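/- Let $n\ge 1$, let $V$ be a complex symplectic vector space of dimension $2n$ with form $\langle\,,\rangle$, and let $V=L\oplus L^*$ with $L,L^*$ Lagrangian. Let $(e,h,f)$ be a regular $\mathfrak{sl}_2$-triple in $\mathfrak{sp}(V)$ with $L=\operatorname{Ker}(f^n)$ and $L^*=\operatorname{Ker}(e^n)$, and let $v_0^*\in L^*\setminus\operatorname{Ker}(e^{n-1})$ satisfy $hv_0^*=v_0^*$ and $\langle v_0^*,fv_0^*\rangle=n^2$. For $v\in V$ let $v^2\in\mathfrak{sp}(V)$ be the operator $w\mapsto\langle v,w\rangle v$. Let $\Sigma_{\mathfrak{sp}}=e+\mathfrak z_{\mathfrak{sp}(V)}(f)$ be the Kostant slice, identified with $\mathfrak{sp}(V)/\!\!/\mathrm{Sp}(V)$, and let $\Sigma_{\mathfrak{gl}}=\mathfrak{gl}(L)/\!\!/\mathrm{GL}(L)$. Put $\Sigma=\Sigma_{\mathfrak{sp}}\times(v_0^*+L)\subset\mathfrak{sp}(V)\oplus V$. Let $$\mathfrak M=(\mathfrak{sp}(V)\oplus V)\times_{\mathfrak{sp}(V)/\!\!/\mathrm{Sp}(V)}\Sigma_{\mathfrak{gl}}$$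 be the fibre product of the map $(x,v)\mapsto[x-v^2]$ and of the map $\Sigma_{\mathfrak{gl}}\to\mathfrak{sp}(V)/\!\!/\mathrm{Sp}(V)$ induced by the embedding of $\mathfrak{gl}(L)$ into $\mathfrak{sp}(V)$ as the Siegel Levi subalgebra, with $\mathrm{Sp}(V)$ acting on the factor $\mathfrak{sp}(V)\oplus V$ by $g\cdot(x,v)=(gxg^{-1},gv)$. Then: (0) For $(x,v)\in\Sigma$ the operator $x-v^2$ preserves $L$; the restriction $\mathbb C[\mathfrak{sp}(V)]^{\mathrm{Sp}(V)}\to\mathbb C[\Sigma_{\mathfrak{sp}}]$ is an isomorphism; and the map $\Sigma\to\mathfrak M$, $(x,v)\mapsto\bigl((x,v),[(x-v^2)|_L]\bigr)$, is a well-defined closed embedding. (1) The map $\mathfrak M\to\mathfrak{sp}(V)/\!\!/\mathrm{Sp}(V)\times\Sigma_{\mathfrak{gl}}=\Sigma_{\mathfrak{sp}}\times\Sigma_{\mathfrak{gl}}$ given by $[x]$ and by the second projection identifies $\mathfrak M/\!\!/\mathrm{Sp}(V)$ with $\Sigma_{\mathfrak{sp}}\times\Sigma_{\mathfrak{gl}}$,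 and $\Sigma\hookrightarrow\mathfrak M$ is a Weierstrass section of the $\mathrm{Sp}(V)$-action, that is, the restriction $\mathbb C[\mathfrak M]^{\mathrm{Sp}(V)}\to\mathbb C[\Sigma]$ is an isomorphism. (2) $\mathbb C[\mathfrak{sp}(V)\oplus V]$ and $\mathbb C[\mathfrak M]$ are domains; the pullback along the action map $\mathrm{Sp}(V)\times\Sigma\to\mathfrak M$, $(g,s)\mapsto g\cdot s$, extends the inclusion $\mathbb C[\mathfrak M]\subset\mathbb C(\mathfrak M)$ uniquely to a homomorphism $\mathbb C[\mathrm{Sp}(V)\times\Sigma]\to\mathbb C(\mathfrak M)$ (i.e. there is a unique $\mathbb C$-algebra homomorphism whose composition with the pullback is that inclusion), and this homomorphism is injective; and with respect to it and to the pullback $\mathbb C(\mathfrak{sp}(V)\oplus V)\to\mathbb C(\mathfrak M)$ one has $$\mathbb C[\mathfrak{sp}(V)\oplus V]=\mathbb C[\mathrm{Sp}(V)\times\Sigma]\times_{\mathbb C(\mathfrak M)}\mathbb C(\mathfrak{sp}(V)\oplus V).$$ -/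

import Mathlib

open scoped TensorProduct

attribute [local instance 100] LieRing.ofAssociativeRing

namespace PseudoSlice

section PolynomialFunctions

/-- The coordinate ring `ℂ[W]` of a finite-dimensional complex vector space `W`: the algebra of
polynomial functions on `W`, that is, the algebra of functions generated by the linear forms. -/
def polyFun (W : Type*) [AddCommGroup W] [Module ℂ W] : Subalgebra ℂ (W → ℂ) :=
  Algebra.adjoin ℂ (Set.range fun ξ : Module.Dual ℂ W => (ξ : W → ℂ))

/-- Composition with a map, as a homomorphism of algebras of functions. -/
def pullback {X Y : Type*} (φ : X → Y) : (Y → ℂ) →ₐ[ℂ] (X → ℂ) where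
  toFun F := F ∘ φ
  map_one' := rfl
  map_mul' _ _ := rfl
  map_zero' := rfl
  map_add' _ _ := rfl
  commutes' _ := rfl

/-- The coordinate ring of a closed subvariety of a vector space `W`, given by an embedding
`j : X → W` of its set of points: the functions on `X` that are restrictions of polynomial
functions on `W`. -/
def regFun {X W : Type*} [AddCommGroup W] [Module ℂ W] (j : X → W) : Subalgebra ℂ (X → ℂ) :=
  (polyFun W).map (pullback j)

theorem dual_mem_polyFun {W : Type*} [AddCommGroup W] [Module ℂ W] (ξ : Module.Dual ℂ W) :
    (ξ : W → ℂ) ∈ polyFun W :=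
  Algebra.subset_adjoin ⟨ξ, rfl⟩

theorem comp_mem_polyFun {W W' : Type*} [AddCommGroup W] [Module ℂ W] [AddCommGroup W']
    [Module ℂ W'] (φ : W → W') (hφ : ∀ ξ : Module.Dual ℂ W', (fun w => ξ (φ w)) ∈ polyFun W)
    {F : W' → ℂ} (hF : F ∈ polyFun W') : (fun w => F (φ w)) ∈ polyFun W := by
  have h : polyFun W' ≤ (polyFun W).comap (pullback φ) := by
    refine Algebra.adjoin_le ?_
    rintro _ ⟨ξ, rfl⟩
    exact hφ ξ
  exact h hF

theorem comp_linear_mem_polyFun {W W' : Type*} [AddCommGroup W] [Module ℂ W] [AddCommGroup W']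
    [Module ℂ W'] (φ : W →ₗ[ℂ] W') {F : W' → ℂ} (hF : F ∈ polyFun W') :
    (fun w => F (φ w)) ∈ polyFun W :=
  comp_mem_polyFun φ (fun ξ => dual_mem_polyFun (ξ ∘ₗ φ)) hF

theorem bilin_mem_polyFun {W : Type*} [AddCommGroup W] [Module ℂ W] [FiniteDimensional ℂ W]
    (β : LinearMap.BilinForm ℂ W) : (fun w => β w w) ∈ polyFun W := by
  let b := Module.finBasis ℂ W
  have h : (fun w => β w w) = ∑ i, (b.coord i : W → ℂ) * (β (b i) : W → ℂ) := by
    funext w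
    simp only [Finset.sum_apply, Pi.mul_apply]
    have hw : β w w = β (∑ i, b.repr w i • b i) w := by rw [b.sum_repr w]
    rw [hw]
    simp only [map_sum, LinearMap.sum_apply, map_smul, LinearMap.smul_apply, smul_eq_mul,
      Module.Basis.coord_apply]
  rw [h]
  exact Subalgebra.sum_mem _ fun i _ =>
    Subalgebra.mul_mem _ (dual_mem_polyFun _) (dual_mem_polyFun _)

end PolynomialFunctions

/-- The data of the construction: a symplectic space `V` of dimension `2n`, two transversal
Lagrangian subspaces `L` and `Ls` (the latter is `L*`), a regular `sl₂`-triple `(e, h, f)` in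
`sp(V)` with `L = Ker fⁿ` and `Ls = Ker eⁿ`, and a vector `v₀ ∈ Ls ∖ Ker eⁿ⁻¹` of `h`-weight `1`
normalized by `⟨v₀, f v₀⟩ = n²`. Regularity of `e` says that its centralizer in `sp(V)` has
dimension `n`, the rank of `sp(V)`. -/
structure Data (n : ℕ) (V : Type*) [AddCommGroup V] [Module ℂ V] where
  ω : LinearMap.BilinForm ℂ V
  alt : ω.IsAlt
  nondeg : ω.Nondegenerate
  finrank_V : Module.finrank ℂ V = 2 * n
  L : Submodule ℂ V
  Ls : Submodule ℂ V
  isCompl : IsCompl L Ls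
  isotropic_L : ∀ u ∈ L, ∀ w ∈ L, ω u w = 0
  isotropic_Ls : ∀ u ∈ Ls, ∀ w ∈ Ls, ω u w = 0
  finrank_L : Module.finrank ℂ L = n
  finrank_Ls : Module.finrank ℂ Ls = n
  e : skewAdjointLieSubalgebra ω
  h : skewAdjointLieSubalgebra ω
  f : skewAdjointLieSubalgebra ω
  triple : IsSl2Triple h e f
  regular : Module.finrank ℂ
    (LinearMap.ker (LieAlgebra.ad ℂ (skewAdjointLieSubalgebra ω) e)) = n
  L_eq : L = LinearMap.ker ((f : Module.End ℂ V) ^ n)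
  Ls_eq : Ls = LinearMap.ker ((e : Module.End ℂ V) ^ n)
  v₀ : V
  v₀_mem : v₀ ∈ Ls
  v₀_notMem : v₀ ∉ LinearMap.ker ((e : Module.End ℂ V) ^ (n - 1))
  h_v₀ : (h : Module.End ℂ V) v₀ = v₀
  form_v₀ : ω v₀ ((f : Module.End ℂ V) v₀) = (n : ℂ) ^ 2

namespace Data

variable {n : ℕ} {V : Type*} [AddCommGroup V] [Module ℂ V] (D : Data n V)

/-- The Lie algebra `sp(V)`. -/
abbrev sp : LieSubalgebra ℂ (Module.End ℂ V) := skewAdjointLieSubalgebra D.ω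

theorem mem_sp (x : Module.End ℂ V) : x ∈ D.sp ↔ ∀ u w, D.ω (x u) w = - D.ω u (x w) := by
  change x ∈ D.ω.skewAdjointSubmodule ↔ _
  rw [LinearMap.mem_skewAdjointSubmodule]
  constructor
  · intro H u w
    simpa using H u w
  · intro H u w
    simpa using H u w

theorem ext_right {a b : Module.End ℂ V} (H : ∀ u w, D.ω u (a w) = D.ω u (b w)) : a = b := by
  ext w
  rw [← sub_eq_zero]
  apply D.nondeg.2
  intro u
  simp [H u w]

/-- The symplectic group `Sp(V)`. -/
def Sp : Subgroup (V ≃ₗ[ℂ] V) where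
  carrier := {g | ∀ u w, D.ω (g u) (g w) = D.ω u w}
  one_mem' _ _ := rfl
  mul_mem' {a b} ha hb u w := by
    change D.ω (a (b u)) (a (b w)) = _
    rw [ha, hb]
  inv_mem' {a} ha u w := by
    have := ha (a⁻¹ u) (a⁻¹ w)
    have h1 : ∀ u, a (a⁻¹ u) = u := fun u => a.apply_symm_apply u
    rwa [h1, h1, eq_comm] at this

theorem conj_mem_sp (g : D.Sp) (x : D.sp) :
    (g : V ≃ₗ[ℂ] V).conj (x : Module.End ℂ V) ∈ D.sp := by
  rw [mem_sp]
  intro u w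
  have hx := (D.mem_sp x).1 x.2 ((g : V ≃ₗ[ℂ] V).symm u) ((g : V ≃ₗ[ℂ] V).symm w)
  rw [← g.2, ← g.2 ((g : V ≃ₗ[ℂ] V).symm u)] at hx
  simpa [LinearEquiv.conj_apply] using hx

/-- The adjoint action of `Sp(V)` on `sp(V)`. -/
def Ad (g : D.Sp) : D.sp →ₗ[ℂ] D.sp :=
  LinearMap.codRestrict D.sp.toSubmodule
    ((g : V ≃ₗ[ℂ] V).conj.toLinearMap ∘ₗ D.sp.toSubmodule.subtype) (D.conj_mem_sp g)

@[simp] theorem Ad_coe (g : D.Sp) (x : D.sp) :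
    (D.Ad g x : Module.End ℂ V) = (g : V ≃ₗ[ℂ] V).conj (x : Module.End ℂ V) := rfl

/-- The action of `Sp(V)` on `sp(V) ⊕ V`, `g · (x, v) = (g x g⁻¹, g v)`. -/
def act (g : D.Sp) : D.sp × V →ₗ[ℂ] D.sp × V :=
  LinearMap.prodMap (D.Ad g) (g : V ≃ₗ[ℂ] V).toLinearMap

theorem sq_mem_sp (v : V) : (D.ω v).smulRight v ∈ D.sp := by
  rw [mem_sp]
  intro u w
  have := D.alt.neg_eq v u
  simp only [LinearMap.smulRight_apply, map_smul, LinearMap.smul_apply, smul_eq_mul]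
  rw [← this]
  ring

/-- The element `v²` of `sp(V) ≅ Sym² V`: the operator `w ↦ ⟨v, w⟩ v`. -/
def sq (v : V) : D.sp := ⟨(D.ω v).smulRight v, D.sq_mem_sp v⟩

/-- The map `sp(V) ⊕ V → sp(V)`, `(x, v) ↦ x - v²`. -/
def shift (p : D.sp × V) : D.sp := p.1 - D.sq p.2

theorem shift_act (g : D.Sp) (p : D.sp × V) : D.shift (D.act g p) = D.Ad g (D.shift p) := by
  have h : D.sq ((g : V ≃ₗ[ℂ] V) p.2) = D.Ad g (D.sq p.2) := by
    apply Subtype.ext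
    ext w
    have := g.2 p.2 ((g : V ≃ₗ[ℂ] V).symm w)
    simp only [LinearEquiv.apply_symm_apply] at this
    simp [sq, LinearEquiv.conj_apply, this]
  change D.Ad g p.1 - D.sq ((g : V ≃ₗ[ℂ] V) p.2) = _
  rw [h, shift, map_sub]

/-! ### The Siegel Levi subalgebra -/

/-- The projection of `V = L ⊕ L*` onto `L`. -/
noncomputable def prL : V →ₗ[ℂ] D.L := D.L.projectionOnto D.Ls D.isCompl

/-- The extension by zero on `L*` of an endomorphism of `L`. -/
noncomputable def extend : Module.End ℂ D.L →ₗ[ℂ] Module.End ℂ V where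
  toFun y := D.L.subtype ∘ₗ y ∘ₗ D.prL
  map_add' _ _ := by ext; simp
  map_smul' _ _ := by ext; simp

/-- The `L`-block `pr_L ∘ x|_L` of an endomorphism `x` of `V`. -/
noncomputable def block (x : Module.End ℂ V) : Module.End ℂ D.L := D.prL ∘ₗ x ∘ₗ D.L.subtype

/-- The map `Σ → gl(L)`, here defined on all of `sp(V) ⊕ V`: the `L`-block of `x - v²`. When
`x - v²` preserves `L`, it is the restriction of `x - v²` to `L`. -/
noncomputable def toGl (p : D.sp × V) : Module.End ℂ D.L :=
  D.block (D.shift p : Module.End ℂ V)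

theorem prL_coe (y : D.L) : D.prL (y : V) = y :=
  Submodule.projectionOnto_apply_left D.isCompl y

@[simp] theorem extend_apply (y : Module.End ℂ D.L) (w : V) :
    D.extend y w = (y (D.prL w) : V) := rfl

theorem extend_mul (a b : Module.End ℂ D.L) : D.extend (a * b) = D.extend a * D.extend b := by
  ext w
  simp [prL_coe]

theorem mem_Ls_of_form (z : V) (hz : ∀ u ∈ D.Ls, D.ω u z = 0) : z ∈ D.Ls := by
  obtain ⟨l, hl, m, hm, rfl⟩ := Submodule.mem_sup.1
    ((D.isCompl.sup_eq_top ▸ Submodule.mem_top : z ∈ D.L ⊔ D.Ls))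
  have h0 : l = 0 := by
    apply D.nondeg.2
    intro u
    obtain ⟨a, ha, b, hb, rfl⟩ := Submodule.mem_sup.1
      ((D.isCompl.sup_eq_top ▸ Submodule.mem_top : u ∈ D.L ⊔ D.Ls))
    have h1 := hz b hb
    rw [map_add, D.isotropic_Ls b hb m hm, add_zero] at h1
    rw [map_add, LinearMap.add_apply, D.isotropic_L a ha l hl, h1, add_zero]
  rw [h0, zero_add]
  exact hm

theorem prL_of_mem_Ls {w : V} (hw : w ∈ D.Ls) : D.prL w = 0 :=
  (Submodule.projectionOnto_apply_eq_zero_iff D.isCompl).2 hw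

variable [FiniteDimensional ℂ V]

/-- The adjoint of an endomorphism of `V` with respect to the symplectic form. -/
noncomputable def adj (a : Module.End ℂ V) : Module.End ℂ V :=
  D.ω.leftAdjointOfNondegenerate D.nondeg a

theorem form_adj (a : Module.End ℂ V) (u w : V) : D.ω (D.adj a u) w = D.ω u (a w) :=
  LinearMap.BilinForm.isAdjointPairLeftAdjointOfNondegenerate D.ω D.nondeg a u w

theorem form_adj' (a : Module.End ℂ V) (u w : V) : D.ω u (D.adj a w) = D.ω (a u) w := by
  rw [← D.alt.neg_eq, form_adj, D.alt.neg_eq]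

theorem adj_add (a b : Module.End ℂ V) : D.adj (a + b) = D.adj a + D.adj b :=
  D.ext_right fun u w => by simp [form_adj']

theorem adj_smul (c : ℂ) (a : Module.End ℂ V) : D.adj (c • a) = c • D.adj a :=
  D.ext_right fun u w => by simp [form_adj']

theorem adj_mul (a b : Module.End ℂ V) : D.adj (a * b) = D.adj b * D.adj a :=
  D.ext_right fun u w => by simp [form_adj']

theorem adj_extend_mem (y : Module.End ℂ D.L) (w : V) : D.adj (D.extend y) w ∈ D.Ls := by
  refine D.mem_Ls_of_form _ fun u hu => ?_
  simp [form_adj', D.prL_of_mem_Ls hu]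

theorem adj_extend_apply_L (y : Module.End ℂ D.L) (u : D.L) : D.adj (D.extend y) u = 0 := by
  apply D.nondeg.2
  intro w
  rw [form_adj']
  exact D.isotropic_L _ (Subtype.mem _) _ u.2

theorem extend_mul_adj (a b : Module.End ℂ D.L) : D.extend a * D.adj (D.extend b) = 0 := by
  ext w
  simp [D.prL_of_mem_Ls (D.adj_extend_mem b w)]

theorem adj_mul_extend (a b : Module.End ℂ D.L) : D.adj (D.extend a) * D.extend b = 0 := by
  refine D.ext_right fun u w => ?_
  simp only [Module.End.mul_apply, form_adj', LinearMap.zero_apply, map_zero]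
  exact D.isotropic_L _ (Subtype.mem _) _ (Subtype.mem _)

theorem levi_mem (y : Module.End ℂ D.L) : D.extend y - D.adj (D.extend y) ∈ D.sp := by
  rw [mem_sp]
  intro u w
  simp only [LinearMap.sub_apply, map_sub, form_adj, form_adj']
  ring

/-- The embedding of `gl(L)` into `sp(V)` as the Siegel Levi subalgebra: an endomorphism `y` of `L`
acts by `y` on `L` and by minus its adjoint on `L*`. -/
noncomputable def levi : Module.End ℂ D.L →ₗ[ℂ] D.sp where
  toFun y := ⟨D.extend y - D.adj (D.extend y), D.levi_mem y⟩
  map_add' a b := by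
    apply Subtype.ext
    simp only [map_add, adj_add]
    change _ = (D.extend a - D.adj (D.extend a)) + (D.extend b - D.adj (D.extend b))
    abel
  map_smul' c a := by
    apply Subtype.ext
    simp only [map_smul, adj_smul]
    exact (smul_sub c _ _).symm

theorem levi_coe (y : Module.End ℂ D.L) :
    (D.levi y : Module.End ℂ V) = D.extend y - D.adj (D.extend y) := rfl

/-- The embedding of `GL(L)` into `Sp(V)` as the Siegel Levi subgroup. -/
theorem exists_leviGroup (g : D.L ≃ₗ[ℂ] D.L) :
    ∃ G : D.Sp, ∀ y : Module.End ℂ D.L, D.levi (g.conj y) = D.Ad G (D.levi y) := by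
  have hone : D.extend 1 + D.adj (D.extend 1) = 1 := by
    refine D.ext_right fun u w => ?_
    obtain ⟨l, hl, m, hm, rfl⟩ := Submodule.mem_sup.1
      ((D.isCompl.sup_eq_top ▸ Submodule.mem_top : w ∈ D.L ⊔ D.Ls))
    obtain ⟨a, ha, b, hb, rfl⟩ := Submodule.mem_sup.1
      ((D.isCompl.sup_eq_top ▸ Submodule.mem_top : u ∈ D.L ⊔ D.Ls))
    have hl' : (D.prL l : V) = l := congrArg Subtype.val (D.prL_coe ⟨l, hl⟩)
    have ha' : (D.prL a : V) = a := congrArg Subtype.val (D.prL_coe ⟨a, ha⟩)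
    simp [form_adj', hl', ha', D.prL_of_mem_Ls hm, D.prL_of_mem_Ls hb, D.isotropic_L a ha l hl,
      D.isotropic_Ls b hb m hm]
  let a : Module.End ℂ D.L := g.toLinearMap
  let b : Module.End ℂ D.L := g.symm.toLinearMap
  have hab : a * b = 1 := by ext; simp [a, b]
  have hba : b * a = 1 := by ext; simp [a, b]
  have key : ∀ a b : Module.End ℂ D.L, a * b = 1 → b * a = 1 →
      (D.extend a + D.adj (D.extend b)) * (D.extend b + D.adj (D.extend a)) = 1 := by
    intro a b hab hba
    rw [add_mul, mul_add, mul_add, ← extend_mul, ← adj_mul, ← extend_mul, extend_mul_adj,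
      adj_mul_extend, hab, add_zero, zero_add, hone]
  let G : V ≃ₗ[ℂ] V := LinearEquiv.ofLinearMap (D.extend a + D.adj (D.extend b))
    (D.extend b + D.adj (D.extend a)) (key a b hab hba) (key b a hba hab)
  refine ⟨⟨G, fun u w => ?_⟩, fun y => ?_⟩
  · have hadj : D.adj (D.extend a + D.adj (D.extend b)) = D.extend b + D.adj (D.extend a) := by
      rw [adj_add, add_comm]
      congr 1
      exact D.ext_right fun u w => by rw [form_adj', form_adj]
    have := D.form_adj' (D.extend a + D.adj (D.extend b)) u
      ((D.extend a + D.adj (D.extend b)) w)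
    rw [hadj] at this
    have h2 := LinearMap.congr_fun (key b a hba hab) w
    rw [Module.End.mul_apply] at h2
    rw [h2] at this
    exact this.symm
  · apply Subtype.ext
    have hy : g.conj y = a * y * b := rfl
    change D.extend (g.conj y) - D.adj (D.extend (g.conj y)) =
      (D.extend a + D.adj (D.extend b)) * (D.extend y - D.adj (D.extend y)) *
        (D.extend b + D.adj (D.extend a))
    rw [hy, extend_mul, extend_mul, adj_mul, adj_mul]
    simp only [add_mul, mul_add, sub_mul, mul_sub, mul_assoc, extend_mul_adj, adj_mul_extend,
      mul_zero]
    simp only [← mul_assoc, add_zero, zero_add]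
    abel

/-! ### Coordinate rings -/

theorem shift_mem_polyFun {F : D.sp → ℂ} (hF : F ∈ polyFun D.sp) :
    (fun p => F (D.shift p)) ∈ polyFun (D.sp × V) := by
  refine comp_mem_polyFun D.shift (fun ξ => ?_) hF
  obtain ⟨η, hη⟩ := LinearMap.exists_extend (p := D.sp.toSubmodule) ξ
  let β : LinearMap.BilinForm ℂ V := LinearMap.mk₂ ℂ (fun u v => η ((D.ω u).smulRight v))
    (by
      intro a b c
      rw [← map_add]; congr 1; ext w; simp [add_smul])
    (by
      intro a b c
      rw [← map_smul]; congr 1; ext w; simp [mul_smul])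
    (by
      intro a b c
      rw [← map_add]; congr 1; ext w; simp)
    (by
      intro a b c
      rw [← map_smul]; congr 1; ext w
      simp only [LinearMap.smulRight_apply, LinearMap.smul_apply]
      exact smul_comm _ _ _)
  have hξ : ∀ x : D.sp, ξ x = η (x : Module.End ℂ V) := fun x => by
    rw [← hη]; rfl
  have h : (fun p : D.sp × V => ξ (D.shift p)) =
      (fun p : D.sp × V => (ξ ∘ₗ LinearMap.fst ℂ D.sp V) p) -
        fun p : D.sp × V => β (LinearMap.snd ℂ D.sp V p) (LinearMap.snd ℂ D.sp V p) := by
    funext p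
    have : ξ (D.sq p.2) = β p.2 p.2 := hξ _
    simp [shift, this]
  rw [h]
  exact Subalgebra.sub_mem _ (dual_mem_polyFun _)
    (comp_linear_mem_polyFun (LinearMap.snd ℂ D.sp V) (bilin_mem_polyFun β))

/-- `ℂ[sp(V) ⊕ V]`. -/
def CoordX : Type _ := polyFun (D.sp × V)

instance : CommRing D.CoordX := inferInstanceAs (CommRing (polyFun (D.sp × V)))

instance : Algebra ℂ D.CoordX := inferInstanceAs (Algebra ℂ (polyFun (D.sp × V)))

instance : CoeFun D.CoordX fun _ => D.sp × V → ℂ := ⟨fun F => F.1⟩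

/-- The algebra of invariants `ℂ[sp(V)]^Sp(V)`, as a subalgebra of the algebra of functions. -/
def invSp : Subalgebra ℂ (D.sp → ℂ) where
  carrier := {F | F ∈ polyFun D.sp ∧ ∀ (g : D.Sp) (x : D.sp), F (D.Ad g x) = F x}
  mul_mem' ha hb := ⟨Subalgebra.mul_mem _ ha.1 hb.1, fun g x => by
    simp only [Pi.mul_apply, ha.2 g x, hb.2 g x]⟩
  add_mem' ha hb := ⟨Subalgebra.add_mem _ ha.1 hb.1, fun g x => by
    simp only [Pi.add_apply, ha.2 g x, hb.2 g x]⟩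
  algebraMap_mem' c := ⟨Subalgebra.algebraMap_mem _ c, fun _ _ => rfl⟩

/-- The algebra of invariants `ℂ[gl(L)]^GL(L)`, as a subalgebra of the algebra of functions. -/
def invGl : Subalgebra ℂ (Module.End ℂ D.L → ℂ) where
  carrier := {F | F ∈ polyFun (Module.End ℂ D.L) ∧
    ∀ (g : D.L ≃ₗ[ℂ] D.L) (y : Module.End ℂ D.L), F (g.conj y) = F y}
  mul_mem' ha hb := ⟨Subalgebra.mul_mem _ ha.1 hb.1, fun g x => by
    simp only [Pi.mul_apply, ha.2 g x, hb.2 g x]⟩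
  add_mem' ha hb := ⟨Subalgebra.add_mem _ ha.1 hb.1, fun g x => by
    simp only [Pi.add_apply, ha.2 g x, hb.2 g x]⟩
  algebraMap_mem' c := ⟨Subalgebra.algebraMap_mem _ c, fun _ _ => rfl⟩

/-- `ℂ[sp(V)]^Sp(V)`, the coordinate ring of `sp(V)//Sp(V)`. -/
def InvSp : Type _ := D.invSp

instance : CommRing D.InvSp := inferInstanceAs (CommRing D.invSp)

instance : Algebra ℂ D.InvSp := inferInstanceAs (Algebra ℂ D.invSp)

instance : CoeFun D.InvSp fun _ => D.sp → ℂ := ⟨fun F => F.1⟩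

/-- `ℂ[gl(L)]^GL(L)`, the coordinate ring of `Σ_gl = gl(L)//GL(L)`. -/
def InvGl : Type _ := D.invGl

instance : CommRing D.InvGl := inferInstanceAs (CommRing D.invGl)

instance : Algebra ℂ D.InvGl := inferInstanceAs (Algebra ℂ D.invGl)

instance : CoeFun D.InvGl fun _ => Module.End ℂ D.L → ℂ := ⟨fun F => F.1⟩

/-- The homomorphism of algebras dual to `(x, v) ↦ [x - v²]`, from `sp(V) ⊕ V` to
`sp(V)//Sp(V)`. -/
def shiftHom : D.InvSp →ₐ[ℂ] D.CoordX :=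
  ((pullback D.shift).comp D.invSp.val).codRestrict (polyFun (D.sp × V))
    fun F => D.shift_mem_polyFun F.2.1

/-- The homomorphism of algebras dual to `(x, v) ↦ [x]`, from `sp(V) ⊕ V` to `sp(V)//Sp(V)`. -/
def fstHom : D.InvSp →ₐ[ℂ] D.CoordX :=
  ((pullback Prod.fst).comp D.invSp.val).codRestrict (polyFun (D.sp × V)) fun F =>
    comp_linear_mem_polyFun (LinearMap.fst ℂ D.sp V) F.2.1

/-- The homomorphism of algebras dual to `Σ_gl = gl(L)//GL(L) → sp(V)//Sp(V)`, the map induced by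
the embedding `gl(L) → sp(V)`. -/
noncomputable def leviHom : D.InvSp →ₐ[ℂ] D.InvGl :=
  ((pullback D.levi).comp D.invSp.val).codRestrict D.invGl fun F =>
    ⟨comp_linear_mem_polyFun D.levi F.2.1, fun g y => by
      obtain ⟨G, hG⟩ := D.exists_leviGroup g
      change (F : D.sp → ℂ) (D.levi (g.conj y)) = (F : D.sp → ℂ) (D.levi y)
      rw [hG, F.2.2]⟩

noncomputable instance : Algebra D.InvSp D.CoordX := D.shiftHom.toRingHom.toAlgebra

noncomputable instance : Algebra D.InvSp D.InvGl := D.leviHom.toRingHom.toAlgebra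

instance : IsScalarTower ℂ D.InvSp D.CoordX :=
  IsScalarTower.of_algebraMap_eq' D.shiftHom.comp_algebraMap.symm

instance : IsScalarTower ℂ D.InvSp D.InvGl :=
  IsScalarTower.of_algebraMap_eq' D.leviHom.comp_algebraMap.symm

/-- `ℂ[𝔐]`, the coordinate ring of the fibre product `𝔐 = (sp(V) ⊕ V) ×_{sp(V)//Sp(V)} Σ_gl` of
`(x, v) ↦ [x - v²]` and of `Σ_gl → sp(V)//Sp(V)`. -/
abbrev CoordM : Type _ := D.CoordX ⊗[D.InvSp] D.InvGl

/-- The action of `Sp(V)` on `ℂ[sp(V) ⊕ V]`, by translations of functions. -/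
def actX (g : D.Sp) : D.CoordX →ₐ[D.InvSp] D.CoordX where
  toFun F := ⟨fun p => F (D.act g p), comp_linear_mem_polyFun (D.act g) F.2⟩
  map_one' := rfl
  map_mul' _ _ := rfl
  map_zero' := rfl
  map_add' _ _ := rfl
  commutes' F := by
    apply Subtype.ext
    funext p
    change F (D.shift (D.act g p)) = F (D.shift p)
    rw [shift_act, F.2.2]

/-- The action of `Sp(V)` on `ℂ[𝔐]`, through the factor `sp(V) ⊕ V` of `𝔐`. -/
noncomputable def actM (g : D.Sp) : D.CoordM →ₐ[D.InvSp] D.CoordM :=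
  Algebra.TensorProduct.map (D.actX g) (AlgHom.id D.InvSp D.InvGl)

/-- The algebra of invariants `ℂ[𝔐]^Sp(V)`, the coordinate ring of `𝔐//Sp(V)`. -/
noncomputable def invM : Subalgebra ℂ D.CoordM :=
  ⨅ g : D.Sp, AlgHom.equalizer ((D.actM g).restrictScalars ℂ) (AlgHom.id ℂ D.CoordM)

/-- The homomorphism `ℂ[sp(V)]^Sp(V) ⊗ ℂ[gl(L)]^GL(L) → ℂ[𝔐]`, dual to the map from `𝔐` to
`sp(V)//Sp(V) × gl(L)//GL(L)` given by `[x]` and by the second projection of `𝔐`. -/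
noncomputable def quotHom : D.InvSp ⊗[ℂ] D.InvGl →ₐ[ℂ] D.CoordM :=
  Algebra.TensorProduct.productMap
    ((Algebra.TensorProduct.includeLeft : D.CoordX →ₐ[ℂ] D.CoordM).comp D.fstHom)
    ((Algebra.TensorProduct.includeRight : D.InvGl →ₐ[D.InvSp] D.CoordM).restrictScalars ℂ)

/-! ### The pseudo-slice -/

/-- The Kostant slice `Σ_sp = e + z(f)`, where `z(f)` is the centralizer of `f` in `sp(V)`. -/
def KostantSlice : Set D.sp := {x | ⁅D.f, x - D.e⁆ = 0}

/-- The pseudo-slice `Σ = Σ_sp × (v₀ + L)`. -/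
def Slice : Set (D.sp × V) := {p | p.1 ∈ D.KostantSlice ∧ p.2 - D.v₀ ∈ D.L}

/-- `ℂ[Σ_sp]`. -/
abbrev CoordKostant : Type _ := regFun (Subtype.val : D.KostantSlice → D.sp)

/-- `ℂ[Σ]`. -/
abbrev CoordSlice : Type _ := regFun (Subtype.val : D.Slice → D.sp × V)

/-- `ℂ[Sp(V) × Σ]`, with `Sp(V) × Σ` embedded in `End(V) × (sp(V) ⊕ V)`. -/
abbrev CoordSpSlice : Type _ :=
  regFun fun q : D.Sp × D.Slice =>
    (((q.1 : V ≃ₗ[ℂ] V) : Module.End ℂ V), (q.2 : D.sp × V))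

/-- The restriction homomorphism `ℂ[sp(V)]^Sp(V) → ℂ[Σ_sp]`. -/
def kostantHom : D.InvSp →ₐ[ℂ] D.CoordKostant :=
  ((pullback (Subtype.val : D.KostantSlice → D.sp)).comp D.invSp.val).codRestrict
    (regFun (Subtype.val : D.KostantSlice → D.sp)) fun F => ⟨F.1, F.2.1, rfl⟩

/-- `ι : ℂ[𝔐] → ℂ[Σ]` is dual to the map `Σ → 𝔐` whose components are the embedding of `Σ` into
`sp(V) ⊕ V` and `(x, v) ↦ [(x - v²)|_L]`, from `Σ` to `Σ_gl`. -/
def IsSliceHom (ι : D.CoordM →ₐ[ℂ] D.CoordSlice) : Prop :=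
  (∀ (F : D.CoordX) (s : D.Slice),
    (ι (F ⊗ₜ[D.InvSp] (1 : D.InvGl))).1 s = F s.1) ∧
  ∀ (P : D.InvGl) (s : D.Slice),
    (ι ((1 : D.CoordX) ⊗ₜ[D.InvSp] P)).1 s = P (D.toGl s.1)

/-- `μ : ℂ[𝔐] → ℂ[Sp(V) × Σ]` is dual to the map `Sp(V) × Σ → 𝔐`, `(g, s) ↦ g · s`, where
`Σ` maps to `𝔐` as above. -/
def IsOrbitHom (μ : D.CoordM →ₐ[ℂ] D.CoordSpSlice) : Prop :=
  (∀ (F : D.CoordX) (g : D.Sp) (s : D.Slice),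
    (μ (F ⊗ₜ[D.InvSp] (1 : D.InvGl))).1 (g, s) = F (D.act g s.1)) ∧
  ∀ (P : D.InvGl) (g : D.Sp) (s : D.Slice),
    (μ ((1 : D.CoordX) ⊗ₜ[D.InvSp] P)).1 (g, s) = P (D.toGl s.1)

end Data

end PseudoSlice

/-! Everything is governed by two characteristic polynomials, that of `x` and that of `(x - v²)|_L`.
In the basis `f^k u`, with `u` a highest weight vector, a point of the Kostant slice has a
Hessenberg matrix, `L` is spanned by the last `n` basis vectors and `v₀` is the vector just before
them. The normalization `n²` makes `v²` cancel the only entry of `x` that leads out of `L`. Hence `x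
- v²` preserves `L`, and its restriction is again Hessenberg, with the free coordinates of `v` in
the first column. The coefficients of the characteristic polynomial of such a matrix are triangular
in the variables (`IsHessenberg.charpoly_coeff`), so the `2n` coefficients are coordinates on `Σ`
(`sliceEquiv`), that is, `Σ = Σ_sp × Σ_gl`.

A perturbation of rank one is controlled by its moments: the characteristic polynomials of `x` and
`x - v²` determine all `⟨v, x^k v⟩`. If `v` is cyclic for `x`, these numbers determine `(x, v)` up
to `Sp(V)` (`exists_act_eq`). A point of `Σ_gl` over `[x - v²]` is a factorization of an even
polynomial as `(-1)^n q(X) q(-X)`, and each choice of `q` is realized on `Σ`. Thus every point of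
`𝔐` over a cyclic pair lies on an orbit of `Σ` (`exists_act_slice`). Cyclic pairs are dense, which
gives the invariants of `sp(V)` and of `gl(L)`.

The ring `ℂ[𝔐]` is a tensor product, so that its functions are determined by their values needs
proof (`eq_zero_of_evalM`): it is spanned over `ℂ[sp(V) ⊕ V]` by `2^n` squarefree monomials, and
over a generic point the fibre contains `2^n` points, one for each choice of signs of the
eigenvalues, on which these monomials are independent. Consequently `ℂ[𝔐]` embeds in `ℂ[Sp(V) × Σ]`,
which is a domain because `Sp(V)` is generated by transvections; the invariants follow by
restriction to `Σ`. Conversely `g` is a rational function of `g · s`, obtained by comparing the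
iterates of the vectors (`isFraction_entry`), so `ℂ[Sp(V) × Σ]` embeds in `ℂ(𝔐)`.

For the fibre product, let `a/c` be a reduced fraction on `sp(V) ⊕ V` that becomes regular on `Sp(V)
× Σ`. A prime factor `π` of `c` would have a zero on the orbits of `Σ` where `a ≠ 0`
(`exists_zero_of_prime`), a contradiction. If `π` does not divide the determinant detecting cyclic
vectors, a generic zero of `π` is a cyclic pair. Otherwise a generic zero of `π` has `x` regular
semisimple and exactly one eigencoordinate of `v` equal to zero; such pairs still lie on the orbits,
provided the sign of one eigenvalue on `L` is chosen suitably. -/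

namespace PseudoSlice

/-! ### Polynomial maps between vector spaces -/

section PolynomialMaps

variable {W W₁ W₂ W₃ : Type*} [AddCommGroup W] [Module ℂ W] [AddCommGroup W₁] [Module ℂ W₁]
  [AddCommGroup W₂] [Module ℂ W₂] [AddCommGroup W₃] [Module ℂ W₃]

/-- A map between vector spaces is polynomial if its composites with linear forms are. -/
def IsPolyMap (φ : W → W₁) : Prop := ∀ ξ : Module.Dual ℂ W₁, (fun w => ξ (φ w)) ∈ polyFun W

theorem IsPolyMap.comp_mem {φ : W → W₁} (hφ : IsPolyMap φ) {F : W₁ → ℂ} (hF : F ∈ polyFun W₁) :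
    (fun w => F (φ w)) ∈ polyFun W := comp_mem_polyFun φ hφ hF

theorem IsPolyMap.comp {ψ : W₁ → W₂} {φ : W → W₁} (hψ : IsPolyMap ψ) (hφ : IsPolyMap φ) :
    IsPolyMap fun w => ψ (φ w) := fun ξ => hφ.comp_mem (hψ ξ)

theorem isPolyMap_linear (φ : W →ₗ[ℂ] W₁) : IsPolyMap φ := fun ξ => dual_mem_polyFun (ξ ∘ₗ φ)

theorem isPolyMap_id : IsPolyMap fun w : W => w := isPolyMap_linear LinearMap.id

theorem IsPolyMap.linear {φ : W → W₁} (hφ : IsPolyMap φ) (T : W₁ →ₗ[ℂ] W₂) :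
    IsPolyMap fun w => T (φ w) := (isPolyMap_linear T).comp hφ

theorem const_mem_polyFun (c : ℂ) : (fun _ : W => c) ∈ polyFun W :=
  Subalgebra.algebraMap_mem (polyFun W) c

theorem isPolyMap_const (c : W₁) : IsPolyMap fun _ : W => c := fun ξ => const_mem_polyFun (ξ c)

theorem IsPolyMap.add {φ ψ : W → W₁} (hφ : IsPolyMap φ) (hψ : IsPolyMap ψ) :
    IsPolyMap fun w => φ w + ψ w := fun ξ => by
  simpa using! Subalgebra.add_mem _ (hφ ξ) (hψ ξ)

theorem IsPolyMap.sum {ι : Type*} {s : Finset ι} {φ : ι → W → W₁}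
    (hφ : ∀ i ∈ s, IsPolyMap (φ i)) : IsPolyMap fun w => ∑ i ∈ s, φ i w := fun ξ => by
  have := Subalgebra.sum_mem (polyFun W) (t := s) (f := fun i w => ξ (φ i w))
    fun i hi => hφ i hi ξ
  convert this using 1
  funext w
  simp

theorem isPolyMap_scalar {F : W → ℂ} : IsPolyMap F ↔ F ∈ polyFun W := by
  refine ⟨fun h => h LinearMap.id, fun h ξ => ?_⟩
  have : (fun w => ξ (F w)) = (ξ 1) • F := by
    funext w
    have := ξ.map_smul (F w) 1
    simp only [smul_eq_mul, mul_one] at this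
    simp [this, mul_comm]
  rw [this]
  exact Subalgebra.smul_mem _ h _

theorem mul_mem_polyFun {F G : W → ℂ} (hF : F ∈ polyFun W) (hG : G ∈ polyFun W) :
    (fun w => F w * G w) ∈ polyFun W := Subalgebra.mul_mem _ hF hG

theorem prod_mem_polyFun {ι : Type*} {s : Finset ι} {F : ι → W → ℂ}
    (hF : ∀ i ∈ s, F i ∈ polyFun W) : (fun w => ∏ i ∈ s, F i w) ∈ polyFun W := by
  convert Subalgebra.prod_mem (polyFun W) hF using 1
  funext w
  simp

/-- A bilinear expression in two polynomial maps is polynomial. -/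
theorem IsPolyMap.bilin [FiniteDimensional ℂ W₁] (B : W₁ →ₗ[ℂ] W₂ →ₗ[ℂ] W₃) {φ : W → W₁}
    {ψ : W → W₂} (hφ : IsPolyMap φ) (hψ : IsPolyMap ψ) : IsPolyMap fun w => B (φ w) (ψ w) := by
  intro ξ
  let b := Module.finBasis ℂ W₁
  have h : (fun w => ξ (B (φ w) (ψ w))) =
      ∑ i, (fun w => b.coord i (φ w)) * fun w => (ξ ∘ₗ B (b i)) (ψ w) := by
    funext w
    have hw : ξ (B (φ w) (ψ w)) = ξ (B (∑ i, b.repr (φ w) i • b i) (ψ w)) := by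
      rw [b.sum_repr (φ w)]
    rw [hw]
    simp only [map_sum, LinearMap.sum_apply, map_smul, LinearMap.smul_apply, smul_eq_mul]
    simp
  rw [h]
  exact Subalgebra.sum_mem _ fun i _ => Subalgebra.mul_mem _ (hφ _) (hψ _)

theorem IsPolyMap.smul {F : W → ℂ} {φ : W → W₁} (hF : F ∈ polyFun W) (hφ : IsPolyMap φ) :
    IsPolyMap fun w => F w • φ w :=
  IsPolyMap.bilin (LinearMap.lsmul ℂ W₁) (isPolyMap_scalar.2 hF) hφ

theorem IsPolyMap.prodMk {φ : W → W₁} {ψ : W → W₂} (hφ : IsPolyMap φ) (hψ : IsPolyMap ψ) :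
    IsPolyMap fun w => (φ w, ψ w) := by
  intro ξ
  have : (fun w => ξ (φ w, ψ w)) = (fun w => (ξ ∘ₗ LinearMap.inl ℂ W₁ W₂) (φ w)) +
      fun w => (ξ ∘ₗ LinearMap.inr ℂ W₁ W₂) (ψ w) := by
    funext w
    simp [← map_add]
  rw [this]
  exact Subalgebra.add_mem _ (hφ _) (hψ _)

theorem IsPolyMap.pi {ι : Type*} [Fintype ι] {φ : W → ι → ℂ}
    (hφ : ∀ i, (fun w => φ w i) ∈ polyFun W) : IsPolyMap φ := by
  classical
  have : φ = fun w => ∑ i, φ w i • Pi.single (M := fun _ : ι => ℂ) i 1 := by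
    funext w j
    simp [Finset.sum_apply, Pi.single_apply]
  rw [this]
  exact IsPolyMap.sum fun i _ => IsPolyMap.smul (hφ i) (isPolyMap_const _)

theorem IsPolyMap.subtype (S : Submodule ℂ W₁) {φ : W → S}
    (h : IsPolyMap fun w => (φ w : W₁)) : IsPolyMap φ := fun ξ => by
  obtain ⟨η, hη⟩ := LinearMap.exists_extend ξ
  simpa [← hη] using! h η

theorem IsPolyMap.mul [FiniteDimensional ℂ W₁] {φ ψ : W → Module.End ℂ W₁} (hφ : IsPolyMap φ)
    (hψ : IsPolyMap ψ) : IsPolyMap fun w => φ w * ψ w :=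
  IsPolyMap.bilin (LinearMap.mul ℂ (Module.End ℂ W₁)) hφ hψ

theorem IsPolyMap.pow [FiniteDimensional ℂ W₁] {φ : W → Module.End ℂ W₁} (hφ : IsPolyMap φ)
    (k : ℕ) : IsPolyMap fun w => φ w ^ k := by
  induction k with
  | zero => simpa using isPolyMap_const _
  | succ k ih => simpa only [pow_succ] using ih.mul hφ

theorem IsPolyMap.apply [FiniteDimensional ℂ W₁] {φ : W → Module.End ℂ W₁} {ψ : W → W₁}
    (hφ : IsPolyMap φ) (hψ : IsPolyMap ψ) : IsPolyMap fun w => φ w (ψ w) :=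
  IsPolyMap.bilin (W₁ := Module.End ℂ W₁) LinearMap.id hφ hψ

/-- Evaluation at a point, on the algebra of polynomial functions. -/
def evalAt (w : W) : polyFun W →ₐ[ℂ] ℂ := (Pi.evalAlgHom ℂ (fun _ : W => ℂ) w).comp (polyFun W).val

section Matrices

variable {m : Type*} [Fintype m] [DecidableEq m] {A : W → Matrix m m ℂ}

/-- Determinants commute with ring homomorphisms, so the determinant can be formed over the ring
`polyFun W` and then evaluated at a point. The next two lemmas use the same device. -/
theorem det_mem_polyFun (hA : ∀ i j, (fun w => A w i j) ∈ polyFun W) :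
    (fun w => (A w).det) ∈ polyFun W := by
  let B : Matrix m m (polyFun W) := fun i j => ⟨_, hA i j⟩
  convert B.det.2 using 1
  funext w
  exact (RingHom.map_det (evalAt w).toRingHom B).symm

theorem charpoly_coeff_mem_polyFun_matrix (hA : ∀ i j, (fun w => A w i j) ∈ polyFun W) (k : ℕ) :
    (fun w => (A w).charpoly.coeff k) ∈ polyFun W := by
  let B : Matrix m m (polyFun W) := fun i j => ⟨_, hA i j⟩
  convert (B.charpoly.coeff k).2 using 1
  funext w
  have h : A w = B.map (evalAt w).toRingHom := rfl
  rw [h, Matrix.charpoly_map, Polynomial.coeff_map]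
  rfl

theorem adjugate_mem_polyFun (hA : ∀ i j, (fun w => A w i j) ∈ polyFun W) (i j : m) :
    (fun w => (A w).adjugate i j) ∈ polyFun W := by
  let B : Matrix m m (polyFun W) := fun i j => ⟨_, hA i j⟩
  convert (B.adjugate i j).2 using 1
  funext w
  exact congrFun (congrFun (RingHom.map_adjugate (evalAt w).toRingHom B).symm i) j

end Matrices

theorem IsPolyMap.det [FiniteDimensional ℂ W₁] {φ : W → Module.End ℂ W₁} (hφ : IsPolyMap φ) :
    (fun w => LinearMap.det (φ w)) ∈ polyFun W := by
  let b := Module.finBasis ℂ W₁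
  have : (fun w => LinearMap.det (φ w)) = fun w => (LinearMap.toMatrix b b (φ w)).det := by
    funext w
    exact (LinearMap.det_toMatrix b (φ w)).symm
  rw [this]
  refine det_mem_polyFun fun i j => ?_
  simpa [LinearMap.toMatrix_apply] using (hφ.apply (isPolyMap_const (b j))) (b.coord i)

theorem IsPolyMap.charpoly_coeff [FiniteDimensional ℂ W₁] {φ : W → Module.End ℂ W₁}
    (hφ : IsPolyMap φ) (k : ℕ) : (fun w => (φ w).charpoly.coeff k) ∈ polyFun W := by
  let b := Module.finBasis ℂ W₁
  have : (fun w => (φ w).charpoly.coeff k) =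
      fun w => (LinearMap.toMatrix b b (φ w)).charpoly.coeff k := by
    funext w
    rw [LinearMap.charpoly_toMatrix]
  rw [this]
  refine charpoly_coeff_mem_polyFun_matrix (fun i j => ?_) k
  simpa [LinearMap.toMatrix_apply] using (hφ.apply (isPolyMap_const (b j))) (b.coord i)

end PolynomialMaps

/-! ### Coordinate rings of vector spaces as polynomial rings -/

section PolynomialRing

variable {W : Type*} [AddCommGroup W] [Module ℂ W] {ι : Type*} (b : Module.Basis ι ℂ W)

/-- Polynomials in the coordinates with respect to a basis, as polynomial functions. -/
noncomputable def ofMvPolynomial : MvPolynomial ι ℂ →ₐ[ℂ] polyFun W :=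
  MvPolynomial.aeval fun i => ⟨b.coord i, dual_mem_polyFun _⟩

theorem ofMvPolynomial_apply (P : MvPolynomial ι ℂ) (w : W) :
    (ofMvPolynomial b P).1 w = MvPolynomial.eval (b.repr w) P := by
  have : (evalAt w).comp (ofMvPolynomial b) = MvPolynomial.aeval (b.repr w) := by
    ext i
    simp [ofMvPolynomial, evalAt]
  exact DFunLike.congr_fun this P

theorem ofMvPolynomial_bijective [Finite ι] : Function.Bijective (ofMvPolynomial b) := by
  cases nonempty_fintype ι
  constructor
  · intro P Q h
    apply MvPolynomial.funext
    intro x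
    have := congrArg (fun F => F.1 (b.equivFun.symm x)) h
    simpa only [ofMvPolynomial_apply, ← b.equivFun_apply, LinearEquiv.apply_symm_apply] using! this
  · have : polyFun W ≤ ((polyFun W).val.comp (ofMvPolynomial b)).range := by
      refine Algebra.adjoin_le ?_
      rintro _ ⟨ξ, rfl⟩
      refine ⟨∑ i, MvPolynomial.C (ξ (b i)) * MvPolynomial.X i, ?_⟩
      funext w
      refine (ofMvPolynomial_apply b _ w).trans ?_
      have hw : ξ w = ξ (∑ i, b.repr w i • b i) := by rw [b.sum_repr w]
      refine Eq.trans ?_ hw.symm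
      simp only [map_sum, map_smul, smul_eq_mul]
      simp [mul_comm]
    rintro ⟨F, hF⟩
    obtain ⟨P, hP⟩ := this hF
    exact ⟨P, Subtype.ext hP⟩

/-- The coordinate ring of a vector space is a polynomial ring. -/
noncomputable def mvPolynomialEquiv [Finite ι] : MvPolynomial ι ℂ ≃ₐ[ℂ] polyFun W :=
  AlgEquiv.ofBijective (ofMvPolynomial b) (ofMvPolynomial_bijective b)

theorem exists_mvPolynomial [Finite ι] {F : W → ℂ} (hF : F ∈ polyFun W) :
    ∃ P : MvPolynomial ι ℂ, ∀ w, F w = MvPolynomial.eval (b.repr w) P := by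
  obtain ⟨P, hP⟩ := (ofMvPolynomial_bijective b).2 ⟨F, hF⟩
  exact ⟨P, fun w => by rw [← ofMvPolynomial_apply, hP]⟩

theorem eval_mem_polyFun (P : MvPolynomial ι ℂ) :
    (fun w => MvPolynomial.eval (b.repr w) P) ∈ polyFun W := by
  convert (ofMvPolynomial b P).2 using 1
  funext w
  exact (ofMvPolynomial_apply b P w).symm

variable (W) [FiniteDimensional ℂ W]

instance : IsDomain (polyFun W) :=
  (mvPolynomialEquiv (Module.finBasis ℂ W)).symm.toMulEquiv.isDomain _

instance : UniqueFactorizationMonoid (polyFun W) :=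
  (mvPolynomialEquiv (Module.finBasis ℂ W)).toMulEquiv.uniqueFactorizationMonoid inferInstance

variable {W}

theorem polyFun_eq_zero_or {F G : W → ℂ} (hF : F ∈ polyFun W) (hG : G ∈ polyFun W)
    (h : ∀ w, F w * G w = 0) : F = 0 ∨ G = 0 := by
  have : (⟨F, hF⟩ : polyFun W) * ⟨G, hG⟩ = 0 := Subtype.ext (funext h)
  rcases mul_eq_zero.1 this with h | h
  · exact Or.inl (congrArg Subtype.val h)
  · exact Or.inr (congrArg Subtype.val h)

/-- A polynomial function that vanishes where another, nonzero, one does not, vanishes. -/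
theorem polyFun_eq_zero_of_dense {F G : W → ℂ} (hF : F ∈ polyFun W) (hG : G ∈ polyFun W)
    (hG0 : ∃ w, G w ≠ 0) (h : ∀ w, G w ≠ 0 → F w = 0) (w : W) : F w = 0 := by
  rcases polyFun_eq_zero_or hF hG fun w => by
    by_cases hw : G w = 0
    · rw [hw, mul_zero]
    · rw [h w hw, zero_mul] with h | h
  · exact congrFun h w
  · obtain ⟨u, hu⟩ := hG0
    exact absurd (congrFun h u) hu

/-- The Nullstellensatz for a hypersurface. -/
theorem prime_dvd_of_vanish {π F : polyFun W} (hπ : Prime π)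
    (h : ∀ w, π.1 w = 0 → F.1 w = 0) : π ∣ F := by
  let b := Module.finBasis ℂ W
  let E := mvPolynomialEquiv b
  have hE : ∀ (G : polyFun W) (x : Fin (Module.finrank ℂ W) → ℂ),
      MvPolynomial.eval x (E.symm G) = G.1 (b.equivFun.symm x) := by
    intro G x
    have := ofMvPolynomial_apply b (E.symm G) (b.equivFun.symm x)
    rw [← b.equivFun_apply, LinearEquiv.apply_symm_apply] at this
    rw [← this]
    exact congrArg (fun F : polyFun W => F.1 (b.equivFun.symm x)) (E.apply_symm_apply G)
  have hp : Prime (E.symm π) := (MulEquiv.prime_iff E.symm.toMulEquiv).2 hπ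
  have hI : (Ideal.span {E.symm π}).IsPrime := (Ideal.span_singleton_prime hp.ne_zero).2 hp
  have key : E.symm F ∈ (Ideal.span {E.symm π}).radical := by
    rw [← MvPolynomial.vanishingIdeal_zeroLocus_eq_radical (K := ℂ),
      MvPolynomial.mem_vanishingIdeal_iff]
    intro x hx
    have := hx _ (Ideal.mem_span_singleton_self _)
    have ev : ∀ Q : MvPolynomial _ ℂ, MvPolynomial.aeval x Q = MvPolynomial.eval x Q := fun Q =>
      DFunLike.congr_fun (MvPolynomial.coe_aeval_eq_eval x) Q
    rw [ev, hE] at this ⊢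
    exact h _ this
  rw [hI.radical, Ideal.mem_span_singleton] at key
  obtain ⟨c, hc⟩ := key
  exact ⟨E c, by rw [← E.apply_symm_apply F, hc, map_mul, E.apply_symm_apply]⟩

/-- A polynomial function on a line is given by a polynomial in one variable. -/
theorem exists_polynomial_line {F : W → ℂ} (hF : F ∈ polyFun W) (u w : W) :
    ∃ P : Polynomial ℂ, ∀ t : ℂ, F (u + t • w) = P.eval t := by
  obtain ⟨P, hP⟩ := exists_mvPolynomial (Module.finBasis ℂ W) hF
  let b := Module.finBasis ℂ W
  refine ⟨MvPolynomial.aeval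
    (fun i => Polynomial.C (b.repr u i) + Polynomial.X * Polynomial.C (b.repr w i)) P, fun t => ?_⟩
  have h : (Polynomial.aeval t).comp (MvPolynomial.aeval
      (fun i => Polynomial.C (b.repr u i) + Polynomial.X * Polynomial.C (b.repr w i))) =
      MvPolynomial.aeval (b.repr (u + t • w)) := by
    ext i
    simp
    ring
  rw [hP]
  exact (DFunLike.congr_fun h P).symm

/-- A polynomial function without zeros on a line is constant on it. -/
theorem line_const_of_ne_zero {F : W → ℂ} (hF : F ∈ polyFun W) (u w : W)
    (h : ∀ t : ℂ, F (u + t • w) ≠ 0) (t : ℂ) : F (u + t • w) = F u := by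
  obtain ⟨P, hP⟩ := exists_polynomial_line hF u w
  have hdeg : P.degree = 0 := by
    by_contra hd
    obtain ⟨z, hz⟩ := IsAlgClosed.exists_root P hd
    exact h z ((hP z).trans hz)
  have h0 := hP 0
  rw [zero_smul, add_zero] at h0
  rw [hP, h0, Polynomial.eq_C_of_degree_eq_zero hdeg]
  simp

end PolynomialRing

end PseudoSlice

namespace PseudoSlice

/-! ### Characteristic polynomials of Hessenberg matrices -/

section Hessenberg

variable {R : Type*} [CommRing R] [Algebra ℂ R] {M : ℕ} (H : Matrix (Fin M) (Fin M) R)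
  (A : ℕ → Subalgebra ℂ R) (y : ℕ → R) (ε : ℕ → ℝ)

/-- A Hessenberg matrix whose entry in position `(i, j)`, `j ≤ i`, is a nonnegative multiple of the
variable `y (i + 1 - j)` up to an expression in earlier variables. -/
structure IsHessenberg : Prop where
  mono : Monotone A
  mem : ∀ k, y k ∈ A (k + 1)
  pos : ∀ m, 0 < m → m < M → 0 < ε m
  eq_above : ∀ i j : Fin M, (j : ℕ) = i + 1 → H i j = algebraMap ℂ R (ε j)
  eq_zero : ∀ i j : Fin M, (i : ℕ) + 1 < j → H i j = 0
  below : ∀ i j : Fin M, (j : ℕ) ≤ i → ∃ ρ : ℝ, 0 ≤ ρ ∧ ((j : ℕ) = 0 → ρ = 1) ∧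
    H i j - (ρ : ℂ) • y (i + 1 - j) ∈ A (i + 1 - j)

variable {H A y ε}

/-- The entry `(m, M - 1)` of `H ^ N` is a sum over paths of `N` steps from `m` to `M - 1`, where a
step raises the index by at most one. Too few steps give zero; exactly enough steps give the product
of the superdiagonal entries. With excess `d`, the variable `y d` enters only through paths with a
single nonascending step, which uses up the whole excess; everything else involves earlier
variables. Nonnegativity of the multiples excludes cancellation. For `N = M` the path that first
drops to `0` and then climbs contributes a positive amount. -/
theorem IsHessenberg.pow_entry (h : IsHessenberg H A y ε) (hM : 0 < M) (N : ℕ) :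
    (∀ m : Fin M, N + m + 1 < M → (H ^ N) m ⟨M - 1, by lia⟩ = 0) ∧
    (∀ m : Fin M, N + m + 1 = M → ∃ c : ℝ, 0 < c ∧
      (H ^ N) m ⟨M - 1, by lia⟩ = algebraMap ℂ R c) ∧
    ∀ (m : Fin M) (d : ℕ), 1 ≤ d → N + m + 1 = M + d → ∃ κ : ℝ, 0 ≤ κ ∧ (N = M → 0 < κ) ∧
      (H ^ N) m ⟨M - 1, by lia⟩ - (κ : ℂ) • y d ∈ A d := by
  induction N with
  | zero =>
    refine ⟨fun m hm => ?_, fun m hm => ⟨1, one_pos, ?_⟩, fun m d hd hm => ?_⟩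
    · rw [pow_zero, Matrix.one_apply_ne]
      intro h
      have := congrArg Fin.val h
      simp only at this
      lia
    · rw [pow_zero, show m = ⟨M - 1, by lia⟩ from Fin.ext (by simp only; lia), Matrix.one_apply_eq]
      simp
    · have := m.2
      lia
  | succ N ih =>
    obtain ⟨ih0, ih1, ih2⟩ := ih
    have hrec : ∀ m : Fin M, (H ^ (N + 1)) m ⟨M - 1, by lia⟩ =
        ∑ j, H m j * (H ^ N) j ⟨M - 1, by lia⟩ := fun m => by
      rw [pow_succ', Matrix.mul_apply]
    refine ⟨fun m hm => ?_, fun m hm => ?_, fun m d hd hm => ?_⟩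
    · rw [hrec]
      refine Finset.sum_eq_zero fun j _ => ?_
      rcases lt_or_ge ((m : ℕ) + 1) j with hj | hj
      · rw [h.eq_zero m j hj, zero_mul]
      · rw [ih0 j (by lia), mul_zero]
    · have hm1 : (m : ℕ) + 1 < M := by lia
      obtain ⟨c, hc, hc'⟩ := ih1 ⟨m + 1, hm1⟩ (by simp only; lia)
      refine ⟨ε (m + 1) * c, mul_pos (h.pos _ (by lia) hm1) hc, ?_⟩
      rw [hrec, Finset.sum_eq_single ⟨m + 1, hm1⟩]
      · rw [hc', h.eq_above m ⟨m + 1, hm1⟩ rfl, ← map_mul]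
        simp
      · intro j _ hj
        have hj' : (j : ℕ) ≠ m + 1 := fun h => hj (Fin.ext h)
        rcases lt_or_ge ((m : ℕ) + 1) j with hj | hj
        · rw [h.eq_zero m j hj, zero_mul]
        · rw [ih0 j (by lia), mul_zero]
      · simp
    · have key : ∀ j : Fin M, ∃ κ : ℝ, 0 ≤ κ ∧ (N + 1 = M → (j : ℕ) = 0 → 0 < κ) ∧
          H m j * (H ^ N) j ⟨M - 1, by lia⟩ - (κ : ℂ) • y d ∈ A d := by
        intro j
        rcases lt_trichotomy ((m : ℕ) + 1) j with hj | hj | hj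
        · refine ⟨0, le_rfl, fun _ h0 => by lia, ?_⟩
          rw [h.eq_zero m j hj]
          simp
        · obtain ⟨κ, hκ, -, hmem⟩ := ih2 j d hd (by lia)
          refine ⟨ε j * κ, mul_nonneg (h.pos _ (by lia) j.2).le hκ, fun _ h0 => by lia, ?_⟩
          rw [h.eq_above m j hj.symm, ← Algebra.smul_def]
          convert (A d).smul_mem hmem (ε j : ℂ) using 1
          rw [smul_sub, smul_smul]
          push_cast
          rfl
        · have hj : (j : ℕ) ≤ m := by lia
          obtain ⟨ρ, hρ, hρ0, hmem⟩ := h.below m j hj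
          have hH : H m j ∈ A (m + 1 - j + 1) := by
            have := (A (m + 1 - j + 1)).add_mem (h.mono (Nat.le_succ _) hmem)
              ((A (m + 1 - j + 1)).smul_mem (h.mem _) (ρ : ℂ))
            simpa using this
          rcases lt_trichotomy ((m : ℕ) + 1 - j) d with hk | hk | hk
          · obtain ⟨κ, -, -, hmem'⟩ := ih2 j (d - (m + 1 - j)) (by lia) (by lia)
            refine ⟨0, le_rfl, fun _ h0 => by lia, ?_⟩
            have hE : (H ^ N) j ⟨M - 1, by lia⟩ ∈ A d := by
              have := (A d).add_mem (h.mono (show d - (m + 1 - j) ≤ d by lia) hmem')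
                ((A d).smul_mem (h.mono (show d - (m + 1 - j) + 1 ≤ d by lia) (h.mem _)) (κ : ℂ))
              simpa using this
            simpa using (A d).mul_mem (h.mono (by lia) hH) hE
          · obtain ⟨c, hc, hc'⟩ := ih1 j (by lia)
            refine ⟨ρ * c, mul_nonneg hρ hc.le, fun _ h0 => by rw [hρ0 h0, one_mul]; exact hc, ?_⟩
            rw [hk] at hmem
            rw [hc', mul_comm, ← Algebra.smul_def]
            convert (A d).smul_mem hmem (c : ℂ) using 1
            rw [smul_sub, smul_smul]
            push_cast
            rw [mul_comm]
          · refine ⟨0, le_rfl, fun _ h0 => by lia, ?_⟩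
            rw [ih0 j (by lia)]
            simp
      choose κ hκ hκ0 hmem using key
      refine ⟨∑ j, κ j, Finset.sum_nonneg fun j _ => hκ j, fun hN => ?_, ?_⟩
      · exact Finset.sum_pos' (fun j _ => hκ j) ⟨⟨0, hM⟩, Finset.mem_univ _, hκ0 _ hN rfl⟩
      · rw [hrec]
        convert (A d).sum_mem (t := Finset.univ) fun j _ => hmem j using 1
        rw [Finset.sum_sub_distrib, ← Finset.sum_smul]
        push_cast
        rfl

/-- The coefficients of the characteristic polynomial of a Hessenberg matrix form a triangular
system in the variables. -/
theorem IsHessenberg.charpoly_coeff (h : IsHessenberg H A y ε) (hM : 0 < M) (d : ℕ) (hd : 1 ≤ d)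
    (hdM : d ≤ M) :
    ∃ κ : ℝ, 0 < κ ∧ H.charpoly.coeff (M - d) + (κ : ℂ) • y d ∈ A d := by
  induction d using Nat.strong_induction_on with
  | _ d ih =>
  rcases subsingleton_or_nontrivial R with hR | hR
  · refine ⟨1, one_pos, ?_⟩
    rw [Subsingleton.elim (_ + _) (0 : R)]
    exact (A d).zero_mem
  -- Cayley–Hamilton is read at the entry `(d - 1, M - 1)`. There the powers below `M - d` vanish,
  -- the power `M - d` is a positive constant, and the power `M` contributes a positive multiple of
  -- `y d`. For the powers strictly between, both the coefficient (by induction) and the entry lie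
  -- in `A d`.
  let m : Fin M := ⟨d - 1, by lia⟩
  let l : Fin M := ⟨M - 1, by lia⟩
  have hdeg : H.charpoly.natDegree = M := by simpa using H.charpoly_natDegree_eq_dim
  have hCH : ∑ i ∈ Finset.range (M + 1), H.charpoly.coeff i * (H ^ i) m l = 0 := by
    have := congrFun (congrFun (Matrix.aeval_self_charpoly H) m) l
    rw [Polynomial.aeval_eq_sum_range, hdeg, Matrix.sum_apply] at this
    simpa using this
  obtain ⟨κ, -, hκ, hmem⟩ := (h.pow_entry hM M).2.2 m d hd (by simp only [m]; lia)
  have hlead : H.charpoly.coeff M = 1 := by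
    have := H.charpoly_monic
    rwa [Polynomial.Monic, Polynomial.leadingCoeff, hdeg] at this
  obtain ⟨c, hc, hc'⟩ := (h.pow_entry hM (M - d)).2.1 m (by simp only [m]; lia)
  have hrest : ∑ i ∈ (Finset.range M).erase (M - d), H.charpoly.coeff i * (H ^ i) m l ∈ A d := by
    refine (A d).sum_mem fun i hi => ?_
    rw [Finset.mem_erase, Finset.mem_range] at hi
    rcases lt_or_gt_of_ne hi.1 with hlt | hlt
    · rw [(h.pow_entry hM i).1 m (by simp only [m]; lia), mul_zero]
      exact (A d).zero_mem
    · obtain ⟨κ', -, hκ'⟩ := ih (M - i) (by lia) (by lia) (by lia)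
      rw [show M - (M - i) = i by lia] at hκ'
      have h1 : H.charpoly.coeff i ∈ A d := by
        have := (A d).sub_mem (h.mono (show M - i ≤ d by lia) hκ')
          ((A d).smul_mem (h.mono (show M - i + 1 ≤ d by lia) (h.mem _)) (κ' : ℂ))
        simpa using this
      obtain ⟨κ₂, -, -, h2⟩ := (h.pow_entry hM i).2.2 m (d - (M - i)) (by lia)
        (by simp only [m]; lia)
      have h3 : (H ^ i) m l ∈ A d := by
        have := (A d).add_mem (h.mono (show d - (M - i) ≤ d by lia) h2)
          ((A d).smul_mem (h.mono (show d - (M - i) + 1 ≤ d by lia) (h.mem _)) (κ₂ : ℂ))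
        simpa [l] using this
      exact (A d).mul_mem h1 h3
  rw [Finset.sum_range_succ, hlead, one_mul,
    ← Finset.add_sum_erase _ _ (Finset.mem_range.2 (show M - d < M by lia)), hc'] at hCH
  refine ⟨κ / c, div_pos (hκ rfl) hc, ?_⟩
  have hfin := (A d).smul_mem ((A d).add_mem hrest hmem) (-(c : ℂ)⁻¹)
  have hc0 : (c : ℂ) ≠ 0 := by exact_mod_cast hc.ne'
  convert hfin using 1
  have hE : (∑ i ∈ (Finset.range M).erase (M - d), H.charpoly.coeff i * (H ^ i) m l) +
      (H ^ M) m l = -((c : ℂ) • H.charpoly.coeff (M - d)) := by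
    rw [Algebra.smul_def, mul_comm]
    linear_combination hCH
  have : (∑ i ∈ (Finset.range M).erase (M - d), H.charpoly.coeff i * (H ^ i) m l) +
      ((H ^ M) m l - (κ : ℂ) • y d) = -((c : ℂ) • H.charpoly.coeff (M - d)) - (κ : ℂ) • y d := by
    rw [← hE]; ring
  refine Eq.trans ?_ (congrArg (fun r => (-(c : ℂ)⁻¹) • r) this.symm)
  simp only [smul_sub, smul_neg, smul_smul]
  push_cast
  rw [neg_mul, inv_mul_cancel₀ hc0, neg_mul, neg_smul, neg_smul, one_smul, neg_neg, sub_neg_eq_add,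
    div_eq_inv_mul]

end Hessenberg

/-- The kernels of the iterates stabilize, say at `k`. An element of the kernel has the form `f^k
u`; then `u` lies in the kernel of `f^(k+1)`, hence in that of `f^k`. This upgrades generation by
the coefficients to algebraic independence. -/
theorem injective_of_surjective_noetherian {R : Type*} [CommRing R] [IsNoetherianRing R]
    (f : R →+* R) (hf : Function.Surjective f) : Function.Injective f := by
  let K : ℕ →o Ideal R := ⟨fun k => RingHom.ker (f ^ k), monotone_nat_of_le_succ fun k x hx => by
    rw [RingHom.mem_ker] at hx ⊢
    rw [pow_succ', RingHom.mul_def, RingHom.comp_apply, hx, map_zero]⟩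
  obtain ⟨k, hk⟩ := monotone_stabilizes_iff_noetherian.2 (inferInstanceAs (IsNoetherian R R)) K
  rw [injective_iff_map_eq_zero]
  intro x hx
  have hs : Function.Surjective (f ^ k) := by
    rw [RingHom.coe_pow]
    exact hf.iterate k
  obtain ⟨u, rfl⟩ := hs x
  have h1 : u ∈ K (k + 1) := by
    change (f ^ (k + 1)) u = 0
    rw [pow_succ', RingHom.mul_def, RingHom.comp_apply, hx]
  rw [← hk (k + 1) (Nat.le_succ k)] at h1
  exact h1

/-! ### Cyclic vectors and perturbations of rank one -/

section Operators

open Polynomial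

variable {U U' : Type*} [AddCommGroup U] [Module ℂ U] [AddCommGroup U'] [Module ℂ U']

/-- A vector generating the space under an operator. -/
def IsCyclic (T : Module.End ℂ U) (w : U) : Prop := ∀ u, ∃ f : ℂ[X], aeval T f w = u

theorem isCyclic_iff (T : Module.End ℂ U) (w : U) :
    IsCyclic T w ↔ ∀ S : Submodule ℂ U, w ∈ S → (∀ u ∈ S, T u ∈ S) → S = ⊤ := by
  constructor
  · intro h S hw hS
    rw [eq_top_iff]
    intro u _
    obtain ⟨f, rfl⟩ := h u
    induction f using Polynomial.induction_on' with
    | add f g hf hg => simpa using S.add_mem (hf trivial) (hg trivial)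
    | monomial k a =>
      rw [aeval_monomial]
      simp only [Module.End.mul_apply, Module.algebraMap_end_apply]
      refine S.smul_mem _ ?_
      induction k with
      | zero => simpa
      | succ k ih =>
        rw [pow_succ', Module.End.mul_apply]
        exact hS _ (ih trivial)
  · intro h u
    let S : Submodule ℂ U :=
      LinearMap.range ((LinearMap.applyₗ w : Module.End ℂ U →ₗ[ℂ] U) ∘ₗ (aeval T).toLinearMap)
    have : S = ⊤ := h S ⟨1, by simp⟩ (by
      rintro _ ⟨f, rfl⟩
      exact ⟨X * f, by simp⟩)
    obtain ⟨f, hf⟩ := this.symm ▸ Submodule.mem_top (x := u)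
    exact ⟨f, hf⟩

variable [FiniteDimensional ℂ U]

theorem natDegree_charpoly (T : Module.End ℂ U) : T.charpoly.natDegree = Module.finrank ℂ U :=
  LinearMap.charpoly_natDegree T

/-- Modulo the characteristic polynomial, `f ↦ f(T) w` is a surjection from the polynomials of
degree less than `dim U` onto `U`. It is injective by equality of dimensions, so the remainder of
`f` is zero. -/
theorem charpoly_dvd_of_isCyclic {T : Module.End ℂ U} {w : U} (h : IsCyclic T w) {f : ℂ[X]}
    (hf : aeval T f w = 0) : T.charpoly ∣ f := by
  let ψ : degreeLT ℂ (Module.finrank ℂ U) →ₗ[ℂ] U :=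
    (LinearMap.applyₗ w : Module.End ℂ U →ₗ[ℂ] U) ∘ₗ (aeval T).toLinearMap ∘ₗ Submodule.subtype _
  have hmod : ∀ f : ℂ[X], f %ₘ T.charpoly ∈ degreeLT ℂ (Module.finrank ℂ U) := fun f => by
    rw [mem_degreeLT, ← natDegree_charpoly T, ← degree_eq_natDegree T.charpoly_monic.ne_zero]
    exact degree_modByMonic_lt _ T.charpoly_monic
  have hψ : Function.Surjective ψ := fun u => by
    obtain ⟨f, rfl⟩ := h u
    refine ⟨⟨_, hmod f⟩, ?_⟩
    rw [T.aeval_eq_aeval_mod_charpoly f]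
    rfl
  have : FiniteDimensional ℂ (degreeLT ℂ (Module.finrank ℂ U)) :=
    Module.Finite.equiv (degreeLTEquiv ℂ _).symm
  have hfin : Module.finrank ℂ (degreeLT ℂ (Module.finrank ℂ U)) = Module.finrank ℂ U := by
    rw [(degreeLTEquiv ℂ (Module.finrank ℂ U)).finrank_eq]
    simp
  have hinj := (LinearMap.injective_iff_surjective_of_finrank_eq_finrank hfin).2 hψ
  rw [← modByMonic_eq_zero_iff_dvd T.charpoly_monic]
  rw [T.aeval_eq_aeval_mod_charpoly f] at hf
  have := hinj (a₁ := ⟨_, hmod f⟩) (a₂ := 0) (by rw [map_zero]; exact hf)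
  exact congrArg Subtype.val this

/-- Operators with the same characteristic polynomial are intertwined by a linear map that carries
a given cyclic vector of the first to a given vector. -/
theorem exists_intertwiner [FiniteDimensional ℂ U'] {T : Module.End ℂ U} {w : U}
    (h : IsCyclic T w) (T' : Module.End ℂ U') (w' : U') (hp : T.charpoly = T'.charpoly) :
    ∃ g : U →ₗ[ℂ] U', ∀ f : ℂ[X], g (aeval T f w) = aeval T' f w' := by
  let ψ : ℂ[X] →ₗ[ℂ] U :=
    (LinearMap.applyₗ w : Module.End ℂ U →ₗ[ℂ] U) ∘ₗ (aeval T).toLinearMap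
  let ψ' : ℂ[X] →ₗ[ℂ] U' :=
    (LinearMap.applyₗ w' : Module.End ℂ U' →ₗ[ℂ] U') ∘ₗ (aeval T').toLinearMap
  obtain ⟨s, hs⟩ := ψ.exists_rightInverse_of_surjective (LinearMap.range_eq_top.2 h)
  refine ⟨ψ' ∘ₗ s, fun f => ?_⟩
  have h1 : ψ (s (ψ f) - f) = 0 := by
    rw [map_sub, sub_eq_zero]
    exact LinearMap.congr_fun hs (ψ f)
  obtain ⟨c, hc⟩ := charpoly_dvd_of_isCyclic h h1
  have h2 : ψ' (s (ψ f) - f) = 0 := by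
    change aeval T' (s (ψ f) - f) w' = 0
    rw [hc, hp, map_mul, LinearMap.aeval_self_charpoly, zero_mul, LinearMap.zero_apply]
  rw [map_sub, sub_eq_zero] at h2
  exact h2

/-- A perturbation of rank one changes the characteristic polynomial by the moments. -/
theorem eval_charpoly_sub_smulRight (x : Module.End ℂ U) (φ : Module.Dual ℂ U) (v : U) (t : ℂ)
    (ht : x.charpoly.eval t ≠ 0) :
    (x - φ.smulRight v).charpoly.eval t =
      x.charpoly.eval t + φ (aeval x (x.charpoly /ₘ (X - C t)) v) := by
  -- By Cayley–Hamilton `(t - x) G(x) = c`, so `c⁻¹ G(x)` is the resolvent at `t`. The perturbed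
  -- operator then factors as `t - x` times a transvection, whose determinant is known.
  set G := x.charpoly /ₘ (X - C t)
  set c := x.charpoly.eval t
  have hG : (X - C t) * G = x.charpoly - C c := by
    rw [X_sub_C_mul_divByMonic_eq_sub_modByMonic, modByMonic_X_sub_C_eq_C_eval]
  have hA : (algebraMap ℂ (Module.End ℂ U) t - x) (aeval x G v) = c • v := by
    have := congrArg (fun f => aeval x f v) hG
    simp only [map_mul, map_sub, aeval_X, aeval_C, LinearMap.aeval_self_charpoly,
      Module.End.mul_apply, LinearMap.sub_apply, zero_sub] at this
    rw [LinearMap.sub_apply, ← neg_sub, this, LinearMap.neg_apply, neg_neg]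
    rfl
  have hfac : algebraMap ℂ (Module.End ℂ U) t - (x - φ.smulRight v) =
      (algebraMap ℂ (Module.End ℂ U) t - x) ∘ₗ LinearMap.transvection φ (c⁻¹ • aeval x G v) := by
    ext u
    rw [LinearMap.comp_apply, LinearMap.transvection.apply, map_add, map_smul, map_smul, hA,
      smul_smul c⁻¹, inv_mul_cancel₀ ht, one_smul]
    simp only [LinearMap.sub_apply, LinearMap.smulRight_apply]
    abel
  rw [LinearMap.eval_charpoly, hfac, LinearMap.det_comp, ← LinearMap.eval_charpoly,
    LinearMap.transvection.det, map_smul, smul_eq_mul, mul_add, mul_one, ← mul_assoc,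
    mul_inv_cancel₀ ht, one_mul]

/-- The moments are determined by the characteristic polynomials before and after a perturbation
of rank one. -/
theorem moments_eq {x x' : Module.End ℂ U} {φ φ' : Module.Dual ℂ U} {v v' : U}
    (hp : x.charpoly = x'.charpoly)
    (hr : (x - φ.smulRight v).charpoly = (x' - φ'.smulRight v').charpoly) (f : ℂ[X]) :
    φ (aeval x f v) = φ' (aeval x' f v') := by
  set p := x.charpoly with hpdef
  set M := Module.finrank ℂ U
  have hdeg : p.natDegree = M := natDegree_charpoly x
  have hmonic : p.Monic := x.charpoly_monic
  let δ : ℕ → ℂ := fun k => φ ((x ^ k) v) - φ' ((x' ^ k) v')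
  have hsum : ∀ g : ℂ[X], g.natDegree < M → φ (aeval x g v) - φ' (aeval x' g v') =
      ∑ k ∈ Finset.range M, g.coeff k * δ k := by
    intro g hg
    rw [aeval_eq_sum_range' hg, aeval_eq_sum_range' hg]
    simp only [LinearMap.sum_apply, map_sum, LinearMap.smul_apply, map_smul, smul_eq_mul, δ,
      mul_sub, Finset.sum_sub_distrib]
  suffices hδ : ∀ k < M, δ k = 0 by
    rcases Nat.eq_zero_or_pos M with hM | hM
    · have : Subsingleton U := Module.finrank_zero_iff.1 hM
      rw [Subsingleton.elim (aeval x f v) 0, Subsingleton.elim (aeval x' f v') 0, map_zero,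
        map_zero]
    rw [x.aeval_eq_aeval_mod_charpoly f, x'.aeval_eq_aeval_mod_charpoly f, ← hp, ← sub_eq_zero,
      hsum]
    · exact Finset.sum_eq_zero fun k hk => by rw [hδ k (Finset.mem_range.1 hk), mul_zero]
    · rw [← hdeg]
      exact natDegree_modByMonic_lt _ hmonic fun h => by
        rw [hpdef, h, natDegree_one] at hdeg
        lia
  -- The value of `Q` at `t` is the difference of the two moment terms of
  -- `eval_charpoly_sub_smulRight`: the coefficients of `p /ₘ (X - t)` are themselves polynomials in
  -- `t`. It vanishes off the finite set of roots of `p`, hence identically.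
  let Q : ℂ[X] := ∑ k ∈ Finset.range M, ∑ i ∈ Finset.Icc (k + 1) M,
    C (p.coeff i * δ k) * X ^ (i - (k + 1))
  have hQ : Q = 0 := by
    have hinf : {t : ℂ | p.eval t ≠ 0}.Infinite := by
      have : {t : ℂ | p.eval t ≠ 0} = (p.rootSet ℂ)ᶜ := by
        ext t
        simp [mem_rootSet, hmonic.ne_zero]
      rw [this]
      exact (p.rootSet_finite ℂ).infinite_compl
    refine eq_of_infinite_eval_eq _ _ (hinf.mono fun t ht => ?_)
    have h1 := eval_charpoly_sub_smulRight x φ v t ht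
    have h2 := eval_charpoly_sub_smulRight x' φ' v' t (by rw [← hp]; exact ht)
    rw [hr, h2, ← hp, add_right_inj] at h1
    have hQt : Q.eval t = ∑ k ∈ Finset.range M, (p /ₘ (X - C t)).coeff k * δ k := by
      simp only [Q, eval_finsetSum, eval_mul, eval_C, eval_pow, eval_X, coeff_divByMonic_X_sub_C,
        hdeg, Finset.sum_mul]
      refine Finset.sum_congr rfl fun k _ => Finset.sum_congr rfl fun i _ => by ring
    have hGdeg : M ≠ 0 → (p /ₘ (X - C t)).natDegree < M := fun hM => by
      rw [natDegree_divByMonic _ (monic_X_sub_C t), natDegree_X_sub_C, hdeg]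
      lia
    change Q.eval t = eval t 0
    rw [eval_zero, hQt]
    rcases eq_or_ne M 0 with hM | hM
    · rw [hM]; simp
    · rw [← hsum _ (hGdeg hM), ← h1, sub_self]
  intro k hk
  induction k using Nat.strong_induction_on with
  | _ k ih =>
  -- In this degree only the `δ j` with `j ≤ k` occur, and `δ k` occurs with the leading coefficient
  -- of `p`. The system is therefore unitriangular.
  have := congrArg (fun g => coeff g (M - (k + 1))) hQ
  simp only [Q, finsetSum_coeff, coeff_C_mul_X_pow, coeff_zero] at this
  rw [Finset.sum_eq_single k, Finset.sum_eq_single M] at this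
  · rw [if_pos rfl, ← hdeg] at this
    change p.leadingCoeff * δ k = 0 at this
    rwa [hmonic.leadingCoeff, one_mul] at this
  · intro i hi hiM
    rw [Finset.mem_Icc] at hi
    rw [if_neg (by lia)]
  · intro h
    exact absurd (Finset.mem_Icc.2 ⟨by lia, le_rfl⟩) h
  · intro j hj hjk
    refine Finset.sum_eq_zero fun i hi => ?_
    rw [Finset.mem_Icc] at hi
    rcases lt_or_gt_of_ne hjk with hlt | hlt
    · rw [ih j hlt (by lia)]
      simp
    · rw [if_neg (by lia)]
  · intro h
    exact absurd (Finset.mem_range.2 hk) h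

end Operators

/-! ### Reduction to squarefree monomials -/

section SquarefreeMonomials

theorem sum_sq_le_sq_sum (s : Multiset ℕ) : (s.map (· ^ 2)).sum ≤ s.sum ^ 2 := by
  induction s using Multiset.induction_on with
  | empty => simp
  | cons a s ih =>
    simp only [Multiset.map_cons, Multiset.sum_cons]
    nlinarith [Nat.zero_le (a * s.sum)]

/-- If the square of each generator is a scalar plus a combination of the products `q i * q j` with
the same total index and `i ≠ j`, then the squarefree monomials span. -/
theorem prod_mem_span_squarefree {E B : Type*} [CommRing E] [CommRing B] [Algebra E B] (n : ℕ)
    (q : ℕ → B) (h0 : q 0 = 1) (hn : ∀ k, n < k → q k = 0)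
    (hrel : ∀ k, 1 ≤ k → ∃ (c : ℕ × ℕ → E) (a : E), q k * q k = algebraMap E B a +
      ∑ ij ∈ (Finset.HasAntidiagonal.antidiagonal (2 * k)).erase (k, k), c ij • (q ij.1 * q ij.2))
    (s : Multiset ℕ) : (s.map q).prod ∈
      Submodule.span E (Set.range fun I : Finset (Fin n) => ∏ i ∈ I, q (i + 1)) := by
  -- Replacing `k, k` by `i, j` with `i + j = 2k` and `i ≠ j` preserves the sum and the cardinality
  -- and strictly increases the sum of squares, which is bounded by the square of the sum. The
  -- cardinality term handles the removal of a factor `q 0` and of the pair in the scalar term.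
  induction hμ : s.sum ^ 2 - (s.map (· ^ 2)).sum + Multiset.card s using Nat.strong_induction_on
    generalizing s with
  | _ μ ih =>
  by_cases hs0 : 0 ∈ s
  · obtain ⟨t, rfl⟩ := Multiset.exists_cons_of_mem hs0
    rw [Multiset.map_cons, Multiset.prod_cons, h0, one_mul]
    refine ih _ ?_ t rfl
    rw [← hμ]
    simp
  by_cases hsn : ∃ k ∈ s, n < k
  · obtain ⟨k, hk, hkn⟩ := hsn
    obtain ⟨t, rfl⟩ := Multiset.exists_cons_of_mem hk
    rw [Multiset.map_cons, Multiset.prod_cons, hn k hkn, zero_mul]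
    exact Submodule.zero_mem _
  push Not at hsn
  by_cases hnd : s.Nodup
  · refine Submodule.subset_span ⟨Finset.univ.filter fun i : Fin n => (i : ℕ) + 1 ∈ s, ?_⟩
    have : (s.map q).prod = ∏ k ∈ s.toFinset, q k := by
      rw [Finset.prod, Multiset.toFinset_val, hnd.dedup]
    rw [this]
    refine Finset.prod_bij (fun i _ => (i : ℕ) + 1) (fun i hi => ?_) (fun i _ j _ hij => ?_)
      (fun k hk => ?_) fun i _ => rfl
    · simpa using hi
    · exact Fin.ext (by simpa using hij)
    · rw [Multiset.mem_toFinset] at hk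
      have h1 : k ≠ 0 := fun h => hs0 (h ▸ hk)
      have h2 := hsn k hk
      refine ⟨⟨k - 1, by lia⟩, ?_, ?_⟩
      · simp only [Finset.mem_filter, Finset.mem_univ, true_and]
        rwa [show k - 1 + 1 = k by lia]
      · simp only
        lia
  · rw [Multiset.nodup_iff_ne_cons_cons] at hnd
    push Not at hnd
    obtain ⟨k, t, rfl⟩ := hnd
    have hk : 1 ≤ k := by
      by_contra h
      exact hs0 (by rw [show k = 0 by lia]; simp)
    obtain ⟨c, a, hq⟩ := hrel k hk
    have hsq := sum_sq_le_sq_sum t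
    simp only [Multiset.map_cons, Multiset.sum_cons, Multiset.card_cons] at hμ
    have hmul : ((k ::ₘ k ::ₘ t).map q).prod = a • (t.map q).prod +
        ∑ ij ∈ (Finset.HasAntidiagonal.antidiagonal (2 * k)).erase (k, k),
          c ij • ((ij.1 ::ₘ ij.2 ::ₘ t).map q).prod := by
      simp only [Multiset.map_cons, Multiset.prod_cons]
      rw [← mul_assoc, hq, add_mul, ← Algebra.smul_def, Finset.sum_mul]
      simp only [smul_mul_assoc, mul_assoc]
    rw [hmul]
    refine Submodule.add_mem _ (Submodule.smul_mem _ _ (ih _ ?_ t rfl))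
      (Submodule.sum_mem _ fun ij hij => Submodule.smul_mem _ _ (ih _ ?_ _ rfl))
    · rw [← hμ]
      have : t.sum ^ 2 - (t.map (· ^ 2)).sum ≤
          (k + (k + t.sum)) ^ 2 - (k ^ 2 + (k ^ 2 + (t.map (· ^ 2)).sum)) := by
        refine Nat.le_sub_of_add_le ?_
        zify [hsq]
        nlinarith [Nat.zero_le (k * t.sum)]
      lia
    · rw [← hμ]
      obtain ⟨i, j⟩ := ij
      simp only [Finset.mem_erase, Finset.HasAntidiagonal.mem_antidiagonal, ne_eq, Prod.mk.injEq] at hij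
      simp only [Multiset.map_cons, Multiset.sum_cons, Multiset.card_cons]
      have hlt : k ^ 2 + k ^ 2 < i ^ 2 + j ^ 2 := by
        obtain ⟨h1, h2⟩ := hij
        have hne : i ≠ j := fun h => h1 (by lia)
        zify at h2 hne ⊢
        nlinarith [sq_pos_of_ne_zero (sub_ne_zero.2 hne)]
      have hs : i + (j + t.sum) = k + (k + t.sum) := by lia
      rw [hs]
      have h1 : i ^ 2 + (j ^ 2 + (t.map (· ^ 2)).sum) ≤ (k + (k + t.sum)) ^ 2 := by
        rw [← hs]
        nlinarith [Nat.zero_le (i * j), Nat.zero_le (i * t.sum), Nat.zero_le (j * t.sum)]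
      lia

end SquarefreeMonomials

end PseudoSlice

namespace PseudoSlice

namespace Data

/-! ### The basis of `V` adapted to the `sl₂`-triple -/

section Basis

variable {n : ℕ} {V : Type*} [AddCommGroup V] [Module ℂ V] (D : Data n V)

/-- The operators `e`, `f`, `h` as endomorphisms of `V`. -/
abbrev E : Module.End ℂ V := (D.e : Module.End ℂ V)

abbrev F : Module.End ℂ V := (D.f : Module.End ℂ V)

abbrev H : Module.End ℂ V := (D.h : Module.End ℂ V)

theorem E_F (u : V) : D.E (D.F u) = D.F (D.E u) + D.H u := by
  have h := congrArg (fun x : D.sp => (x : Module.End ℂ V) u) D.triple.lie_e_f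
  simp only [LieSubalgebra.coe_bracket, Ring.lie_def, LinearMap.sub_apply,
    Module.End.mul_apply] at h
  rw [← h]
  abel

theorem H_E (u : V) : D.H (D.E u) = D.E (D.H u) + (2 : ℂ) • D.E u := by
  have h := congrArg (fun x : D.sp => (x : Module.End ℂ V) u) (D.triple.lie_h_e_smul ℂ)
  change D.H (D.E u) - D.E (D.H u) = (2 : ℂ) • D.E u at h
  rw [← h]
  abel

theorem H_F (u : V) : D.H (D.F u) = D.F (D.H u) - (2 : ℂ) • D.F u := by
  have h := congrArg (fun x : D.sp => (x : Module.End ℂ V) u) (D.triple.lie_lie_smul_f ℂ)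
  change D.H (D.F u) - D.F (D.H u) = -((2 : ℂ) • D.F u) at h
  rw [eq_add_of_sub_eq h]
  abel

theorem one_le {n : ℕ} {V : Type*} [AddCommGroup V] [Module ℂ V] (D : Data n V) : 1 ≤ n := by
  by_contra h
  have hm := D.v₀_mem
  rw [D.Ls_eq] at hm
  exact D.v₀_notMem (by rwa [show n - 1 = n by lia])

variable [FiniteDimensional ℂ V]

/-- The vector `e^(n-1) v₀` is nonzero, killed by `e`, and of weight `2n - 1`. The relations of
`sl₂` make its first `2n` images under powers of `f` nonzero, with distinct weights, and they fill
the dimension `2n`. The weight `1` line contains both `v₀` and the vector of index `n - 1`;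
rescaling identifies the two. -/
theorem exists_sl2Basis : ∃ (u : ℕ → V) (b : Module.Basis (Fin (2 * n)) ℂ V),
    (∀ i, b i = u i) ∧ (∀ k, 2 * n ≤ k → u k = 0) ∧ (∀ k, D.F (u k) = u (k + 1)) ∧
    D.E (u 0) = 0 ∧ (∀ k, D.E (u (k + 1)) = (((k : ℂ) + 1) * (2 * n - 1 - k)) • u k) ∧
    (∀ k, D.H (u k) = (2 * n - 1 - 2 * k : ℂ) • u k) ∧ u (n - 1) = D.v₀ := by
  have hn := D.one_le
  set t : V := (D.E ^ (n - 1)) D.v₀ with ht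
  let u : ℕ → V := fun k => (D.F ^ k) t
  have ht0 : t ≠ 0 := D.v₀_notMem
  have hEt : D.E t = 0 := by
    have hm := D.v₀_mem
    rw [D.Ls_eq, LinearMap.mem_ker, ← mul_pow_sub_one (by lia)] at hm
    exact hm
  have hHt : D.H t = (2 * n - 1 : ℂ) • t := by
    have : ∀ k : ℕ, D.H ((D.E ^ k) D.v₀) = (2 * k + 1 : ℂ) • (D.E ^ k) D.v₀ := by
      intro k
      induction k with
      | zero => simpa using D.h_v₀
      | succ k ih =>
        rw [pow_succ', Module.End.mul_apply, D.H_E, ih, map_smul, ← add_smul]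
        congr 1
        push_cast
        ring
    rw [ht, this]
    congr 1
    push_cast [Nat.cast_sub hn]
    ring
  have hF : ∀ k, D.F (u k) = u (k + 1) := fun k => by
    simp only [u, pow_succ', Module.End.mul_apply]
  have hH : ∀ k, D.H (u k) = (2 * n - 1 - 2 * k : ℂ) • u k := by
    intro k
    induction k with
    | zero => simpa [u] using hHt
    | succ k ih =>
      rw [← hF, D.H_F, ih, map_smul, ← sub_smul]
      congr 1
      push_cast
      ring
  have hE : ∀ k, D.E (u (k + 1)) = (((k : ℂ) + 1) * (2 * n - 1 - k)) • u k := by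
    intro k
    induction k with
    | zero =>
      rw [← hF, D.E_F, hH]
      simp [u, hEt]
    | succ k ih =>
      rw [← hF (k + 1), D.E_F, ih, map_smul, hF, hH, ← add_smul]
      congr 1
      push_cast
      ring
  have hne : ∀ k, k < 2 * n → u k ≠ 0 := by
    intro k
    induction k with
    | zero => simpa [u] using fun _ => ht0
    | succ k ih =>
      intro hk h
      have := hE k
      rw [h, map_zero, eq_comm, smul_eq_zero_iff_left (ih (by lia)), mul_eq_zero] at this
      rcases this with h | h
      · exact Nat.cast_add_one_ne_zero k h
      · have h2 : ((2 * n : ℕ) : ℂ) = ((1 + k : ℕ) : ℂ) := by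
          push_cast
          linear_combination h
        have := Nat.cast_injective h2
        lia
  have hli : ∀ N : ℕ, (∀ k < N, u k ≠ 0) → LinearIndependent ℂ fun i : Fin N => u i := by
    intro N hN
    refine Module.End.eigenvectors_linearIndependent' D.H
      (fun i : Fin N => (2 * n - 1 - 2 * (i : ℕ) : ℂ)) (fun i j hij => ?_) _ fun i =>
      ⟨Module.End.mem_eigenspace_iff.2 (hH i), hN i i.2⟩
    have : ((i : ℕ) : ℂ) = (j : ℕ) := by
      simp only at hij
      linear_combination (-1 / 2 : ℂ) * hij
    exact Fin.ext (Nat.cast_injective this)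
  -- Otherwise there would be `2n + 1` eigenvectors of `h` with distinct eigenvalues.
  have hu0 : u (2 * n) = 0 := by
    by_contra h
    have := (hli (2 * n + 1) fun k hk => by
      rcases Nat.lt_succ_iff_lt_or_eq.1 hk with h' | rfl
      · exact hne k h'
      · exact h).fintype_card_le_finrank
    rw [D.finrank_V, Fintype.card_fin] at this
    lia
  have hu : ∀ k, 2 * n ≤ k → u k = 0 := by
    intro k hk
    induction k, hk using Nat.le_induction with
    | base => exact hu0
    | succ k _ ih => rw [← hF, ih, map_zero]
  have : Nonempty (Fin (2 * n)) := ⟨⟨0, by lia⟩⟩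
  let b := basisOfLinearIndependentOfCardEqFinrank (hli (2 * n) hne)
    (by rw [D.finrank_V, Fintype.card_fin])
  have hb : ∀ i, b i = u i := fun i => by simp [b]
  have hv : D.v₀ = b.repr D.v₀ ⟨n - 1, by lia⟩ • u (n - 1) := by
    have hcoef : ∀ i : Fin (2 * n), (i : ℕ) ≠ n - 1 → b.repr D.v₀ i = 0 := by
      intro i hi
      have h1 : D.H D.v₀ = ∑ i, (b.repr D.v₀ i * (2 * n - 1 - 2 * (i : ℕ))) • b i := by
        conv_lhs => rw [← b.sum_repr D.v₀]
        simp only [map_sum, map_smul, hb, hH, smul_smul]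
      have h2 := congrArg (fun w => b.repr w i) (D.h_v₀.symm.trans h1)
      simp only [map_sum, map_smul, b.repr_self, Finsupp.coe_finsetSum, Finset.sum_apply,
        Finsupp.smul_apply, Finsupp.single_apply, smul_eq_mul, mul_ite, mul_one, mul_zero,
        Finset.sum_ite_eq', Finset.sum_ite_eq, Finset.mem_univ, if_true] at h2
      by_contra h0
      have h3 : (2 * n - 1 - 2 * (i : ℕ) : ℂ) = 1 := by
        apply mul_left_cancel₀ h0
        rw [mul_one]
        exact h2.symm
      have h4 : ((n : ℕ) : ℂ) = ((1 + i : ℕ) : ℂ) := by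
        push_cast
        linear_combination (1 / 2 : ℂ) * h3
      have := Nat.cast_injective h4
      lia
    conv_lhs => rw [← b.sum_repr D.v₀]
    rw [Finset.sum_eq_single ⟨n - 1, by lia⟩, hb]
    · intro i _ hi
      rw [hcoef i fun h => hi (Fin.ext h), zero_smul]
    · simp
  set c := b.repr D.v₀ ⟨n - 1, by lia⟩
  have hc : c ≠ 0 := by
    rintro h
    rw [h, zero_smul] at hv
    exact ht0 (by rw [ht, hv, map_zero])
  refine ⟨fun k => c • u k, b.isUnitSMul (w := fun _ => c) fun _ => isUnit_iff_ne_zero.2 hc,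
    fun i => ?_, fun k hk => ?_, fun k => ?_, ?_, fun k => ?_, fun k => ?_, hv.symm⟩
  · simp [Module.Basis.isUnitSMul_apply, hb]
  · simp [hu k hk]
  · simp [hF]
  · simp [u, hEt]
  · rw [map_smul, hE, smul_comm]
  · rw [map_smul, hH, smul_comm]

/-- The vectors `f^k u`, for `u` a suitable highest weight vector, starting from `k = 0`. -/
noncomputable def vec : ℕ → V := D.exists_sl2Basis.choose

/-- The basis of `V` formed by the vectors `f^k u`, `k < 2n`, for `u` a highest weight vector. -/
noncomputable def basis : Module.Basis (Fin (2 * n)) ℂ V := D.exists_sl2Basis.choose_spec.choose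

theorem basis_eq (i : Fin (2 * n)) : D.basis i = D.vec i :=
  D.exists_sl2Basis.choose_spec.choose_spec.1 i

theorem vec_eq_zero {k : ℕ} (hk : 2 * n ≤ k) : D.vec k = 0 :=
  D.exists_sl2Basis.choose_spec.choose_spec.2.1 k hk

theorem F_vec (k : ℕ) : D.F (D.vec k) = D.vec (k + 1) :=
  D.exists_sl2Basis.choose_spec.choose_spec.2.2.1 k

theorem E_vec_zero : D.E (D.vec 0) = 0 :=
  D.exists_sl2Basis.choose_spec.choose_spec.2.2.2.1

theorem E_vec_succ (k : ℕ) :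
    D.E (D.vec (k + 1)) = (((k : ℂ) + 1) * (2 * n - 1 - k)) • D.vec k :=
  D.exists_sl2Basis.choose_spec.choose_spec.2.2.2.2.1 k

theorem H_vec (k : ℕ) : D.H (D.vec k) = (2 * n - 1 - 2 * k : ℂ) • D.vec k :=
  D.exists_sl2Basis.choose_spec.choose_spec.2.2.2.2.2.1 k

theorem vec_pred : D.vec (n - 1) = D.v₀ :=
  D.exists_sl2Basis.choose_spec.choose_spec.2.2.2.2.2.2

theorem F_pow_vec (j k : ℕ) : (D.F ^ j) (D.vec k) = D.vec (k + j) := by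
  induction j with
  | zero => rfl
  | succ j ih => rw [pow_succ', Module.End.mul_apply, ih, D.F_vec, add_assoc]

/-- The coordinate of index `k` with respect to the basis of `V`, zero for `k ≥ 2n`. -/
noncomputable def coord (k : ℕ) : Module.Dual ℂ V :=
  if h : k < 2 * n then D.basis.coord ⟨k, h⟩ else 0

theorem coord_vec (k j : ℕ) (hj : j < 2 * n) : D.coord k (D.vec j) = if j = k then 1 else 0 := by
  have hb := D.basis_eq ⟨j, hj⟩
  simp only at hb
  rw [← hb, coord]
  split_ifs with h1 h2 h2
  · simp [Finsupp.single_apply, h2]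
  · simp [Finsupp.single_apply, h2]
  · lia
  · rfl

theorem coord_of_le {k : ℕ} (hk : 2 * n ≤ k) : D.coord k = 0 := by
  rw [coord, dif_neg (by lia)]

theorem sum_coord (u : V) : u = ∑ i : Fin (2 * n), D.coord i u • D.vec i := by
  conv_lhs => rw [← D.basis.sum_repr u]
  refine Finset.sum_congr rfl fun i _ => ?_
  rw [D.basis_eq, coord, dif_pos i.2]
  rfl

theorem ext_coord {u w : V} (h : ∀ k < 2 * n, D.coord k u = D.coord k w) : u = w := by
  rw [D.sum_coord u, D.sum_coord w]
  exact Finset.sum_congr rfl fun i _ => by rw [h i i.2]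

theorem dual_ext {ξ η : Module.Dual ℂ V} (h : ∀ k < 2 * n, ξ (D.vec k) = η (D.vec k)) :
    ξ = η :=
  D.basis.ext fun i => by rw [D.basis_eq]; exact h i i.2

theorem coord_F_pow (a k : ℕ) (u : V) :
    D.coord k ((D.F ^ a) u) = if a ≤ k ∧ k < 2 * n then D.coord (k - a) u else 0 := by
  by_cases hk : k < 2 * n
  swap
  · rw [D.coord_of_le (by lia), if_neg (by lia)]
    rfl
  rw [D.sum_coord u]
  simp only [map_sum, map_smul, D.F_pow_vec, smul_eq_mul]
  have key : ∀ i : Fin (2 * n), D.coord k (D.vec (i + a)) =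
      if a ≤ k ∧ k < 2 * n then D.coord (k - a) (D.vec i) else 0 := by
    intro i
    rw [D.coord_vec _ _ i.2]
    by_cases hi : (i : ℕ) + a < 2 * n
    · rw [D.coord_vec _ _ hi]
      split_ifs <;> first | rfl | lia
    · rw [D.vec_eq_zero (by lia), map_zero]
      split_ifs <;> first | rfl | lia
  simp only [key]
  split_ifs <;> simp

theorem coord_E (k : ℕ) (u : V) :
    D.coord k (D.E u) = ((k + 1 : ℂ) * (2 * n - 1 - k)) * D.coord (k + 1) u := by
  have : D.coord k ∘ₗ D.E = ((k + 1 : ℂ) * (2 * n - 1 - k)) • D.coord (k + 1) := by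
    refine D.dual_ext fun j hj => ?_
    rw [LinearMap.comp_apply, LinearMap.smul_apply, D.coord_vec _ _ hj]
    rcases j with _ | j
    · rw [D.E_vec_zero]
      simp
    · rw [D.E_vec_succ, map_smul, D.coord_vec _ _ (by lia)]
      by_cases h : j = k
      · simp [h]
      · simp [h]
  exact LinearMap.congr_fun this u

theorem mem_L_iff (u : V) : u ∈ D.L ↔ ∀ k < n, D.coord k u = 0 := by
  rw [D.L_eq, LinearMap.mem_ker]
  constructor
  · intro h k hk
    have := D.coord_F_pow n (k + n) u
    rw [h, map_zero, if_pos (by lia)] at this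
    rw [this]
    congr 2
    lia
  · intro h
    refine D.ext_coord fun k hk => ?_
    rw [D.coord_F_pow, map_zero]
    split_ifs with h1
    · exact h _ (by lia)
    · rfl

theorem vec_mem_L {k : ℕ} (hk : n ≤ k) : D.vec k ∈ D.L := by
  rw [mem_L_iff]
  intro j hj
  by_cases h : k < 2 * n
  · rw [D.coord_vec _ _ h, if_neg (by lia)]
  · rw [D.vec_eq_zero (by lia), map_zero]

/-- Since `h` is skew, weight vectors pair to zero unless their weights are opposite. -/
theorem form_vec (i j : ℕ) (hij : i + j ≠ 2 * n - 1) : D.ω (D.vec i) (D.vec j) = 0 := by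
  have hn := D.one_le
  have h := (D.mem_sp D.h).1 D.h.2 (D.vec i) (D.vec j)
  change D.ω (D.H (D.vec i)) (D.vec j) = -D.ω (D.vec i) (D.H (D.vec j)) at h
  rw [D.H_vec, D.H_vec, map_smul, map_smul, LinearMap.smul_apply, smul_eq_mul, smul_eq_mul] at h
  have h2 : ((2 * n - 1 - 2 * i : ℂ) + (2 * n - 1 - 2 * j)) * D.ω (D.vec i) (D.vec j) = 0 := by
    linear_combination h
  rcases mul_eq_zero.1 h2 with h3 | h3
  · exfalso
    have h4 : ((2 * n : ℕ) : ℂ) = ((1 + i + j : ℕ) : ℂ) := by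
      push_cast
      linear_combination (1 / 2 : ℂ) * h3
    have := Nat.cast_injective h4
    lia
  · exact h3

/-- By weights `v₀`, of index `n - 1`, pairs only with the vector of index `n`, which is `f v₀`; the
normalization gives the constant. -/
theorem form_v₀_left (w : V) : D.ω D.v₀ w = (n : ℂ) ^ 2 * D.coord n w := by
  have hn := D.one_le
  have : D.ω D.v₀ = ((n : ℂ) ^ 2) • D.coord n := by
    refine D.dual_ext fun k hk => ?_
    rw [LinearMap.smul_apply, D.coord_vec _ _ hk, smul_eq_mul]
    split_ifs with h
    · subst h
      have hk' : D.vec k = D.F D.v₀ := by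
        rw [← D.vec_pred, D.F_vec, show k - 1 + 1 = k by lia]
      rw [hk', mul_one]
      exact D.form_v₀
    · rw [mul_zero, ← D.vec_pred]
      exact D.form_vec _ _ (by lia)
  exact LinearMap.congr_fun this w

end Basis

end Data

end PseudoSlice

namespace PseudoSlice

namespace Data

/-! ### Coordinates of the Kostant slice and of the pseudo-slice -/

section SlicePoints

variable {n : ℕ} {V : Type*} [AddCommGroup V] [Module ℂ V] (D : Data n V)

theorem form_apply (x : D.sp) (u w : V) :
    D.ω ((x : Module.End ℂ V) u) w = -D.ω u ((x : Module.End ℂ V) w) :=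
  (D.mem_sp x).1 x.2 u w

theorem form_F_pow (k : ℕ) (u w : V) :
    D.ω ((D.F ^ k) u) w = (-1) ^ k * D.ω u ((D.F ^ k) w) := by
  induction k generalizing u w with
  | zero => simp
  | succ k ih =>
    rw [pow_succ' D.F, Module.End.mul_apply, D.form_apply, ih, ← Module.End.mul_apply, ← pow_succ,
      pow_succ' D.F]
    ring

theorem F_pow_odd_mem (j : ℕ) : D.F ^ (2 * j + 1) ∈ D.sp := by
  rw [mem_sp]
  intro u w
  rw [form_F_pow, pow_succ, pow_mul]
  simp

/-- The odd powers of `f`, which span the centralizer of `f`. -/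
def fOdd (j : ℕ) : D.sp := ⟨D.F ^ (2 * j + 1), D.F_pow_odd_mem j⟩

/-- The point of the Kostant slice with given coordinates. -/
def kostantPoint (z : Fin n → ℂ) : D.sp := D.e + ∑ j : Fin n, z j • D.fOdd j

theorem kostantPoint_apply (z : Fin n → ℂ) (u : V) :
    (D.kostantPoint z : Module.End ℂ V) u =
      D.E u + ∑ j : Fin n, z j • (D.F ^ (2 * (j : ℕ) + 1)) u := by
  have h : (D.kostantPoint z : Module.End ℂ V) =
      D.E + ∑ j : Fin n, z j • D.F ^ (2 * (j : ℕ) + 1) := by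
    change D.sp.subtype (D.e + ∑ j : Fin n, z j • D.fOdd j) = _
    change D.sp.toSubmodule.subtype (D.e + ∑ j : Fin n, z j • D.fOdd j) = _
    rw [map_add, map_sum]
    rfl
  rw [h]
  simp [LinearMap.sum_apply]

variable [FiniteDimensional ℂ V]

/-- An operator commuting with `f` is determined by its value at the vector of index `0`, which
generates `V` under `f`; hence it is a polynomial in `f`. The adjoint of `f^i` is `(-1)^i f^i`, so
skewness eliminates the even powers. -/
theorem mem_kostantSlice_iff (x : D.sp) :
    x ∈ D.KostantSlice ↔ ∃ z, D.kostantPoint z = x := by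
  have hn := D.one_le
  constructor
  · intro hx
    set y : D.sp := x - D.e with hy
    have hcomm : ∀ u, (y : Module.End ℂ V) (D.F u) = D.F ((y : Module.End ℂ V) u) := fun u => by
      have h := congrArg (fun x : D.sp => (x : Module.End ℂ V) u) (show ⁅D.f, y⁆ = 0 from hx)
      change D.F ((y : Module.End ℂ V) u) - (y : Module.End ℂ V) (D.F u) = 0 at h
      exact (sub_eq_zero.1 h).symm
    let a : ℕ → ℂ := fun k => D.coord k ((y : Module.End ℂ V) (D.vec 0))
    have hyv : ∀ j, (y : Module.End ℂ V) (D.vec j) =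
        (D.F ^ j) ((y : Module.End ℂ V) (D.vec 0)) := by
      intro j
      induction j with
      | zero => rfl
      | succ j ih => rw [← D.F_vec, hcomm, ih, pow_succ', Module.End.mul_apply]
    have hycoord : ∀ k j, D.coord k ((y : Module.End ℂ V) (D.vec j)) =
        if j ≤ k ∧ k < 2 * n then a (k - j) else 0 := fun k j => by
      rw [hyv, D.coord_F_pow]
    have heven : ∀ k, Even k → k < 2 * n → a k = 0 := by
      intro k hk hk2
      have hsum : ∀ u : V, (y : Module.End ℂ V) u =
          ∑ i : Fin (2 * n), a i • (D.F ^ (i : ℕ)) u := by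
        intro u
        have : (y : Module.End ℂ V) = ∑ i : Fin (2 * n), a i • D.F ^ (i : ℕ) := by
          refine D.basis.ext fun j => ?_
          rw [D.basis_eq, LinearMap.sum_apply]
          refine D.ext_coord fun m hm => ?_
          rw [hycoord, map_sum]
          simp only [LinearMap.smul_apply, map_smul, smul_eq_mul, D.coord_F_pow]
          rw [if_congr (and_iff_left hm) rfl rfl]
          split_ifs with hjm
          · rw [Finset.sum_eq_single ⟨m - j, by lia⟩]
            · rw [if_pos (by simp only; lia), D.coord_vec _ _ j.2, if_pos (by simp only; lia),
                mul_one]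
            · intro i _ hi
              have hi' : (i : ℕ) ≠ m - j := fun h => hi (Fin.ext h)
              split_ifs with h1
              · rw [D.coord_vec _ _ j.2, if_neg (by lia), mul_zero]
              · rw [mul_zero]
            · simp
          · symm
            refine Finset.sum_eq_zero fun i _ => ?_
            split_ifs with h1
            · rw [D.coord_vec _ _ j.2, if_neg (by lia), mul_zero]
            · rw [mul_zero]
        rw [this, LinearMap.sum_apply]
        rfl
      have hskew : ∑ i : Fin (2 * n), (a i * (-1) ^ (i : ℕ)) • (D.F ^ (i : ℕ)) (D.vec 0) =
          - (y : Module.End ℂ V) (D.vec 0) := by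
        rw [← sub_eq_zero]
        apply D.nondeg.2
        intro u
        have h1 := D.form_apply y u (D.vec 0)
        rw [hsum u] at h1
        simp only [map_sum, map_smul, LinearMap.sum_apply, LinearMap.smul_apply, smul_eq_mul,
          D.form_F_pow] at h1
        simp only [map_sub, map_neg, map_sum, map_smul, smul_eq_mul]
        rw [← h1, sub_eq_zero]
        exact Finset.sum_congr rfl fun i _ => by ring
      have h2 := congrArg (D.coord k) hskew
      simp only [map_sum, map_smul, map_neg, smul_eq_mul, D.F_pow_vec, zero_add] at h2
      rw [Finset.sum_eq_single ⟨k, hk2⟩, D.coord_vec _ _ hk2, if_pos rfl, hk.neg_one_pow] at h2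
      · have h3 : a k = -a k := by simpa using h2
        have : (2 : ℂ) * a k = 0 := by linear_combination h3
        simpa using this
      · intro i _ hi
        rw [D.coord_vec _ _ i.2, if_neg (fun h => hi (Fin.ext h)), mul_zero]
      · simp
    refine ⟨fun j => a (2 * j + 1), ?_⟩
    have hx' : x = D.e + y := by rw [hy]; abel
    rw [hx']
    apply Subtype.ext
    refine D.basis.ext fun j => ?_
    rw [D.kostantPoint_apply, D.basis_eq]
    change _ = D.E (D.vec j) + (y : Module.End ℂ V) (D.vec j)
    congr 1
    refine D.ext_coord fun m hm => ?_
    rw [hycoord, map_sum]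
    simp only [map_smul, smul_eq_mul, D.coord_F_pow]
    by_cases hodd : (j : ℕ) ≤ m ∧ Odd (m - j)
    · obtain ⟨hjm, t, ht⟩ := hodd
      rw [if_pos ⟨hjm, hm⟩, Finset.sum_eq_single ⟨t, by lia⟩]
      · rw [if_pos (by simp only; lia), D.coord_vec _ _ j.2, if_pos (by simp only; lia), mul_one, ht]
      · intro i _ hi
        have hi' : (i : ℕ) ≠ t := fun h => hi (Fin.ext h)
        split_ifs with h1
        · rw [D.coord_vec _ _ j.2, if_neg (by lia), mul_zero]
        · rw [mul_zero]
      · simp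
    · have hr : (if (j : ℕ) ≤ m ∧ m < 2 * n then a (m - j) else 0) = 0 := by
        split_ifs with h1
        · refine heven _ ?_ (by lia)
          rw [← Nat.not_odd_iff_even]
          exact fun h => hodd ⟨h1.1, h⟩
        · rfl
      rw [hr]
      refine Finset.sum_eq_zero fun i _ => ?_
      split_ifs with h1
      · rw [D.coord_vec _ _ j.2, if_neg, mul_zero]
        intro h
        exact hodd ⟨by lia, ⟨i, by lia⟩⟩
      · rw [mul_zero]
  · rintro ⟨z, rfl⟩
    change ⁅D.f, D.kostantPoint z - D.e⁆ = 0
    rw [kostantPoint, add_sub_cancel_left]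
    apply Subtype.ext
    have h : ((∑ j : Fin n, z j • D.fOdd j : D.sp) : Module.End ℂ V) =
        ∑ j : Fin n, z j • D.F ^ (2 * (j : ℕ) + 1) := by
      change D.sp.toSubmodule.subtype (∑ j : Fin n, z j • D.fOdd j) = _
      rw [map_sum]
      rfl
    rw [LieSubalgebra.coe_bracket, h, Ring.lie_def, Finset.mul_sum, Finset.sum_mul,
      ← Finset.sum_sub_distrib]
    refine Finset.sum_eq_zero fun j _ => ?_
    rw [mul_smul_comm, smul_mul_assoc, ← pow_succ, ← pow_succ', sub_self]

/-- The vector of `v₀ + L` with given coordinates. -/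
noncomputable def sliceVec (l : Fin n → ℂ) : V := D.v₀ + ∑ i : Fin n, l i • D.vec (n + i)

theorem mem_L_iff_sum (u : V) :
    u ∈ D.L ↔ u = ∑ i : Fin n, D.coord (n + i) u • D.vec (n + i) := by
  constructor
  · intro h
    rw [mem_L_iff] at h
    refine D.ext_coord fun k hk => ?_
    simp only [map_sum, map_smul, smul_eq_mul]
    by_cases hkn : k < n
    · rw [h k hkn]
      symm
      refine Finset.sum_eq_zero fun i _ => ?_
      rw [D.coord_vec _ _ (by lia), if_neg (by lia), mul_zero]
    · rw [Finset.sum_eq_single ⟨k - n, by lia⟩]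
      · rw [D.coord_vec _ _ (by simp only; lia), if_pos (by simp only; lia), mul_one]
        congr 2
        simp only
        lia
      · intro i _ hi
        have hi' : (i : ℕ) ≠ k - n := fun h => hi (Fin.ext h)
        rw [D.coord_vec _ _ (by lia), if_neg (by lia), mul_zero]
      · simp
  · intro h
    rw [h]
    exact D.L.sum_mem fun i _ => D.L.smul_mem _ (D.vec_mem_L (by lia))

/-- The point of the pseudo-slice with given coordinates. -/
noncomputable def slicePoint (z l : Fin n → ℂ) : D.Slice :=
  ⟨(D.kostantPoint z, D.sliceVec l), (D.mem_kostantSlice_iff _).2 ⟨z, rfl⟩, by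
    simp only [sliceVec, add_sub_cancel_left]
    exact D.L.sum_mem fun i _ => D.L.smul_mem _ (D.vec_mem_L (by lia))⟩

theorem exists_slicePoint (s : D.Slice) : ∃ z l, D.slicePoint z l = s := by
  obtain ⟨⟨x, v⟩, hx, hv⟩ := s
  obtain ⟨z, rfl⟩ := (D.mem_kostantSlice_iff x).1 hx
  refine ⟨z, fun i => D.coord (n + i) (v - D.v₀), Subtype.ext (Prod.ext rfl ?_)⟩
  change D.v₀ + _ = v
  rw [← (D.mem_L_iff_sum (v - D.v₀)).1 hv]
  abel

theorem coord_kostantPoint (z : Fin n → ℂ) (k : ℕ) (u : V) :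
    D.coord k ((D.kostantPoint z : Module.End ℂ V) u) =
      ((k + 1 : ℂ) * (2 * n - 1 - k)) * D.coord (k + 1) u +
        ∑ j : Fin n, z j * if 2 * (j : ℕ) + 1 ≤ k ∧ k < 2 * n then
          D.coord (k - (2 * j + 1)) u else 0 := by
  rw [D.kostantPoint_apply, map_add, D.coord_E, map_sum]
  simp only [map_smul, D.coord_F_pow, smul_eq_mul]

theorem form_slice (s : D.Slice) {u : V} (hu : u ∈ D.L) :
    D.ω s.1.2 u = (n : ℂ) ^ 2 * D.coord n u := by
  have h := D.isotropic_L _ s.2.2 u hu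
  rw [map_sub, LinearMap.sub_apply, sub_eq_zero] at h
  rw [h, D.form_v₀_left]

theorem coord_v₀ (k : ℕ) : D.coord k D.v₀ = if k + 1 = n then 1 else 0 := by
  have hn := D.one_le
  rw [← D.vec_pred, D.coord_vec _ _ (by lia)]
  split_ifs <;> first | rfl | lia

theorem coord_slice_snd (s : D.Slice) {k : ℕ} (hk : k < n) :
    D.coord k s.1.2 = if k + 1 = n then 1 else 0 := by
  have h := (D.mem_L_iff _).1 s.2.2 k hk
  rw [map_sub, sub_eq_zero, D.coord_v₀] at h
  exact h

theorem shift_apply (p : D.sp × V) (u : V) :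
    (D.shift p : Module.End ℂ V) u = (p.1 : Module.End ℂ V) u - D.ω p.2 u • p.2 := rfl

/-- On the pseudo-slice, `x - v²` preserves `L`. -/
theorem shift_mem_L (s : D.Slice) {u : V} (hu : u ∈ D.L) :
    (D.shift s.1 : Module.End ℂ V) u ∈ D.L := by
  have hn := D.one_le
  rw [mem_L_iff]
  intro k hk
  rw [D.shift_apply, map_sub, map_smul, D.form_slice s hu, D.coord_slice_snd s hk, smul_eq_mul]
  obtain ⟨z, hz⟩ := (D.mem_kostantSlice_iff _).1 s.2.1
  rw [← hz, D.coord_kostantPoint, Finset.sum_eq_zero, add_zero]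
  · rw [mem_L_iff] at hu
    -- Only the coordinate of index `n - 1` is critical. There `e` contributes `n · n` times the
    -- coordinate of index `n`, and `v²` subtracts `n²` times the same coordinate.
    split_ifs with h
    · have : (n : ℂ) = k + 1 := by exact_mod_cast h.symm
      rw [show D.coord (k + 1) = D.coord n by rw [h], this]
      ring
    · rw [hu (k + 1) (by lia)]
      ring
  · intro j _
    rw [mem_L_iff] at hu
    split_ifs with h
    · rw [hu _ (by lia), mul_zero]
    · rw [mul_zero]

/-- The basis of `L` formed by the basis vectors of `V` of index at least `n`. -/
noncomputable def basisL : Module.Basis (Fin n) ℂ D.L :=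
  have : Nonempty (Fin n) := ⟨⟨0, D.one_le⟩⟩
  basisOfTopLeSpanOfCardEqFinrank (fun i : Fin n => ⟨D.vec (n + i), D.vec_mem_L (by lia)⟩)
    (fun u _ => by
      have h := (D.mem_L_iff_sum u).1 u.2
      have : u = ∑ i : Fin n, D.coord (n + i) u •
          (⟨D.vec (n + i), D.vec_mem_L (by lia)⟩ : D.L) := by
        apply Subtype.ext
        refine h.trans ?_
        simp
      rw [this]
      exact Submodule.sum_mem _ fun i _ => Submodule.smul_mem _ _
        (Submodule.subset_span ⟨i, rfl⟩))
    (by rw [Fintype.card_fin, D.finrank_L])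

theorem basisL_coe (i : Fin n) : (D.basisL i : V) = D.vec (n + i) := by
  simp [basisL]

theorem basisL_repr (u : D.L) (i : Fin n) : D.basisL.repr u i = D.coord (n + i) u := by
  have : D.basisL.coord i = D.coord (n + i) ∘ₗ D.L.subtype := by
    refine D.basisL.ext fun j => ?_
    rw [LinearMap.comp_apply, Submodule.subtype_apply, D.basisL_coe, D.coord_vec _ _ (by lia)]
    simp [Finsupp.single_apply, Fin.ext_iff]
  exact LinearMap.congr_fun this u

theorem toGl_coe (s : D.Slice) (u : D.L) :
    (D.toGl s.1 u : V) = (D.shift s.1 : Module.End ℂ V) u := by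
  have h := D.shift_mem_L s u.2
  exact congrArg Subtype.val (D.prL_coe ⟨_, h⟩)

end SlicePoints

end Data

end PseudoSlice

namespace PseudoSlice

namespace Data

/-! ### Matrices of `x` and of `(x - v²)|_L` over the pseudo-slice -/

section SliceCoordinates

variable {n : ℕ} {V : Type*} [AddCommGroup V] [Module ℂ V] (D : Data n V)

/-- Polynomials in the coordinates of the pseudo-slice. -/
abbrev SliceRing (n : ℕ) : Type := MvPolynomial (Fin n ⊕ Fin n) ℂ

/-- The coefficient of `f ^ (k - 1)` in the Kostant slice, as a polynomial in the coordinates. -/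
noncomputable def zVar (n k : ℕ) : SliceRing n :=
  if h : 2 ≤ k ∧ k ≤ 2 * n ∧ Even k then MvPolynomial.X (Sum.inl ⟨k / 2 - 1, by lia⟩) else 0

theorem eval_zVar (z l : Fin n → ℂ) (k : ℕ) :
    MvPolynomial.eval (Sum.elim z l) (zVar n k) =
      ∑ j : Fin n, z j * if 2 * (j : ℕ) + 2 = k then 1 else 0 := by
  rw [zVar]
  split_ifs with h
  · obtain ⟨h1, h2, t, ht⟩ := h
    rw [MvPolynomial.eval_X, Sum.elim_inl, Finset.sum_eq_single ⟨k / 2 - 1, by lia⟩]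
    · rw [if_pos (by simp only; lia), mul_one]
    · intro j _ hj
      have hj' : (j : ℕ) ≠ k / 2 - 1 := fun h => hj (Fin.ext h)
      rw [if_neg (by lia), mul_zero]
    · simp
  · rw [map_zero]
    symm
    refine Finset.sum_eq_zero fun j _ => ?_
    rw [if_neg, mul_zero]
    intro hj
    exact h ⟨by lia, by lia, ⟨j + 1, by lia⟩⟩

/-- The matrix of a point of the Kostant slice. -/
noncomputable def kostantMatrix (n : ℕ) : Matrix (Fin (2 * n)) (Fin (2 * n)) (SliceRing n) :=
  fun i j => if (j : ℕ) = i + 1 then MvPolynomial.C ((j * (2 * n - j) : ℝ) : ℂ) else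
    if (j : ℕ) ≤ i then zVar n (i + 1 - j) else 0

/-- The `L`-coordinates of the vector, scaled. -/
noncomputable def lVar (n k : ℕ) : SliceRing n :=
  if h : 1 ≤ k ∧ k ≤ n then
    -(MvPolynomial.C ((n : ℂ) ^ 2) * MvPolynomial.X (Sum.inr ⟨k - 1, by lia⟩)) else 0

/-- The matrix of the restriction of `x - v²` to `L` for a point of the pseudo-slice. -/
noncomputable def leviMatrix (n : ℕ) : Matrix (Fin n) (Fin n) (SliceRing n) :=
  fun i j => if (j : ℕ) = i + 1 then MvPolynomial.C (((n + j) * (n - j) : ℝ) : ℂ) else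
    if (j : ℕ) ≤ i then zVar n (i + 1 - j) + if (j : ℕ) = 0 then lVar n (i + 1) else 0 else 0

variable [FiniteDimensional ℂ V]

theorem coord_kostantPoint_vec (z l : Fin n → ℂ) (i j : ℕ) (hi : i < 2 * n) (hj : j < 2 * n) :
    D.coord i ((D.kostantPoint z : Module.End ℂ V) (D.vec j)) =
      if j = i + 1 then (j * (2 * n - j) : ℂ) else
        if j ≤ i then MvPolynomial.eval (Sum.elim z l) (zVar n (i + 1 - j)) else 0 := by
  rw [D.coord_kostantPoint, D.coord_vec _ _ hj, eval_zVar]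
  simp only [D.coord_vec _ _ hj]
  split_ifs with h1 h2
  · rw [Finset.sum_eq_zero, h1]
    · push_cast
      ring
    · intro t _
      split_ifs <;> first | lia | simp
  · rw [mul_zero, zero_add]
    refine Finset.sum_congr rfl fun t _ => ?_
    congr 1
    split_ifs <;> first | rfl | lia
  · rw [mul_zero, zero_add]
    refine Finset.sum_eq_zero fun t _ => ?_
    split_ifs <;> first | lia | simp

theorem kostantMatrix_map (z l : Fin n → ℂ) :
    (kostantMatrix n).map (MvPolynomial.eval (Sum.elim z l)) =
      LinearMap.toMatrix D.basis D.basis (D.kostantPoint z : Module.End ℂ V) := by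
  ext i j
  have h := D.coord_kostantPoint_vec z l i j i.2 j.2
  rw [coord, dif_pos i.2, Module.Basis.coord_apply] at h
  rw [Matrix.map_apply, LinearMap.toMatrix_apply, D.basis_eq]
  refine Eq.trans ?_ h.symm
  rw [kostantMatrix]
  split_ifs <;> simp

/-- On `L` the form `⟨v, ·⟩` is `n²` times the coordinate of index `n`, the first one of `L`, so
`v²` affects only the first column. The superdiagonal entries are those of `e`, `k (2n - k)`, at `k
= n + j`. -/
theorem leviMatrix_map (z l : Fin n → ℂ) :
    (leviMatrix n).map (MvPolynomial.eval (Sum.elim z l)) =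
      LinearMap.toMatrix D.basisL D.basisL (D.toGl (D.slicePoint z l).1) := by
  have hn := D.one_le
  ext i j
  rw [Matrix.map_apply, LinearMap.toMatrix_apply, D.basisL_repr, D.toGl_coe, D.basisL_coe,
    D.shift_apply, map_sub, map_smul, smul_eq_mul, D.form_slice _ (D.vec_mem_L (by lia)),
    D.coord_vec _ _ (by lia)]
  change _ = D.coord (n + i) ((D.kostantPoint z : Module.End ℂ V) (D.vec (n + j))) -
    _ * D.coord (n + i) (D.sliceVec l)
  rw [D.coord_kostantPoint_vec z l _ _ (by lia) (by lia)]
  have hl : D.coord (n + i) (D.sliceVec l) = l i := by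
    rw [sliceVec, map_add, D.coord_v₀, if_neg (by lia), zero_add, map_sum,
      Finset.sum_eq_single i]
    · rw [map_smul, D.coord_vec _ _ (by lia), if_pos rfl, smul_eq_mul, mul_one]
    · intro t _ ht
      rw [map_smul, D.coord_vec _ _ (by lia),
        if_neg (fun h => ht (Fin.ext (by lia))), smul_zero]
    · simp
  rw [hl, leviMatrix, show n + (i : ℕ) + 1 - (n + j) = i + 1 - j by lia]
  have hlv : MvPolynomial.eval (Sum.elim z l) (lVar n (i + 1)) = -((n : ℂ) ^ 2 * l i) := by
    rw [lVar, dif_pos (by lia)]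
    simp
  split_ifs with h1 h2 h3 h4 h5 h6 h7 <;> first | lia | skip
  · simp only [MvPolynomial.eval_C]
    push_cast
    ring
  · simp [hlv, sub_eq_add_neg]
  · simp
  · simp

theorem kostantMatrix_charpoly (z l : Fin n → ℂ) :
    (kostantMatrix n).charpoly.map (MvPolynomial.eval (Sum.elim z l)) =
      LinearMap.charpoly (D.kostantPoint z : Module.End ℂ V) := by
  rw [← Matrix.charpoly_map, D.kostantMatrix_map, LinearMap.charpoly_toMatrix]

theorem leviMatrix_charpoly (z l : Fin n → ℂ) :
    (leviMatrix n).charpoly.map (MvPolynomial.eval (Sum.elim z l)) =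
      LinearMap.charpoly (D.toGl (D.slicePoint z l).1) := by
  rw [← Matrix.charpoly_map, D.leviMatrix_map, LinearMap.charpoly_toMatrix]

end SliceCoordinates

/-! ### The coefficients of the two characteristic polynomials as coordinates on the pseudo-slice -/

section Generation

variable {n : ℕ}

/-- The nontrivial coefficients of the characteristic polynomials, on the pseudo-slice. -/
noncomputable def sliceCoeff (n : ℕ) : Fin n ⊕ Fin n → SliceRing n :=
  Sum.elim (fun i => (kostantMatrix n).charpoly.coeff (2 * n - 2 * (i + 1)))
    fun i => (leviMatrix n).charpoly.coeff (n - (i + 1))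

theorem kostantMatrix_isHessenberg (n : ℕ) :
    IsHessenberg (kostantMatrix n) (fun k => Algebra.adjoin ℂ {r | ∃ j < k, r = zVar n j})
      (zVar n) fun j => j * (2 * n - j) where
  mono a b hab := Algebra.adjoin_mono fun _ ⟨j, hj, hr⟩ => ⟨j, by lia, hr⟩
  mem k := Algebra.subset_adjoin ⟨k, by lia, rfl⟩
  pos m h0 hm := by
    have h1 : (0 : ℝ) < m := by exact_mod_cast h0
    have h2 : (m : ℝ) < 2 * n := by exact_mod_cast hm
    exact mul_pos h1 (by linarith)
  eq_above i j h := by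
    rw [kostantMatrix, if_pos h]
    rfl
  eq_zero i j h := by rw [kostantMatrix, if_neg (by lia), if_neg (by lia)]
  below i j h := ⟨1, zero_le_one, fun _ => rfl, by
    rw [kostantMatrix, if_neg (by lia), if_pos h]
    simp⟩

/-- The coordinates of the Kostant slice are already known from the matrix of `x`, so they are put
in every step of the filtration and play the role of constants. The variables `lVar` then occur only
in the first column, whence the multiples `1` and `0`. -/
theorem leviMatrix_isHessenberg (n : ℕ) :
    IsHessenberg (leviMatrix n) (fun k => Algebra.adjoin ℂ
      (Set.range (zVar n) ∪ {r | ∃ j < k, r = lVar n j})) (lVar n)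
      fun j => (n + j) * (n - j) where
  mono a b hab := Algebra.adjoin_mono (Set.union_subset_union_right _
    fun _ ⟨j, hj, hr⟩ => ⟨j, by lia, hr⟩)
  mem k := Algebra.subset_adjoin (Or.inr ⟨k, by lia, rfl⟩)
  pos m h0 hm := by
    have h1 : (0 : ℝ) < m := by exact_mod_cast h0
    have h2 : (m : ℝ) < n := by exact_mod_cast hm
    exact mul_pos (by linarith) (by linarith)
  eq_above i j h := by
    rw [leviMatrix, if_pos h]
    rfl
  eq_zero i j h := by rw [leviMatrix, if_neg (by lia), if_neg (by lia)]
  below i j h := by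
    rw [leviMatrix, if_neg (by lia), if_pos h]
    have hz : zVar n (i + 1 - j) ∈ Algebra.adjoin ℂ
        (Set.range (zVar n) ∪ {r | ∃ k < (i : ℕ) + 1 - j, r = lVar n k}) :=
      Algebra.subset_adjoin (Or.inl ⟨_, rfl⟩)
    by_cases hj : (j : ℕ) = 0
    · refine ⟨1, zero_le_one, fun _ => rfl, ?_⟩
      rw [if_pos hj, show (i : ℕ) + 1 - j = i + 1 by lia] at *
      simpa using hz
    · refine ⟨0, le_rfl, fun h => absurd h hj, ?_⟩
      rw [if_neg hj]
      simpa using hz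

/-- The triangular system is solved recursively; for odd index, or index out of range, the variable
is zero by convention. -/
theorem zVar_mem_adjoin (k : ℕ) :
    zVar n k ∈ Algebra.adjoin ℂ (Set.range fun i : Fin n => sliceCoeff n (Sum.inl i)) := by
  induction k using Nat.strong_induction_on with
  | _ k ih =>
  by_cases hk : 2 ≤ k ∧ k ≤ 2 * n ∧ Even k
  · obtain ⟨h1, h2, t, ht⟩ := hk
    obtain ⟨κ, hκ, hmem⟩ := (kostantMatrix_isHessenberg n).charpoly_coeff (by lia) k (by lia) h2
    have hle : Algebra.adjoin ℂ {r | ∃ j < k, r = zVar n j} ≤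
        Algebra.adjoin ℂ (Set.range fun i : Fin n => sliceCoeff n (Sum.inl i)) :=
      Algebra.adjoin_le fun r ⟨j, hj, hr⟩ => hr ▸ ih j hj
    have hc : (kostantMatrix n).charpoly.coeff (2 * n - k) ∈
        Algebra.adjoin ℂ (Set.range fun i : Fin n => sliceCoeff n (Sum.inl i)) := by
      refine Algebra.subset_adjoin ⟨⟨t - 1, by lia⟩, ?_⟩
      simp only [sliceCoeff, Sum.elim_inl]
      congr 1
      lia
    have h := Subalgebra.smul_mem _ (Subalgebra.sub_mem _ (hle hmem) hc) ((κ : ℂ)⁻¹)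
    rw [add_sub_cancel_left, smul_smul, inv_mul_cancel₀ (by exact_mod_cast hκ.ne'),
      one_smul] at h
    exact h
  · rw [zVar, dif_neg hk]
    exact Subalgebra.zero_mem _

theorem lVar_mem_adjoin (k : ℕ) :
    lVar n k ∈ Algebra.adjoin ℂ (Set.range (sliceCoeff n)) := by
  induction k using Nat.strong_induction_on with
  | _ k ih =>
  by_cases hk : 1 ≤ k ∧ k ≤ n
  · obtain ⟨κ, hκ, hmem⟩ := (leviMatrix_isHessenberg n).charpoly_coeff (by lia) k hk.1 hk.2
    have hle : Algebra.adjoin ℂ (Set.range (zVar n) ∪ {r | ∃ j < k, r = lVar n j}) ≤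
        Algebra.adjoin ℂ (Set.range (sliceCoeff n)) := by
      refine Algebra.adjoin_le ?_
      rintro r (⟨j, rfl⟩ | ⟨j, hj, rfl⟩)
      · refine Algebra.adjoin_mono ?_ (zVar_mem_adjoin j)
        rintro _ ⟨i, rfl⟩
        exact ⟨_, rfl⟩
      · exact ih j hj
    have hc : (leviMatrix n).charpoly.coeff (n - k) ∈
        Algebra.adjoin ℂ (Set.range (sliceCoeff n)) := by
      refine Algebra.subset_adjoin ⟨Sum.inr ⟨k - 1, by lia⟩, ?_⟩
      simp only [sliceCoeff, Sum.elim_inr]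
      congr 1
      lia
    have h := Subalgebra.smul_mem _ (Subalgebra.sub_mem _ (hle hmem) hc) ((κ : ℂ)⁻¹)
    rw [add_sub_cancel_left, smul_smul, inv_mul_cancel₀ (by exact_mod_cast hκ.ne'),
      one_smul] at h
    exact h
  · rw [lVar, dif_neg hk]
    exact Subalgebra.zero_mem _

theorem aeval_sliceCoeff_surjective (n : ℕ) :
    Function.Surjective (MvPolynomial.aeval (R := ℂ) (sliceCoeff n)) := by
  rw [← AlgHom.range_eq_top, ← Algebra.adjoin_range_eq_range_aeval, eq_top_iff,
    ← MvPolynomial.adjoin_range_X]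
  refine Algebra.adjoin_le ?_
  rintro _ ⟨i | i, rfl⟩
  · have h := zVar_mem_adjoin (n := n) (2 * (i + 1))
    rw [zVar, dif_pos ⟨by lia, by lia, ⟨i + 1, by lia⟩⟩] at h
    have hi : (⟨2 * ((i : ℕ) + 1) / 2 - 1, by lia⟩ : Fin n) = i := Fin.ext (by simp only; lia)
    rw [hi] at h
    refine Algebra.adjoin_mono ?_ h
    rintro _ ⟨i, rfl⟩
    exact ⟨_, rfl⟩
  · have h := lVar_mem_adjoin (n := n) (i + 1)
    rw [lVar, dif_pos ⟨by lia, by lia⟩] at h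
    have hn : (-((n : ℂ) ^ 2)) ≠ 0 := by
      have := i.2
      simp only [ne_eq, neg_eq_zero, pow_eq_zero_iff (two_ne_zero), Nat.cast_eq_zero]
      lia
    have h2 := Subalgebra.smul_mem _ h ((-((n : ℂ) ^ 2))⁻¹)
    rw [← MvPolynomial.smul_eq_C_mul, ← neg_smul, smul_smul, inv_mul_cancel₀ hn, one_smul] at h2
    exact h2

/-- The coefficients of the characteristic polynomials are coordinates on the pseudo-slice. -/
noncomputable def sliceEquiv (n : ℕ) : SliceRing n ≃ₐ[ℂ] SliceRing n :=
  AlgEquiv.ofBijective (MvPolynomial.aeval (sliceCoeff n))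
    ⟨injective_of_surjective_noetherian (MvPolynomial.aeval (R := ℂ) (sliceCoeff n)).toRingHom
      (aeval_sliceCoeff_surjective n), aeval_sliceCoeff_surjective n⟩

/-- The point is obtained by evaluating at `c` the images of the variables under the inverse of the
automorphism `sliceEquiv`. -/
theorem exists_eval_sliceCoeff (c : Fin n ⊕ Fin n → ℂ) :
    ∃ z l : Fin n → ℂ, ∀ i, MvPolynomial.eval (Sum.elim z l) (sliceCoeff n i) = c i := by
  let w : Fin n ⊕ Fin n → ℂ := fun j =>
    MvPolynomial.aeval c ((sliceEquiv n).symm (MvPolynomial.X j))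
  refine ⟨fun i => w (Sum.inl i), fun i => w (Sum.inr i), fun i => ?_⟩
  have hw : Sum.elim (fun i => w (Sum.inl i)) (fun i => w (Sum.inr i)) = w := by
    ext (i | i) <;> rfl
  have h : (MvPolynomial.aeval w : SliceRing n →ₐ[ℂ] ℂ) =
      (MvPolynomial.aeval c).comp (sliceEquiv n).symm.toAlgHom := by
    ext j
    simp [w]
  have h2 : sliceCoeff n i = sliceEquiv n (MvPolynomial.X i) := by
    simp [sliceEquiv]
  rw [hw]
  refine (DFunLike.congr_fun h (sliceCoeff n i)).trans ?_
  rw [h2]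
  simp

end Generation

end Data

end PseudoSlice

namespace PseudoSlice

/-! ### Factorization of polynomials and the determinant detecting cyclic vectors -/

section Operators

open Polynomial

theorem exists_eq_prod_X_sub_C {p : ℂ[X]} (hp : p.Monic) {n : ℕ} (hn : p.natDegree = n) :
    ∃ s : Fin n → ℂ, p = ∏ i, (X - C (s i)) := by
  have hs := (IsAlgClosed.splits p)
  have hcard : p.roots.toList.length = n := by
    rw [Multiset.length_toList, ← hn]
    exact hs.natDegree_eq_card_roots.symm
  subst hcard
  refine ⟨p.roots.toList.get, ?_⟩
  conv_lhs => rw [hs.eq_prod_roots_of_monic hp]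
  have h : (List.ofFn fun i => X - C (p.roots.toList.get i)) =
      p.roots.toList.map fun a => X - C a := by
    conv_rhs => rw [← List.ofFn_get p.roots.toList, List.map_ofFn]
    rfl
  rw [← List.prod_ofFn, h, ← Multiset.prod_coe, ← Multiset.map_coe, Multiset.coe_toList]

/-- An even monic polynomial is a product of factors `X² - s`. -/
theorem exists_eq_prod_X_sq_sub_C {p : ℂ[X]} (hp : p.Monic) {n : ℕ} (hn : p.natDegree = 2 * n)
    (hodd : ∀ k, Odd k → p.coeff k = 0) : ∃ s : Fin n → ℂ, p = ∏ i, (X ^ 2 - C (s i)) := by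
  have hexp : expand ℂ 2 (contract 2 p) = p := by
    ext k
    rw [coeff_expand two_pos]
    split_ifs with h
    · rw [coeff_contract two_ne_zero, Nat.div_mul_cancel h]
    · exact (hodd k (Nat.not_even_iff_odd.1 fun h2 => h h2.two_dvd)).symm
  have hdeg : (contract 2 p).natDegree = n := by
    have := congrArg natDegree hexp
    rw [natDegree_expand, hn] at this
    lia
  have hmon : (contract 2 p).Monic := by
    rw [← monic_expand_iff two_pos, hexp]
    exact hp
  obtain ⟨s, hs⟩ := exists_eq_prod_X_sub_C hmon hdeg
  refine ⟨s, ?_⟩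
  rw [← hexp, hs, map_prod]
  simp

variable {U : Type*} [AddCommGroup U] [Module ℂ U] [FiniteDimensional ℂ U] {m : ℕ}
  (b : Module.Basis (Fin m) ℂ U)

/-- The determinant of the first iterates of a vector, which detects cyclic vectors. -/
noncomputable def cyclicDet (T : Module.End ℂ U) (w : U) : ℂ :=
  b.det fun i : Fin m => (T ^ (i : ℕ)) w

theorem isCyclic_iff_cyclicDet {T : Module.End ℂ U} {w : U} :
    IsCyclic T w ↔ cyclicDet b T w ≠ 0 := by
  have hm : Module.finrank ℂ U = m := by rw [Module.finrank_eq_card_basis b, Fintype.card_fin]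
  rw [cyclicDet, ← isUnit_iff_ne_zero, ← Module.Basis.is_basis_iff_det]
  constructor
  · intro h
    have hspan : Submodule.span ℂ (Set.range fun i : Fin m => (T ^ (i : ℕ)) w) = ⊤ := by
      rw [eq_top_iff]
      intro u _
      rcases Nat.eq_zero_or_pos m with rfl | hpos
      · have : Subsingleton U := Module.finrank_zero_iff.1 hm
        rw [Subsingleton.elim u 0]
        exact Submodule.zero_mem _
      obtain ⟨f, rfl⟩ := h u
      rw [T.aeval_eq_aeval_mod_charpoly, aeval_eq_sum_range' (n := m), LinearMap.sum_apply]
      · exact Submodule.sum_mem _ fun i hi => Submodule.smul_mem _ _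
          (Submodule.subset_span ⟨⟨i, Finset.mem_range.1 hi⟩, rfl⟩)
      · rw [← hm, ← natDegree_charpoly T]
        refine natDegree_modByMonic_lt _ T.charpoly_monic fun h => ?_
        have := natDegree_charpoly T
        rw [h, natDegree_one, hm] at this
        lia
    exact ⟨linearIndependent_of_top_le_span_of_card_eq_finrank hspan.ge
      (by rw [hm, Fintype.card_fin]), hspan⟩
  · rintro ⟨-, h⟩
    rw [isCyclic_iff]
    intro S hw hS
    rw [eq_top_iff, ← h, Submodule.span_le]
    rintro _ ⟨i, rfl⟩
    simp only
    generalize (i : ℕ) = k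
    induction k with
    | zero => exact hw
    | succ k ih =>
      rw [pow_succ', Module.End.mul_apply]
      exact hS _ ih

theorem cyclicDet_mem_polyFun {W : Type*} [AddCommGroup W] [Module ℂ W] {φ : W → Module.End ℂ U}
    {ψ : W → U} (hφ : IsPolyMap φ) (hψ : IsPolyMap ψ) :
    (fun p => cyclicDet b (φ p) (ψ p)) ∈ polyFun W := by
  simp only [cyclicDet, Module.Basis.det_apply]
  refine det_mem_polyFun fun i j => ?_
  exact (hφ.pow j).apply hψ (b.coord i)

/-- The last basis vector is cyclic for an operator with a Hessenberg matrix. -/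
theorem isCyclic_of_hessenberg (hm : 0 < m) {T : Module.End ℂ U}
    (h0 : ∀ i j : Fin m, (i : ℕ) + 1 < j → b.repr (T (b j)) i = 0)
    (h1 : ∀ i j : Fin m, (j : ℕ) = i + 1 → b.repr (T (b j)) i ≠ 0) :
    IsCyclic T (b ⟨m - 1, by lia⟩) := by
  rw [isCyclic_iff]
  intro S hw hS
  -- From the last basis vector downwards: `T b_(i+1)` has a nonzero coefficient at `b_i`, and its
  -- other terms involve only vectors of larger index, already in `S`.
  have key : ∀ k, ∀ i : Fin m, m ≤ i + 1 + k → b i ∈ S := by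
    intro k
    induction k with
    | zero =>
      intro i hi
      rwa [show i = ⟨m - 1, by lia⟩ from Fin.ext (by simp only; lia)]
    | succ k ih =>
      intro i hi
      by_cases hik : m ≤ i + 1 + k
      · exact ih i hik
      have hi1 : (i : ℕ) + 1 < m := by lia
      have hT := hS _ (ih ⟨i + 1, hi1⟩ (by simp only; lia))
      rw [← b.sum_repr (T (b ⟨i + 1, hi1⟩)), ← Finset.add_sum_erase _ _ (Finset.mem_univ i)] at hT
      have hrest : ∑ j ∈ Finset.univ.erase i, b.repr (T (b ⟨i + 1, hi1⟩)) j • b j ∈ S := by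
        refine S.sum_mem fun j hj => ?_
        have hji : (j : ℕ) ≠ i := fun h => (Finset.mem_erase.1 hj).1 (Fin.ext h)
        rcases lt_or_gt_of_ne hji with hlt | hlt
        · rw [h0 j _ (by simp only; lia), zero_smul]
          exact S.zero_mem
        · exact S.smul_mem _ (ih j (by lia))
      have := S.sub_mem hT hrest
      rw [add_sub_cancel_right] at this
      exact (S.smul_mem_iff (h1 i _ rfl)).1 this
  rw [eq_top_iff, ← b.span_eq, Submodule.span_le]
  rintro _ ⟨i, rfl⟩
  exact key m i (by lia)

end Operators

namespace Data

open Polynomial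

variable {n : ℕ} {V : Type*} [AddCommGroup V] [Module ℂ V] (D : Data n V)

section Group

theorem act_mul (g h : D.Sp) (p : D.sp × V) : D.act (g * h) p = D.act g (D.act h p) := by
  refine Prod.ext (Subtype.ext ?_) rfl
  ext w
  rfl

theorem act_one (p : D.sp × V) : D.act 1 p = p := by
  refine Prod.ext (Subtype.ext ?_) rfl
  ext w
  rfl

theorem act_inv_act (g : D.Sp) (p : D.sp × V) : D.act g⁻¹ (D.act g p) = p := by
  rw [← act_mul, inv_mul_cancel, act_one]

end Group

variable [FiniteDimensional ℂ V]

/-! ### Characteristic polynomials of elements of `sp(V)` -/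

section CharacteristicPolynomials

theorem charpoly_Ad (g : D.Sp) (x : D.sp) :
    LinearMap.charpoly (D.Ad g x : Module.End ℂ V) =
      LinearMap.charpoly (x : Module.End ℂ V) := by
  rw [Ad_coe, LinearEquiv.charpoly_conj]

/-- For `x` in `sp(V)` the operator `t + x` is the adjoint of `t - x`, and the form conjugates the
adjoint into the transpose, which has the same determinant. -/
theorem det_add_eq_det_sub (x : D.sp) (t : ℂ) :
    LinearMap.det (algebraMap ℂ (Module.End ℂ V) t + (x : Module.End ℂ V)) =
      LinearMap.det (algebraMap ℂ (Module.End ℂ V) t - (x : Module.End ℂ V)) := by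
  have h : algebraMap ℂ (Module.End ℂ V) t + (x : Module.End ℂ V) =
      D.adj (algebraMap ℂ (Module.End ℂ V) t - (x : Module.End ℂ V)) := by
    refine D.ext_right fun u w => ?_
    rw [D.form_adj']
    simp only [LinearMap.add_apply, LinearMap.sub_apply, map_add, map_sub, D.form_apply,
      Module.algebraMap_end_apply, map_smul, LinearMap.smul_apply]
    ring
  have hΦ : ∀ a : Module.End ℂ V, LinearMap.det (D.adj a) = LinearMap.det a := by
    intro a
    let Φ : V ≃ₗ[ℂ] Module.Dual ℂ V := D.ω.toDual D.nondeg
    have : D.adj a = Φ.symm.toLinearMap ∘ₗ a.dualMap ∘ₗ Φ.toLinearMap := by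
      ext u
      apply Φ.injective
      ext w
      simp only [LinearMap.comp_apply, LinearEquiv.coe_coe, LinearEquiv.apply_symm_apply]
      exact D.form_adj a u w
    rw [this, ← LinearMap.det_dualMap a]
    exact LinearMap.det_conj a.dualMap Φ.symm
  rw [h, hΦ]

theorem natDegree_charpoly_sp (D : Data n V) (x : Module.End ℂ V) : x.charpoly.natDegree = 2 * n := by
  rw [natDegree_charpoly, D.finrank_V]

theorem charpoly_comp_neg (x : D.sp) :
    (LinearMap.charpoly (x : Module.End ℂ V)).comp (-X) = LinearMap.charpoly (x : Module.End ℂ V) := by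
  refine Polynomial.funext fun t => ?_
  rw [eval_comp, eval_neg, eval_X, LinearMap.eval_charpoly, LinearMap.eval_charpoly,
    ← D.det_add_eq_det_sub x t]
  have : algebraMap ℂ (Module.End ℂ V) (-t) - (x : Module.End ℂ V) =
      (-1 : ℂ) • (algebraMap ℂ (Module.End ℂ V) t + (x : Module.End ℂ V)) := by
    rw [map_neg, neg_one_smul]
    abel
  rw [this, LinearMap.det_smul, D.finrank_V, pow_mul]
  simp

theorem charpoly_coeff_odd (x : D.sp) {k : ℕ} (hk : Odd k) :
    (LinearMap.charpoly (x : Module.End ℂ V)).coeff k = 0 := by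
  have h := congrArg (fun p => coeff p k) (D.charpoly_comp_neg x)
  simp only [← neg_one_mul (X : ℂ[X]), ← C_1, ← C_neg, comp_C_mul_X_coeff, hk.neg_one_pow] at h
  have : (2 : ℂ) * (LinearMap.charpoly (x : Module.End ℂ V)).coeff k = 0 := by
    linear_combination -h
  simpa using this

theorem exists_charpoly_eq (x : D.sp) : ∃ s : Fin n → ℂ,
    LinearMap.charpoly (x : Module.End ℂ V) = ∏ i, (X ^ 2 - C (s i)) :=
  exists_eq_prod_X_sq_sub_C (LinearMap.charpoly_monic _) (D.natDegree_charpoly_sp _)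
    fun _ hk => D.charpoly_coeff_odd x hk

/-- An element of `sp(V)` preserving `L` acts on `V/L`, the dual of `L`, by minus the transpose of
its restriction to `L`. -/
theorem det_sub_eq_of_preserves (y : D.sp) (hy : ∀ u ∈ D.L, (y : Module.End ℂ V) u ∈ D.L) (t : ℂ) :
    LinearMap.det (algebraMap ℂ (Module.End ℂ V) t - (y : Module.End ℂ V)) =
      LinearMap.det (algebraMap ℂ (Module.End ℂ D.L) t - D.block y) *
        LinearMap.det (algebraMap ℂ (Module.End ℂ D.L) t + D.block y) := by
  set T : Module.End ℂ V := algebraMap ℂ (Module.End ℂ V) t - (y : Module.End ℂ V) with hT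
  have hTL : D.L ≤ D.L.comap T := fun u hu => by
    simp only [hT, Submodule.mem_comap, LinearMap.sub_apply, Module.algebraMap_end_apply]
    exact D.L.sub_mem (D.L.smul_mem _ hu) (hy u hu)
  have hblock : ∀ u : D.L, (D.block y u : V) = (y : Module.End ℂ V) u := fun u =>
    congrArg Subtype.val (D.prL_coe ⟨_, hy u u.2⟩)
  let Ψ : V →ₗ[ℂ] Module.Dual ℂ D.L :=
    { toFun := fun u => D.ω u ∘ₗ D.L.subtype
      map_add' := fun a b => by ext; simp
      map_smul' := fun a b => by ext; simp }
  have hker : LinearMap.ker Ψ = D.L := by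
    apply le_antisymm
    · intro u hu
      obtain ⟨l, hl, m, hm, rfl⟩ := Submodule.mem_sup.1
        ((D.isCompl.sup_eq_top ▸ Submodule.mem_top : u ∈ D.L ⊔ D.Ls))
      have hm0 : m = 0 := by
        apply D.nondeg.1
        intro w
        obtain ⟨a, ha, b, hb, rfl⟩ := Submodule.mem_sup.1
          ((D.isCompl.sup_eq_top ▸ Submodule.mem_top : w ∈ D.L ⊔ D.Ls))
        have h1 : D.ω (l + m) a = 0 := LinearMap.congr_fun (LinearMap.mem_ker.1 hu) (⟨a, ha⟩ : D.L)
        rw [map_add, LinearMap.add_apply, D.isotropic_L l hl a ha, zero_add] at h1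
        rw [map_add, h1, D.isotropic_Ls m hm b hb, add_zero]
      rw [hm0, add_zero]
      exact hl
    · intro u hu
      rw [LinearMap.mem_ker]
      ext a
      exact D.isotropic_L u hu a a.2
  have hsurj : Function.Surjective Ψ := by
    rw [← LinearMap.range_eq_top]
    apply Submodule.eq_top_of_finrank_eq
    have := Ψ.finrank_range_add_finrank_ker
    rw [hker, D.finrank_L, D.finrank_V] at this
    rw [Subspace.dual_finrank_eq, D.finrank_L]
    lia
  let e : (V ⧸ D.L) ≃ₗ[ℂ] Module.Dual ℂ D.L :=
    (Submodule.quotEquivOfEq _ _ hker.symm).trans (Ψ.quotKerEquivOfSurjective hsurj)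
  have he : ∀ u, e (Submodule.Quotient.mk u) = Ψ u := fun u => rfl
  have hquot : D.L.mapQ D.L T hTL = e.symm.toLinearMap ∘ₗ
      (algebraMap ℂ (Module.End ℂ D.L) t + D.block y).dualMap ∘ₗ e.toLinearMap := by
    refine Submodule.linearMap_qext _ (LinearMap.ext fun u => e.injective ?_)
    simp only [LinearMap.comp_apply, LinearEquiv.coe_coe, LinearEquiv.apply_symm_apply,
      Submodule.mkQ_apply, Submodule.mapQ_apply, he]
    ext a
    change D.ω (T u) a = D.ω u (((algebraMap ℂ (Module.End ℂ D.L) t + D.block y) a : D.L) : V)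
    simp only [hT, LinearMap.sub_apply, LinearMap.add_apply, Module.algebraMap_end_apply, map_sub,
      map_smul, LinearMap.smul_apply, D.form_apply, Submodule.coe_add, Submodule.coe_smul, hblock,
      map_add]
    ring
  have hres : T.restrict hTL = algebraMap ℂ (Module.End ℂ D.L) t - D.block y := by
    ext u
    simp [hT, hblock]
  rw [LinearMap.det_eq_det_mul_det D.L T hTL, hres, hquot]
  congr 1
  rw [← LinearMap.det_dualMap (algebraMap ℂ (Module.End ℂ D.L) t + D.block y)]
  exact LinearMap.det_conj (algebraMap ℂ (Module.End ℂ D.L) t + D.block y).dualMap e.symm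

theorem charpoly_eq_of_preserves (y : D.sp) (hy : ∀ u ∈ D.L, (y : Module.End ℂ V) u ∈ D.L) :
    LinearMap.charpoly (y : Module.End ℂ V) =
      (D.block y).charpoly * ((-1) ^ n * (D.block y).charpoly.comp (-X)) := by
  refine Polynomial.funext fun t => ?_
  rw [LinearMap.eval_charpoly, D.det_sub_eq_of_preserves y hy, eval_mul, LinearMap.eval_charpoly,
    eval_mul, eval_comp, LinearMap.eval_charpoly]
  congr 1
  have : algebraMap ℂ (Module.End ℂ D.L) t + D.block y = (-1 : ℂ) •
      (algebraMap ℂ (Module.End ℂ D.L) ((-X : ℂ[X]).eval t) - D.block y) := by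
    ext u
    simp
    abel
  rw [this, LinearMap.det_smul, D.finrank_L]
  simp

theorem charpoly_eq_prod_of_preserves (y : D.sp)
    (hy : ∀ u ∈ D.L, (y : Module.End ℂ V) u ∈ D.L) {τ : Fin n → ℂ}
    (hτ : (D.block y).charpoly = ∏ i, (X - C (τ i))) :
    LinearMap.charpoly (y : Module.End ℂ V) = ∏ i, (X ^ 2 - C (τ i ^ 2)) := by
  rw [D.charpoly_eq_of_preserves y hy, hτ, prod_comp]
  have h : ((-1 : ℂ[X])) ^ n = ∏ _i : Fin n, (-1 : ℂ[X]) := by simp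
  rw [h, ← Finset.prod_mul_distrib, ← Finset.prod_mul_distrib]
  refine Finset.prod_congr rfl fun i _ => ?_
  simp only [sub_comp, X_comp, C_comp, C_pow]
  ring

theorem block_levi (y : Module.End ℂ D.L) : D.block (D.levi y : Module.End ℂ V) = y := by
  ext u
  have : (D.levi y : Module.End ℂ V) u = (y u : V) := by
    rw [levi_coe, LinearMap.sub_apply, D.adj_extend_apply_L, sub_zero, extend_apply, D.prL_coe]
  change ((D.prL ((D.levi y : Module.End ℂ V) u) : D.L) : V) = y u
  rw [this, D.prL_coe]

theorem levi_preserves (y : Module.End ℂ D.L) : ∀ u ∈ D.L, (D.levi y : Module.End ℂ V) u ∈ D.L := by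
  intro u hu
  have : (D.levi y : Module.End ℂ V) u = (y ⟨u, hu⟩ : V) := by
    have h := D.adj_extend_apply_L y ⟨u, hu⟩
    simp only at h
    rw [levi_coe, LinearMap.sub_apply, h, sub_zero, extend_apply]
    exact congrArg (fun a => ((y a : D.L) : V)) (D.prL_coe ⟨u, hu⟩)
  rw [this]
  exact (y ⟨u, hu⟩).2

theorem charpoly_levi_toGl (s : D.Slice) :
    LinearMap.charpoly (D.levi (D.toGl s.1) : Module.End ℂ V) =
      LinearMap.charpoly (D.shift s.1 : Module.End ℂ V) := by
  rw [D.charpoly_eq_of_preserves _ (D.levi_preserves _), D.block_levi,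
    D.charpoly_eq_of_preserves _ fun u hu => D.shift_mem_L s hu]
  rfl

end CharacteristicPolynomials

/-! ### Classification of cyclic pairs up to `Sp(V)` -/

section Conjugacy

theorem form_aeval (x : D.sp) (f : ℂ[X]) (u w : V) :
    D.ω (aeval (x : Module.End ℂ V) f u) w =
      D.ω u (aeval (x : Module.End ℂ V) (f.comp (-X)) w) := by
  induction f using Polynomial.induction_on' with
  | add f g hf hg => simp [hf, hg]
  | monomial k a =>
    induction k generalizing u w with
    | zero => simp
    | succ k ih =>
      have h : monomial (k + 1) a = monomial k a * X := (monomial_mul_X k a).symm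
      rw [h, map_mul, aeval_X, Module.End.mul_apply, ih, D.form_apply, mul_comp, X_comp,
        mul_comm _ (-X), map_mul, map_neg, aeval_X, Module.End.mul_apply, LinearMap.neg_apply,
        map_neg]

/-- Pairs `(x, v)` with `v` cyclic for `x` are classified, up to `Sp(V)`, by the characteristic
polynomials of `x` and of `x - v²`. -/
theorem exists_act_eq {p p' : D.sp × V} (hc : IsCyclic (p.1 : Module.End ℂ V) p.2)
    (hp : LinearMap.charpoly (p.1 : Module.End ℂ V) = LinearMap.charpoly (p'.1 : Module.End ℂ V))
    (hr : LinearMap.charpoly (D.shift p : Module.End ℂ V) =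
      LinearMap.charpoly (D.shift p' : Module.End ℂ V)) : ∃ g : D.Sp, D.act g p = p' := by
  obtain ⟨x, v⟩ := p
  obtain ⟨x', v'⟩ := p'
  simp only at hc hp
  obtain ⟨g, hg⟩ := exists_intertwiner hc (x' : Module.End ℂ V) v' hp
  have hmom : ∀ f : ℂ[X], D.ω v (aeval (x : Module.End ℂ V) f v) =
      D.ω v' (aeval (x' : Module.End ℂ V) f v') := moments_eq hp hr
  -- Moving `f(x)` across the form turns `⟨f(x) v, k(x) v⟩` into a single moment of `v`, and the
  -- moments of the two pairs agree.
  have hform : ∀ u w, D.ω (g u) (g w) = D.ω u w := by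
    intro u w
    obtain ⟨f, rfl⟩ := hc u
    obtain ⟨k, rfl⟩ := hc w
    rw [hg, hg, D.form_aeval, D.form_aeval, ← Module.End.mul_apply, ← map_mul,
      ← Module.End.mul_apply, ← map_mul, hmom]
  -- The vector of the second pair is not assumed cyclic; injectivity comes from preservation of a
  -- nondegenerate form.
  have hinj : Function.Injective g := by
    rw [injective_iff_map_eq_zero]
    intro u hu
    apply D.nondeg.1
    intro w
    rw [← hform, hu, map_zero, LinearMap.zero_apply]
  let G : V ≃ₗ[ℂ] V := LinearEquiv.ofInjectiveEndo g hinj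
  have hG : ∀ u, G u = g u := fun u => rfl
  refine ⟨⟨G, hform⟩, Prod.ext (Subtype.ext ?_) ?_⟩
  · change G.conj (x : Module.End ℂ V) = x'
    ext u
    obtain ⟨w, rfl⟩ := G.surjective u
    rw [LinearEquiv.conj_apply_apply, LinearEquiv.symm_apply_apply]
    obtain ⟨f, rfl⟩ := hc w
    have h1 := hg (X * f)
    rw [map_mul, map_mul, aeval_X, aeval_X, Module.End.mul_apply, Module.End.mul_apply, ← hg] at h1
    exact h1
  · change g v = v'
    simpa using hg 1

end Conjugacy

end Data

end PseudoSlice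

namespace PseudoSlice

namespace Data

open Polynomial

variable {n : ℕ} {V : Type*} [AddCommGroup V] [Module ℂ V] (D : Data n V) [FiniteDimensional ℂ V]

theorem proj_mem_polyFun {ι : Type*} (i : ι) : (fun w : ι → ℂ => w i) ∈ polyFun (ι → ℂ) :=
  dual_mem_polyFun (LinearMap.proj (φ := fun _ : ι => ℂ) i)

/-! ### Functions on the pseudo-slice in terms of the coefficients -/

section Coefficients

/-- The coefficients of the characteristic polynomial, as functions on `sp(V)`. -/
noncomputable def spCoeff (x : D.sp) (i : Fin n) : ℂ :=
  (LinearMap.charpoly (x : Module.End ℂ V)).coeff (2 * n - 2 * (i + 1))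

/-- The coefficients of the characteristic polynomial, as functions on `gl(L)`. -/
noncomputable def glCoeff (y : Module.End ℂ D.L) (i : Fin n) : ℂ :=
  (LinearMap.charpoly y).coeff (n - (i + 1))

theorem isPolyMap_sp_coe : IsPolyMap fun x : D.sp => (x : Module.End ℂ V) :=
  isPolyMap_linear D.sp.toSubmodule.subtype

theorem isPolyMap_fst_coe : IsPolyMap fun p : D.sp × V => (p.1 : Module.End ℂ V) :=
  isPolyMap_linear (D.sp.toSubmodule.subtype ∘ₗ LinearMap.fst ℂ D.sp V)

theorem isPolyMap_snd (D : Data n V) : IsPolyMap fun p : D.sp × V => p.2 :=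
  isPolyMap_linear (LinearMap.snd ℂ D.sp V)

theorem isPolyMap_shift : IsPolyMap D.shift := fun ξ => D.shift_mem_polyFun (dual_mem_polyFun ξ)

theorem isPolyMap_toGl : IsPolyMap D.toGl := by
  let β : Module.End ℂ V →ₗ[ℂ] Module.End ℂ D.L :=
    { toFun := D.block
      map_add' := fun a b => by ext; simp [block]
      map_smul' := fun c a => by ext; simp [block] }
  exact (D.isPolyMap_sp_coe.comp D.isPolyMap_shift).linear β

theorem spCoeff_mem_polyFun (i : Fin n) : (fun x => D.spCoeff x i) ∈ polyFun D.sp :=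
  D.isPolyMap_sp_coe.charpoly_coeff _

theorem glCoeff_mem_polyFun (i : Fin n) : (fun y => D.glCoeff y i) ∈ polyFun (Module.End ℂ D.L) :=
  IsPolyMap.charpoly_coeff isPolyMap_id _

theorem isPolyMap_spCoeff : IsPolyMap D.spCoeff := IsPolyMap.pi D.spCoeff_mem_polyFun

theorem isPolyMap_glCoeff : IsPolyMap D.glCoeff := IsPolyMap.pi D.glCoeff_mem_polyFun

theorem eval_fun_mem_polyFun {ι : Type*} [Fintype ι] (Q : MvPolynomial ι ℂ) :
    (fun w : ι → ℂ => MvPolynomial.eval w Q) ∈ polyFun (ι → ℂ) :=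
  eval_mem_polyFun (Pi.basisFun ℂ ι) Q

theorem charpoly_eq_of_spCoeff {x x' : D.sp} (h : D.spCoeff x = D.spCoeff x') :
    LinearMap.charpoly (x : Module.End ℂ V) = LinearMap.charpoly (x' : Module.End ℂ V) := by
  ext k
  rcases Nat.even_or_odd k with hk | hk
  · rcases lt_trichotomy k (2 * n) with hlt | rfl | hgt
    · obtain ⟨t, ht⟩ := hk
      have h1 := congrFun h ⟨n - 1 - t, by lia⟩
      simp only [spCoeff] at h1
      rwa [show 2 * n - 2 * (n - 1 - t + 1) = k by lia] at h1
    · have h1 := LinearMap.charpoly_monic (x : Module.End ℂ V)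
      have h2 := LinearMap.charpoly_monic (x' : Module.End ℂ V)
      rw [Monic, leadingCoeff, D.natDegree_charpoly_sp] at h1 h2
      rw [h1, h2]
    · rw [coeff_eq_zero_of_natDegree_lt (by rw [D.natDegree_charpoly_sp]; exact hgt),
        coeff_eq_zero_of_natDegree_lt (by rw [D.natDegree_charpoly_sp]; exact hgt)]
  · rw [D.charpoly_coeff_odd _ hk, D.charpoly_coeff_odd _ hk]

theorem natDegree_charpoly_gl (y : Module.End ℂ D.L) : (LinearMap.charpoly y).natDegree = n := by
  rw [natDegree_charpoly, D.finrank_L]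

theorem eq_charpoly_of_glCoeff {y : Module.End ℂ D.L} {q : ℂ[X]} (hq : q.Monic)
    (hqn : q.natDegree = n) (h : ∀ i : Fin n, D.glCoeff y i = q.coeff (n - (i + 1))) :
    LinearMap.charpoly y = q := by
  ext k
  rcases lt_trichotomy k n with hlt | hk | hgt
  · have h1 := h ⟨n - 1 - k, by lia⟩
    simp only [glCoeff] at h1
    rwa [show n - (n - 1 - k + 1) = k by lia] at h1
  · have h1 := LinearMap.charpoly_monic y
    rw [Monic, leadingCoeff, D.natDegree_charpoly_gl] at h1
    rw [Monic, leadingCoeff, hqn] at hq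
    rw [hk, h1, hq]
  · rw [coeff_eq_zero_of_natDegree_lt (by rw [D.natDegree_charpoly_gl]; exact hgt),
      coeff_eq_zero_of_natDegree_lt (by rw [hqn]; exact hgt)]

theorem spCoeff_kostantPoint (z l : Fin n → ℂ) (i : Fin n) :
    D.spCoeff (D.kostantPoint z) i =
      MvPolynomial.eval (Sum.elim z l) (sliceCoeff n (Sum.inl i)) := by
  rw [spCoeff, ← D.kostantMatrix_charpoly z l, coeff_map]
  rfl

theorem glCoeff_slicePoint (z l : Fin n → ℂ) (i : Fin n) :
    D.glCoeff (D.toGl (D.slicePoint z l).1) i =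
      MvPolynomial.eval (Sum.elim z l) (sliceCoeff n (Sum.inr i)) := by
  rw [glCoeff, ← D.leviMatrix_charpoly z l, coeff_map]
  rfl

/-- Every pair of characteristic polynomials is realized on the pseudo-slice. -/
theorem exists_slice (x : D.sp) {q : ℂ[X]} (hq : q.Monic) (hqn : q.natDegree = n) :
    ∃ s : D.Slice, LinearMap.charpoly (s.1.1 : Module.End ℂ V) =
      LinearMap.charpoly (x : Module.End ℂ V) ∧ (D.toGl s.1).charpoly = q := by
  obtain ⟨z, l, h⟩ := exists_eval_sliceCoeff (n := n) (Sum.elim (D.spCoeff x)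
    fun i => q.coeff (n - (i + 1)))
  refine ⟨D.slicePoint z l, ?_, ?_⟩
  · exact D.charpoly_eq_of_spCoeff (funext fun i =>
      (D.spCoeff_kostantPoint z l i).trans (h (Sum.inl i)))
  · exact D.eq_charpoly_of_glCoeff hq hqn fun i =>
      (D.glCoeff_slicePoint z l i).trans (h (Sum.inr i))

/-- The coordinates on the pseudo-slice given by the two characteristic polynomials. -/
noncomputable def sliceCoord (s : D.Slice) : Fin n ⊕ Fin n → ℂ :=
  Sum.elim (D.spCoeff s.1.1) (D.glCoeff (D.toGl s.1))

theorem sliceCoord_slicePoint (z l : Fin n → ℂ) (i : Fin n ⊕ Fin n) :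
    D.sliceCoord (D.slicePoint z l) i = MvPolynomial.eval (Sum.elim z l) (sliceCoeff n i) := by
  rcases i with i | i
  · exact D.spCoeff_kostantPoint z l i
  · exact D.glCoeff_slicePoint z l i

theorem isPolyMap_kostantPoint : IsPolyMap D.kostantPoint := by
  refine (isPolyMap_const D.e).add (IsPolyMap.sum fun j _ => ?_)
  exact IsPolyMap.smul (proj_mem_polyFun j) (isPolyMap_const _)

theorem isPolyMap_sliceVec : IsPolyMap D.sliceVec := by
  refine (isPolyMap_const D.v₀).add (IsPolyMap.sum fun j _ => ?_)
  exact IsPolyMap.smul (proj_mem_polyFun j) (isPolyMap_const _)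

/-- A polynomial function on the Kostant slice is a polynomial in the coefficients of the
characteristic polynomial. -/
theorem exists_eval_spCoeff {F : D.sp → ℂ} (hF : F ∈ polyFun D.sp) :
    ∃ Q : MvPolynomial (Fin n) ℂ, ∀ z, F (D.kostantPoint z) =
      MvPolynomial.eval (D.spCoeff (D.kostantPoint z)) Q := by
  obtain ⟨P, hP⟩ := exists_mvPolynomial (Pi.basisFun ℂ (Fin n)) (D.isPolyMap_kostantPoint.comp_mem hF)
  have h : ∀ j : Fin n, ∃ Q : MvPolynomial (Fin n) ℂ,
      MvPolynomial.aeval (fun i : Fin n => sliceCoeff n (Sum.inl i)) Q =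
        MvPolynomial.X (Sum.inl j) := by
    intro j
    have h1 := zVar_mem_adjoin (n := n) (2 * (j + 1))
    rw [Algebra.adjoin_range_eq_range_aeval, zVar,
      dif_pos ⟨by lia, by lia, even_two_mul _⟩] at h1
    obtain ⟨Q, hQ⟩ := h1
    refine ⟨Q, hQ.trans ?_⟩
    congr 2
    exact Fin.ext (by simp)
  choose Q hQ using h
  refine ⟨MvPolynomial.bind₁ Q P, fun z => ?_⟩
  rw [hP]
  change MvPolynomial.eval z P = _
  have key : ∀ j, MvPolynomial.eval (D.spCoeff (D.kostantPoint z)) (Q j) = z j := by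
    intro j
    have h1 := congrArg (MvPolynomial.eval (Sum.elim z 0)) (hQ j)
    rw [MvPolynomial.eval_X, Sum.elim_inl, MvPolynomial.aeval_def, MvPolynomial.eval_eval₂] at h1
    rw [← h1, MvPolynomial.eval, MvPolynomial.coe_eval₂Hom]
    have hcoe : D.spCoeff (D.kostantPoint z) = fun i => MvPolynomial.eval (Sum.elim z 0)
        (sliceCoeff n (Sum.inl i)) := funext fun i => D.spCoeff_kostantPoint z 0 i
    rw [hcoe]
    congr 1
    ext a
    simp
  rw [← MvPolynomial.coe_aeval_eq_eval, ← MvPolynomial.coe_aeval_eq_eval]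
  simp only [RingHom.coe_coe]
  rw [MvPolynomial.aeval_bind₁]
  congr 1
  congr 1
  funext j
  rw [← key j, ← MvPolynomial.coe_aeval_eq_eval]
  rfl

/-- A polynomial function on the pseudo-slice is a polynomial in the coefficients of the two
characteristic polynomials. -/
theorem exists_eval_sliceCoord {F : D.sp × V → ℂ} (hF : F ∈ polyFun (D.sp × V)) :
    ∃ Q : SliceRing n, ∀ s : D.Slice, F s.1 = MvPolynomial.eval (D.sliceCoord s) Q := by
  have hpoint : IsPolyMap fun w : Fin n ⊕ Fin n → ℂ =>
      (D.slicePoint (fun i => w (Sum.inl i)) fun i => w (Sum.inr i)).1 := by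
    refine IsPolyMap.prodMk (D.isPolyMap_kostantPoint.comp (IsPolyMap.pi fun i => ?_))
      (D.isPolyMap_sliceVec.comp (IsPolyMap.pi fun i => ?_))
    · exact proj_mem_polyFun _
    · exact proj_mem_polyFun _
  obtain ⟨P, hP⟩ := exists_mvPolynomial (Pi.basisFun ℂ (Fin n ⊕ Fin n)) (hpoint.comp_mem hF)
  obtain ⟨Q, rfl⟩ := aeval_sliceCoeff_surjective n P
  refine ⟨Q, fun s => ?_⟩
  obtain ⟨z, l, rfl⟩ := D.exists_slicePoint s
  refine (hP (Sum.elim z l)).trans ?_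
  change MvPolynomial.eval (Sum.elim z l) _ = _
  rw [show D.sliceCoord (D.slicePoint z l) = _ from funext (D.sliceCoord_slicePoint z l),
    MvPolynomial.aeval_def, MvPolynomial.eval_eval₂, MvPolynomial.eval, MvPolynomial.coe_eval₂Hom]
  congr 1
  ext a
  simp

end Coefficients

/-! ### Density of cyclic pairs and their position on the orbits of the pseudo-slice -/

section CyclicVectors

theorem cyclicDet_mem : (fun p : D.sp × V => cyclicDet D.basis (p.1 : Module.End ℂ V) p.2) ∈
    polyFun (D.sp × V) := cyclicDet_mem_polyFun _ D.isPolyMap_fst_coe D.isPolyMap_snd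

theorem isCyclic_kostantPoint (z : Fin n → ℂ) :
    IsCyclic (D.kostantPoint z : Module.End ℂ V) (D.vec (2 * n - 1)) := by
  have hn := D.one_le
  have hm : ∀ i j : Fin (2 * n),
      D.basis.repr ((D.kostantPoint z : Module.End ℂ V) (D.basis j)) i =
        MvPolynomial.eval (Sum.elim z 0) (kostantMatrix n i j) := by
    intro i j
    have := congrFun (congrFun (D.kostantMatrix_map z 0) i) j
    rw [LinearMap.toMatrix_apply, Matrix.map_apply] at this
    exact this.symm
  have h := isCyclic_of_hessenberg D.basis (by lia) (T := (D.kostantPoint z : Module.End ℂ V)) ?_ ?_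
  · rwa [D.basis_eq] at h
  · intro i j hij
    rw [hm, kostantMatrix, if_neg (by lia), if_neg (by lia), map_zero]
  · intro i j hij
    rw [hm, kostantMatrix, if_pos hij, MvPolynomial.eval_C]
    have h1 : (0 : ℝ) < j := by
      have : 0 < (j : ℕ) := by lia
      exact_mod_cast this
    have h2 : (0 : ℝ) < 2 * n - j := by
      have : ((j : ℕ) : ℝ) < ((2 * n : ℕ) : ℝ) := by exact_mod_cast j.2
      push_cast at this
      linarith
    exact_mod_cast (mul_pos h1 h2).ne'

theorem isCyclic_toGl (s : D.Slice) :
    IsCyclic (D.toGl s.1) (D.basisL ⟨n - 1, by have := D.one_le; lia⟩) := by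
  have hn := D.one_le
  obtain ⟨z, l, rfl⟩ := D.exists_slicePoint s
  have hm : ∀ i j : Fin n, D.basisL.repr (D.toGl (D.slicePoint z l).1 (D.basisL j)) i =
      MvPolynomial.eval (Sum.elim z l) (leviMatrix n i j) := by
    intro i j
    have := congrFun (congrFun (D.leviMatrix_map z l) i) j
    rw [LinearMap.toMatrix_apply, Matrix.map_apply] at this
    exact this.symm
  refine isCyclic_of_hessenberg D.basisL (by lia) ?_ ?_
  · intro i j hij
    rw [hm, leviMatrix, if_neg (by lia), if_neg (by lia), map_zero]
  · intro i j hij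
    rw [hm, leviMatrix, if_pos hij, MvPolynomial.eval_C]
    have h1 : (0 : ℝ) < n + j := by positivity
    have h2 : (0 : ℝ) < n - j := by
      have : ((j : ℕ) : ℝ) < n := by exact_mod_cast j.2
      linarith
    exact_mod_cast (mul_pos h1 h2).ne'

theorem exists_cyclicDet_ne_zero :
    ∃ p : D.sp × V, cyclicDet D.basis (p.1 : Module.End ℂ V) p.2 ≠ 0 :=
  ⟨(D.kostantPoint 0, D.vec (2 * n - 1)),
    (isCyclic_iff_cyclicDet D.basis).1 (D.isCyclic_kostantPoint 0)⟩

/-- A polynomial function vanishing at all pairs with a cyclic vector is zero. -/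
theorem eq_zero_of_cyclic {F : D.sp × V → ℂ} (hF : F ∈ polyFun (D.sp × V))
    (h : ∀ p : D.sp × V, IsCyclic (p.1 : Module.End ℂ V) p.2 → F p = 0) (p : D.sp × V) :
    F p = 0 :=
  polyFun_eq_zero_of_dense hF D.cyclicDet_mem D.exists_cyclicDet_ne_zero
    (fun p hp => h p ((isCyclic_iff_cyclicDet D.basis).2 hp)) p

theorem natDegree_prod_X_sub_C (τ : Fin n → ℂ) : (∏ i, (X - C (τ i))).natDegree = n := by
  rw [natDegree_prod_of_monic _ _ fun i _ => monic_X_sub_C _]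
  simp

theorem charpoly_shift_slice (s : D.Slice) {τ : Fin n → ℂ}
    (h : (D.toGl s.1).charpoly = ∏ i, (X - C (τ i))) :
    LinearMap.charpoly (D.shift s.1 : Module.End ℂ V) = ∏ i, (X ^ 2 - C (τ i ^ 2)) :=
  D.charpoly_eq_prod_of_preserves _ (fun _ hu => D.shift_mem_L s hu) h

/-- Pairs with a cyclic vector lie on the orbits of the pseudo-slice. -/
theorem exists_act_slice {p : D.sp × V} (hc : IsCyclic (p.1 : Module.End ℂ V) p.2) {τ : Fin n → ℂ}
    (h : LinearMap.charpoly (D.shift p : Module.End ℂ V) = ∏ i, (X ^ 2 - C (τ i ^ 2))) :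
    ∃ (g : D.Sp) (s : D.Slice), D.act g s.1 = p ∧ (D.toGl s.1).charpoly = ∏ i, (X - C (τ i)) := by
  -- The numbers `τ i` are a choice of square roots, hence of a point of `Σ_gl` over `[x - v²]`; any
  -- such choice can be prescribed as the spectrum on `L`.
  obtain ⟨s, h1, h2⟩ := D.exists_slice p.1 (monic_prod_of_monic _ _ fun i _ => monic_X_sub_C (τ i))
    (natDegree_prod_X_sub_C τ)
  obtain ⟨g, hg⟩ := D.exists_act_eq hc h1.symm (h.trans (D.charpoly_shift_slice s h2).symm)
  exact ⟨g⁻¹, s, by rw [← hg, D.act_inv_act], h2⟩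

theorem exists_charpoly_eq_sq (x : D.sp) : ∃ τ : Fin n → ℂ,
    LinearMap.charpoly (x : Module.End ℂ V) = ∏ i, (X ^ 2 - C (τ i ^ 2)) := by
  obtain ⟨s, hs⟩ := D.exists_charpoly_eq x
  choose τ hτ using fun i => IsAlgClosed.exists_pow_nat_eq (s i) two_pos
  exact ⟨τ, by simp only [hτ, hs]⟩

theorem exists_act_slice_of_cyclic {p : D.sp × V} (hc : IsCyclic (p.1 : Module.End ℂ V) p.2) :
    ∃ (g : D.Sp) (s : D.Slice), D.act g s.1 = p := by
  obtain ⟨τ, hτ⟩ := D.exists_charpoly_eq_sq (D.shift p)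
  obtain ⟨g, s, h, -⟩ := D.exists_act_slice hc hτ
  exact ⟨g, s, h⟩

end CyclicVectors

/-! ### The invariants of `Sp(V)` on `sp(V)` and of `GL(L)` on `gl(L)` -/

section Invariants

theorem spCoeff_Ad (g : D.Sp) (x : D.sp) : D.spCoeff (D.Ad g x) = D.spCoeff x := by
  funext i
  rw [spCoeff, D.charpoly_Ad]
  rfl

theorem glCoeff_conj (g : D.L ≃ₗ[ℂ] D.L) (y : Module.End ℂ D.L) :
    D.glCoeff (g.conj y) = D.glCoeff y := by
  funext i
  rw [glCoeff, LinearEquiv.charpoly_conj]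
  rfl

/-- The coefficients of the characteristic polynomial in `ℂ[sp(V)]^Sp(V)`. -/
noncomputable def spInv (i : Fin n) : D.InvSp :=
  ⟨fun x => D.spCoeff x i, D.spCoeff_mem_polyFun i, fun g x => congrFun (D.spCoeff_Ad g x) i⟩

/-- The coefficients of the characteristic polynomial in `ℂ[gl(L)]^GL(L)`. -/
noncomputable def glInv (i : Fin n) : D.InvGl :=
  ⟨fun y => D.glCoeff y i, D.glCoeff_mem_polyFun i, fun g y => congrFun (D.glCoeff_conj g y) i⟩

/-- Evaluation at a point, on invariants of `Sp(V)`. -/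
def evalSp (x : D.sp) : D.InvSp →ₐ[ℂ] ℂ := (Pi.evalAlgHom ℂ (fun _ : D.sp => ℂ) x).comp D.invSp.val

/-- Evaluation at a point, on invariants of `GL(L)`. -/
def evalGl (y : Module.End ℂ D.L) : D.InvGl →ₐ[ℂ] ℂ :=
  (Pi.evalAlgHom ℂ (fun _ : Module.End ℂ D.L => ℂ) y).comp D.invGl.val

theorem aeval_spInv_apply (Q : MvPolynomial (Fin n) ℂ) (x : D.sp) :
    (MvPolynomial.aeval D.spInv Q : D.InvSp).1 x = MvPolynomial.eval (D.spCoeff x) Q := by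
  have : (D.evalSp x).comp (MvPolynomial.aeval D.spInv) = MvPolynomial.aeval (D.spCoeff x) := by
    ext i
    rw [AlgHom.comp_apply, MvPolynomial.aeval_X, MvPolynomial.aeval_X]
    rfl
  exact DFunLike.congr_fun this Q

theorem aeval_glInv_apply (Q : MvPolynomial (Fin n) ℂ) (y : Module.End ℂ D.L) :
    (MvPolynomial.aeval D.glInv Q : D.InvGl).1 y = MvPolynomial.eval (D.glCoeff y) Q := by
  have : (D.evalGl y).comp (MvPolynomial.aeval D.glInv) = MvPolynomial.aeval (D.glCoeff y) := by
    ext i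
    rw [AlgHom.comp_apply, MvPolynomial.aeval_X, MvPolynomial.aeval_X]
    rfl
  exact DFunLike.congr_fun this Q

/-- Both sides are invariant and agree on the slice, hence agree at the first component of every
cyclic pair. The auxiliary vector component makes the density of such pairs available. -/
theorem invSp_apply_eq (F : D.InvSp) {Q : MvPolynomial (Fin n) ℂ}
    (hQ : ∀ z, F.1 (D.kostantPoint z) = MvPolynomial.eval (D.spCoeff (D.kostantPoint z)) Q)
    (x : D.sp) : F.1 x = MvPolynomial.eval (D.spCoeff x) Q := by
  have hmem : (fun p : D.sp × V => F.1 p.1 - MvPolynomial.eval (D.spCoeff p.1) Q) ∈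
      polyFun (D.sp × V) := by
    have h1 : (fun x : D.sp => F.1 x - MvPolynomial.eval (D.spCoeff x) Q) ∈ polyFun D.sp :=
      Subalgebra.sub_mem _ F.2.1 (D.isPolyMap_spCoeff.comp_mem (eval_fun_mem_polyFun Q))
    exact comp_linear_mem_polyFun (LinearMap.fst ℂ D.sp V) h1
  rw [← sub_eq_zero]
  refine D.eq_zero_of_cyclic hmem (fun p hp => ?_) (x, 0)
  obtain ⟨g, s, rfl⟩ := D.exists_act_slice_of_cyclic hp
  obtain ⟨z, l, rfl⟩ := D.exists_slicePoint s
  change F.1 (D.Ad g (D.kostantPoint z)) -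
    MvPolynomial.eval (D.spCoeff (D.Ad g (D.kostantPoint z))) Q = 0
  rw [F.2.2, D.spCoeff_Ad, hQ, sub_self]

theorem aeval_spInv_surjective :
    Function.Surjective (MvPolynomial.aeval D.spInv : MvPolynomial (Fin n) ℂ →ₐ[ℂ] D.InvSp) := by
  intro F
  obtain ⟨Q, hQ⟩ := D.exists_eval_spCoeff F.2.1
  refine ⟨Q, Subtype.ext (funext fun x => ?_)⟩
  rw [D.aeval_spInv_apply, D.invSp_apply_eq F hQ]

/-- Invariants of `Sp(V)` are determined by the characteristic polynomial. -/
theorem invSp_congr (F : D.InvSp) {x x' : D.sp} (h : LinearMap.charpoly (x : Module.End ℂ V) =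
    LinearMap.charpoly (x' : Module.End ℂ V)) : F.1 x = F.1 x' := by
  obtain ⟨Q, rfl⟩ := D.aeval_spInv_surjective F
  rw [D.aeval_spInv_apply, D.aeval_spInv_apply]
  congr 2
  funext i
  rw [spCoeff, h]
  rfl

/-- Injectivity: invariants depend only on the characteristic polynomial, and each one occurs on the
slice. Surjectivity: functions on the slice are polynomials in the coefficients, which are
invariants of the whole space. -/
theorem kostantHom_bijective : Function.Bijective D.kostantHom := by
  constructor
  · rw [injective_iff_map_eq_zero]
    intro F hF
    refine Subtype.ext (funext fun x => ?_)
    obtain ⟨s, hs, -⟩ := D.exists_slice x (monic_X_pow n) (natDegree_X_pow n)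
    rw [D.invSp_congr F hs.symm]
    exact congrFun (congrArg Subtype.val hF) ⟨s.1.1, s.2.1⟩
  · rintro ⟨_, G, hG, rfl⟩
    obtain ⟨Q, hQ⟩ := D.exists_eval_spCoeff hG
    refine ⟨MvPolynomial.aeval D.spInv Q, Subtype.ext (funext fun x => ?_)⟩
    obtain ⟨z, hz⟩ := (D.mem_kostantSlice_iff _).1 x.2
    change (MvPolynomial.aeval D.spInv Q : D.InvSp).1 (x : D.sp) = G (x : D.sp)
    rw [D.aeval_spInv_apply, ← hz, hQ]

/-- The slice provides an operator with the characteristic polynomial of `y`, while the class in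
`sp(V)//Sp(V)` remains free and is prescribed by `x`. The intertwiner sending cyclic vector to
cyclic vector is onto, hence invertible. -/
theorem exists_conj_toGl {y : Module.End ℂ D.L}
    (hc : IsCyclic y (D.basisL ⟨n - 1, by have := D.one_le; lia⟩)) (x : D.sp) :
    ∃ (s : D.Slice) (g : D.L ≃ₗ[ℂ] D.L), D.spCoeff s.1.1 = D.spCoeff x ∧
      D.toGl s.1 = g.conj y := by
  obtain ⟨s, h1, h2⟩ := D.exists_slice x y.charpoly_monic (D.natDegree_charpoly_gl y)
  obtain ⟨g, hg⟩ := exists_intertwiner hc (D.toGl s.1)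
    (D.basisL ⟨n - 1, by have := D.one_le; lia⟩) h2.symm
  have hsurj : Function.Surjective g := by
    intro u
    obtain ⟨f, rfl⟩ := D.isCyclic_toGl s u
    exact ⟨_, hg f⟩
  let G : D.L ≃ₗ[ℂ] D.L :=
    LinearEquiv.ofBijective g ⟨LinearMap.injective_iff_surjective.2 hsurj, hsurj⟩
  have hG : ∀ u, G u = g u := fun u => rfl
  refine ⟨s, G, ?_, ?_⟩
  · funext i
    rw [spCoeff, h1]
    rfl
  · ext u
    obtain ⟨w, rfl⟩ := G.surjective u
    rw [LinearEquiv.conj_apply_apply, LinearEquiv.symm_apply_apply]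
    obtain ⟨f, rfl⟩ := hc w
    have h3 := hg (X * f)
    rw [map_mul, map_mul, aeval_X, aeval_X, Module.End.mul_apply, Module.End.mul_apply,
      ← hg] at h3
    exact congrArg Subtype.val h3.symm

theorem aeval_glInv_surjective :
    Function.Surjective (MvPolynomial.aeval D.glInv : MvPolynomial (Fin n) ℂ →ₐ[ℂ] D.InvGl) := by
  have hn := D.one_le
  intro F
  obtain ⟨Q, hQ⟩ := D.exists_eval_sliceCoord (D.isPolyMap_toGl.comp_mem F.2.1)
  -- Pulled back to the pseudo-slice, `F` is a polynomial in both families of coefficients; the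
  -- first family is frozen at its value at `e`.
  let R : MvPolynomial (Fin n) ℂ := MvPolynomial.aeval (Sum.elim
    (fun i => MvPolynomial.C (D.spCoeff D.e i)) MvPolynomial.X) Q
  have hR : ∀ c, MvPolynomial.eval c R = MvPolynomial.eval (Sum.elim (D.spCoeff D.e) c) Q := by
    intro c
    have : (MvPolynomial.aeval c).comp (MvPolynomial.aeval (Sum.elim
        (fun i => MvPolynomial.C (D.spCoeff D.e i)) MvPolynomial.X)) =
        (MvPolynomial.aeval (Sum.elim (D.spCoeff D.e) c) : SliceRing n →ₐ[ℂ] ℂ) := by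
      ext i
      rcases i with i | i <;> simp
    exact DFunLike.congr_fun this Q
  refine ⟨R, Subtype.ext (funext fun y => ?_)⟩
  rw [D.aeval_glInv_apply, eq_comm, ← sub_eq_zero]
  obtain ⟨s₀, -⟩ := D.exists_slice D.e (monic_X_pow n) (natDegree_X_pow n)
  refine polyFun_eq_zero_of_dense (F := fun y => F.1 y - MvPolynomial.eval (D.glCoeff y) R)
    (G := fun y => cyclicDet D.basisL y (D.basisL ⟨n - 1, by lia⟩))
    (Subalgebra.sub_mem _ F.2.1 (D.isPolyMap_glCoeff.comp_mem (eval_fun_mem_polyFun R)))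
    (cyclicDet_mem_polyFun _ isPolyMap_id (isPolyMap_const _))
    ⟨D.toGl s₀.1, (isCyclic_iff_cyclicDet D.basisL).1 (D.isCyclic_toGl s₀)⟩ (fun y hy => ?_) y
  obtain ⟨s, g, h1, h2⟩ := D.exists_conj_toGl ((isCyclic_iff_cyclicDet D.basisL).2 hy) D.e
  have h3 := hQ s
  simp only [sliceCoord] at h3
  rw [h1, h2, F.2.2, D.glCoeff_conj] at h3
  change F.1 y - MvPolynomial.eval (D.glCoeff y) R = 0
  rw [hR, h3, sub_self]

end Invariants

end Data

end PseudoSlice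

namespace PseudoSlice

theorem exists_mvPolynomial_interpolation {ι κ : Type*} [Fintype κ] (pt : κ → ι → ℂ)
    (hpt : Function.Injective pt) (φ : κ → ℂ) :
    ∃ P : MvPolynomial ι ℂ, ∀ k, MvPolynomial.eval (pt k) P = φ k := by
  classical
  have hsep : ∀ a b : κ, ∃ P : MvPolynomial ι ℂ, a ≠ b →
      MvPolynomial.eval (pt a) P = 1 ∧ MvPolynomial.eval (pt b) P = 0 := by
    intro a b
    by_cases hab : a = b
    · exact ⟨0, fun h => (h hab).elim⟩
    obtain ⟨i, hi⟩ := Function.ne_iff.1 (hpt.ne hab)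
    refine ⟨MvPolynomial.C (pt a i - pt b i)⁻¹ * (MvPolynomial.X i - MvPolynomial.C (pt b i)),
      fun _ => ⟨?_, ?_⟩⟩
    · simp [inv_mul_cancel₀ (sub_ne_zero.2 hi)]
    · simp
  choose P hP using hsep
  refine ⟨∑ a, MvPolynomial.C (φ a) * ∏ b ∈ Finset.univ.erase a, P a b, fun k => ?_⟩
  rw [map_sum, Finset.sum_eq_single k]
  · rw [map_mul, MvPolynomial.eval_C, map_prod, Finset.prod_eq_one, mul_one]
    intro b hb
    exact (hP k b (Finset.ne_of_mem_erase hb).symm).1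
  · intro a _ hak
    rw [map_mul, map_prod, Finset.prod_eq_zero (Finset.mem_erase.2 ⟨hak.symm, Finset.mem_univ k⟩),
      mul_zero]
    exact (hP a k hak).2
  · exact fun h => (h (Finset.mem_univ k)).elim

/-! ### A discriminant for operators -/

section Discriminant

open Polynomial

variable {U : Type*} [AddCommGroup U] [Module ℂ U] [FiniteDimensional ℂ U]

/-- A function detecting the separability of the characteristic polynomial. -/
noncomputable def disc (T : Module.End ℂ U) : ℂ :=
  LinearMap.det (aeval T (derivative T.charpoly))

theorem disc_mem_polyFun {W : Type*} [AddCommGroup W] [Module ℂ W] {φ : W → Module.End ℂ U}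
    (hφ : IsPolyMap φ) : (fun w => disc (φ w)) ∈ polyFun W := by
  refine IsPolyMap.det ?_
  have h : (fun w => aeval (φ w) (derivative (φ w).charpoly)) = fun w =>
      ∑ k ∈ Finset.range (Module.finrank ℂ U + 1),
        ((φ w).charpoly.coeff (k + 1) * (k + 1)) • φ w ^ k := by
    funext w
    rw [aeval_eq_sum_range' (n := Module.finrank ℂ U + 1)]
    · simp only [coeff_derivative]
    · have h1 := natDegree_derivative_le (φ w).charpoly
      rw [natDegree_charpoly] at h1
      lia
  rw [h]
  exact IsPolyMap.sum fun k _ => IsPolyMap.smul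
    (mul_mem_polyFun (hφ.charpoly_coeff _) (const_mem_polyFun _)) (hφ.pow k)

theorem disc_ne_zero {T : Module.End ℂ U} (h : T.charpoly.Separable) : disc T ≠ 0 := by
  obtain ⟨a, b, hab⟩ := h
  have h1 := congrArg (fun f => LinearMap.det (aeval T f)) hab
  simp only [map_add, map_mul, LinearMap.aeval_self_charpoly, mul_zero, zero_add, map_one] at h1
  exact right_ne_zero_of_mul_eq_one h1

/-- A double root `t` of the characteristic polynomial is a root of its derivative, which then
contributes the singular factor `T - t`. -/
theorem not_sq_dvd_of_disc {T : Module.End ℂ U} (h : disc T ≠ 0) (t : ℂ) :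
    ¬ (X - C t) ^ 2 ∣ T.charpoly := by
  rintro ⟨f, hf⟩
  apply h
  have h1 : derivative T.charpoly = (X - C t) * (2 * f + (X - C t) * derivative f) := by
    rw [hf, derivative_mul, pow_two, derivative_mul, derivative_sub, derivative_X, derivative_C]
    ring
  have h2 : LinearMap.det (aeval T (X - C t)) = 0 := by
    have h3 : T.charpoly.eval t = 0 := by rw [hf]; simp
    rw [LinearMap.eval_charpoly] at h3
    have h4 : aeval T (X - C t) = (-1 : ℂ) • (algebraMap ℂ (Module.End ℂ U) t - T) := by
      rw [map_sub, aeval_X, aeval_C]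
      module
    rw [h4, LinearMap.det_smul, h3, mul_zero]
  rw [disc, h1, map_mul, map_mul, h2, zero_mul]

theorem separable_prod_X_sq_sub_C {ι : Type*} [Fintype ι] {s : ι → ℂ} (hs : Function.Injective s)
    (h0 : ∀ i, s i ≠ 0) : (∏ i, (X ^ 2 - C (s i))).Separable := by
  refine separable_prod' (fun i _ j _ hij => ?_) fun i _ =>
    separable_X_pow_sub_C _ (by norm_num) (h0 i)
  have h : s j - s i ≠ 0 := sub_ne_zero.2 (hs.ne hij.symm)
  refine ⟨C (s j - s i)⁻¹, -C (s j - s i)⁻¹, ?_⟩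
  have h2 : C (s j - s i)⁻¹ * (C (s j) - C (s i)) = (1 : ℂ[X]) := by
    rw [← C_sub, ← C_mul, inv_mul_cancel₀ h, C_1]
  linear_combination h2

theorem injective_of_not_sq_dvd {ι : Type*} [Fintype ι] {τ : ι → ℂ}
    (h : ∀ t, ¬ (X - C t) ^ 2 ∣ ∏ i, (X ^ 2 - C (τ i ^ 2))) :
    Function.Injective (fun i => τ i ^ 2) ∧ ∀ i, τ i ≠ 0 := by
  classical
  have hfac : ∀ i, X ^ 2 - C (τ i ^ 2) = (X - C (τ i)) * (X + C (τ i)) := by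
    intro i
    rw [C_pow]
    ring
  constructor
  · intro i j hij
    by_contra hne
    apply h (τ i)
    rw [← Finset.mul_prod_erase _ _ (Finset.mem_univ i),
      ← Finset.mul_prod_erase _ _ (Finset.mem_erase.2 ⟨Ne.symm hne, Finset.mem_univ j⟩), ← mul_assoc,
      pow_two]
    refine Dvd.dvd.mul_right (mul_dvd_mul ?_ ?_) _
    · rw [hfac]
      exact dvd_mul_right _ _
    · have hji : τ j ^ 2 = τ i ^ 2 := hij.symm
      rw [hji, hfac]
      exact dvd_mul_right _ _
  · intro i hi
    apply h 0
    refine Dvd.dvd.trans ?_ (Finset.dvd_prod_of_mem _ (Finset.mem_univ i))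
    rw [hi]
    simp

end Discriminant

namespace Data

open Polynomial

variable {n : ℕ} {V : Type*} [AddCommGroup V] [Module ℂ V] (D : Data n V) [FiniteDimensional ℂ V]

/-! ### Points of `𝔐`, restriction to `Σ` and pullback to `Sp(V) × Σ` -/

section Homomorphisms

/-- Homomorphisms from `ℂ[𝔐]` are pairs of compatible homomorphisms. -/
noncomputable def liftM {R : Type*} [CommRing R] [Algebra ℂ R] (f : D.CoordX →ₐ[ℂ] R)
    (g : D.InvGl →ₐ[ℂ] R) (h : ∀ F, f (D.shiftHom F) = g (D.leviHom F)) : D.CoordM →ₐ[ℂ] R :=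
  letI : Algebra D.InvSp R := (f.comp D.shiftHom).toRingHom.toAlgebra
  haveI : IsScalarTower ℂ D.InvSp R :=
    IsScalarTower.of_algebraMap_eq' (f.comp D.shiftHom).comp_algebraMap.symm
  (Algebra.TensorProduct.productMap (R := D.InvSp)
    ({ f with commutes' := fun _ => rfl } : D.CoordX →ₐ[D.InvSp] R)
    ({ g with commutes' := fun F => (h F).symm } : D.InvGl →ₐ[D.InvSp] R)).restrictScalars ℂ

/-- Evaluation at a point of `𝔐`. -/
noncomputable def evalM (p : D.sp × V) (y : Module.End ℂ D.L)
    (h : LinearMap.charpoly (D.shift p : Module.End ℂ V) =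
      LinearMap.charpoly (D.levi y : Module.End ℂ V)) : D.CoordM →ₐ[ℂ] ℂ :=
  D.liftM (evalAt p) (D.evalGl y) fun F => D.invSp_congr F h

theorem evalM_tmul (p : D.sp × V) (y : Module.End ℂ D.L)
    (h : LinearMap.charpoly (D.shift p : Module.End ℂ V) =
      LinearMap.charpoly (D.levi y : Module.End ℂ V)) (F : D.CoordX) (P : D.InvGl) :
    D.evalM p y h (F ⊗ₜ P) = F.1 p * P.1 y := rfl

theorem invGl_congr (F : D.InvGl) {y y' : Module.End ℂ D.L} (h : y.charpoly = y'.charpoly) :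
    F.1 y = F.1 y' := by
  obtain ⟨Q, rfl⟩ := D.aeval_glInv_surjective F
  rw [D.aeval_glInv_apply, D.aeval_glInv_apply]
  congr 2
  funext i
  rw [glCoeff, h]
  rfl

theorem charpoly_shift_act (g : D.Sp) (s : D.Slice) :
    LinearMap.charpoly (D.shift (D.act g s.1) : Module.End ℂ V) =
      LinearMap.charpoly (D.levi (D.toGl s.1) : Module.End ℂ V) := by
  rw [D.shift_act, D.charpoly_Ad, D.charpoly_levi_toGl]

/-- The restriction to the pseudo-slice. -/
noncomputable def sliceHom : D.CoordM →ₐ[ℂ] D.CoordSlice :=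
  D.liftM
    (((pullback (Subtype.val : D.Slice → D.sp × V)).comp (polyFun (D.sp × V)).val).codRestrict
      (regFun (Subtype.val : D.Slice → D.sp × V)) fun F => ⟨F.1, F.2, rfl⟩)
    (((pullback fun s : D.Slice => D.toGl s.1).comp D.invGl.val).codRestrict
      (regFun (Subtype.val : D.Slice → D.sp × V)) fun F =>
        ⟨fun p => F.1 (D.toGl p), D.isPolyMap_toGl.comp_mem F.2.1, rfl⟩)
    fun F => Subtype.ext (funext fun s => D.invSp_congr F (D.charpoly_levi_toGl s).symm)

/-- On `Sp(V)` the inverse is the adjoint, so `a ↦ a x a*` extends conjugation polynomially to all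
of `End(V)`. This is needed because functions on `Sp(V)` are restrictions of polynomials on
`End(V)`. -/
theorem conj_sp_mem (a : Module.End ℂ V) (x : D.sp) :
    a * (x : Module.End ℂ V) * D.adj a ∈ D.sp := by
  rw [mem_sp]
  intro u w
  simp only [Module.End.mul_apply]
  rw [← D.form_adj' a, D.form_apply, D.form_adj]

/-- The action of `Sp(V)` extended to a polynomial map on `End(V) × (sp(V) ⊕ V)`. -/
noncomputable def actEnd (q : Module.End ℂ V × (D.sp × V)) : D.sp × V :=
  (⟨q.1 * (q.2.1 : Module.End ℂ V) * D.adj q.1, D.conj_sp_mem q.1 q.2.1⟩, q.1 q.2.2)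

theorem isPolyMap_actEnd : IsPolyMap D.actEnd := by
  have h1 : IsPolyMap fun q : Module.End ℂ V × (D.sp × V) => q.1 :=
    isPolyMap_linear (LinearMap.fst ℂ (Module.End ℂ V) (D.sp × V))
  have h2 : IsPolyMap fun q : Module.End ℂ V × (D.sp × V) => q.2 :=
    isPolyMap_linear (LinearMap.snd ℂ (Module.End ℂ V) (D.sp × V))
  let A : Module.End ℂ V →ₗ[ℂ] Module.End ℂ V :=
    { toFun := D.adj
      map_add' := D.adj_add
      map_smul' := D.adj_smul }
  refine IsPolyMap.prodMk (IsPolyMap.subtype D.sp.toSubmodule ?_) ?_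
  · exact (h1.mul (D.isPolyMap_fst_coe.comp h2)).mul (h1.linear A)
  · exact h1.apply (D.isPolyMap_snd.comp h2)

theorem adj_coe (g : D.Sp) :
    D.adj ((g : V ≃ₗ[ℂ] V) : Module.End ℂ V) = ((g : V ≃ₗ[ℂ] V).symm : Module.End ℂ V) := by
  refine D.ext_right fun u w => ?_
  rw [D.form_adj']
  have := g.2 u ((g : V ≃ₗ[ℂ] V).symm w)
  simpa using this

theorem actEnd_coe (g : D.Sp) (p : D.sp × V) :
    D.actEnd (((g : V ≃ₗ[ℂ] V) : Module.End ℂ V), p) = D.act g p := by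
  refine Prod.ext (Subtype.ext ?_) rfl
  change ((g : V ≃ₗ[ℂ] V) : Module.End ℂ V) * (p.1 : Module.End ℂ V) * D.adj _ = _
  rw [D.adj_coe]
  rfl

/-- The pullback along the action map from `Sp(V) × Σ`. -/
noncomputable def orbitHom : D.CoordM →ₐ[ℂ] D.CoordSpSlice :=
  D.liftM
    (((pullback fun q : D.Sp × D.Slice => D.act q.1 q.2.1).comp
      (polyFun (D.sp × V)).val).codRestrict (regFun fun q : D.Sp × D.Slice =>
        (((q.1 : V ≃ₗ[ℂ] V) : Module.End ℂ V), (q.2 : D.sp × V))) fun F =>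
          ⟨fun q => F.1 (D.actEnd q), D.isPolyMap_actEnd.comp_mem F.2,
            funext fun q => congrArg F.1 (D.actEnd_coe q.1 q.2)⟩)
    (((pullback fun q : D.Sp × D.Slice => D.toGl q.2.1).comp D.invGl.val).codRestrict
      (regFun fun q : D.Sp × D.Slice =>
        (((q.1 : V ≃ₗ[ℂ] V) : Module.End ℂ V), (q.2 : D.sp × V))) fun F =>
        ⟨fun q => F.1 (D.toGl q.2), (D.isPolyMap_toGl.comp (isPolyMap_linear
          (LinearMap.snd ℂ (Module.End ℂ V) (D.sp × V)))).comp_mem F.2.1, rfl⟩)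
    fun F => Subtype.ext (funext fun q => D.invSp_congr F (D.charpoly_shift_act q.1 q.2))

theorem sliceHom_apply (r : D.CoordM) (s : D.Slice) :
    (D.sliceHom r).1 s = D.evalM s.1 (D.toGl s.1) (D.charpoly_levi_toGl s).symm r := by
  induction r using TensorProduct.induction_on with
  | zero => rw [map_zero, map_zero]; rfl
  | tmul F P => rfl
  | add a b ha hb => rw [map_add, map_add, ← ha, ← hb]; rfl

theorem orbitHom_apply (r : D.CoordM) (g : D.Sp) (s : D.Slice) :
    (D.orbitHom r).1 (g, s) = D.evalM (D.act g s.1) (D.toGl s.1) (D.charpoly_shift_act g s) r := by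
  induction r using TensorProduct.induction_on with
  | zero => rw [map_zero, map_zero]; rfl
  | tmul F P => rfl
  | add a b ha hb => rw [map_add, map_add, ← ha, ← hb]; rfl

theorem isSliceHom_sliceHom : D.IsSliceHom D.sliceHom := by
  constructor
  · intro F s
    rw [D.sliceHom_apply, D.evalM_tmul]
    exact mul_one _
  · intro P s
    rw [D.sliceHom_apply, D.evalM_tmul]
    exact one_mul _

theorem isOrbitHom_orbitHom : D.IsOrbitHom D.orbitHom := by
  constructor
  · intro F g s
    rw [D.orbitHom_apply, D.evalM_tmul]
    exact mul_one _
  · intro P g s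
    rw [D.orbitHom_apply, D.evalM_tmul]
    exact one_mul _

theorem orbitHom_tmul (F : D.CoordX) (P : D.InvGl) (g : D.Sp) (s : D.Slice) :
    (D.orbitHom (F ⊗ₜ P)).1 (g, s) = F.1 (D.act g s.1) * P.1 (D.toGl s.1) := by
  rw [D.orbitHom_apply, D.evalM_tmul]

theorem evalM_actM (g : D.Sp) (s : D.Slice) (r : D.CoordM) :
    D.evalM s.1 (D.toGl s.1) (D.charpoly_levi_toGl s).symm (D.actM g r) =
      D.evalM (D.act g s.1) (D.toGl s.1) (D.charpoly_shift_act g s) r := by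
  induction r using TensorProduct.induction_on with
  | zero => simp only [map_zero]
  | tmul F P => rfl
  | add a b ha hb => simp only [map_add, ha, hb]

end Homomorphisms

/-! ### Squarefree monomials span `ℂ[gl(L)]^GL(L)` over `ℂ[sp(V)]^Sp(V)` -/

section Spanning

/-- The coefficients of the reversed characteristic polynomial, as invariants of `GL(L)`. -/
noncomputable def glRev (k : ℕ) : D.InvGl :=
  ⟨fun y => y.charpoly.coeff (revAt n k), IsPolyMap.charpoly_coeff isPolyMap_id _, fun g y => by
    simp only [LinearEquiv.charpoly_conj]⟩

/-- The coefficients of the reversed characteristic polynomial, as invariants of `Sp(V)`. -/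
noncomputable def spRev (k : ℕ) : D.InvSp :=
  ⟨fun x => (LinearMap.charpoly (x : Module.End ℂ V)).coeff (revAt (2 * n) k),
    D.isPolyMap_sp_coe.charpoly_coeff _, fun g x => by simp only [D.charpoly_Ad]⟩

theorem glRev_zero : D.glRev 0 = 1 := by
  refine Subtype.ext (funext fun y => ?_)
  have h1 := y.charpoly_monic
  rw [Monic, leadingCoeff, D.natDegree_charpoly_gl] at h1
  change y.charpoly.coeff (revAt n 0) = 1
  rw [revAt_zero, h1]

theorem glRev_of_lt {k : ℕ} (hk : n < k) : D.glRev k = 0 := by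
  refine Subtype.ext (funext fun y => ?_)
  change y.charpoly.coeff (revAt n k) = 0
  rw [revAt_eq_self_of_lt hk]
  exact coeff_eq_zero_of_natDegree_lt (by rwa [D.natDegree_charpoly_gl])

theorem glRev_succ (i : Fin n) : D.glRev (i + 1) = D.glInv i := by
  refine Subtype.ext (funext fun y => ?_)
  change y.charpoly.coeff (revAt n (i + 1)) = y.charpoly.coeff (n - (i + 1))
  rw [revAt_le (by lia)]

theorem invGl_ext {P Q : D.InvGl} (h : ∀ y, D.evalGl y P = D.evalGl y Q) : P = Q :=
  Subtype.ext (funext h)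

theorem evalGl_algebraMap (y : Module.End ℂ D.L) (F : D.InvSp) :
    D.evalGl y (algebraMap D.InvSp D.InvGl F) = D.evalSp (D.levi y) F := rfl

/-- The reversed characteristic polynomial of the Levi element is `r(X) r(-X)`, where `r` is the
reversed characteristic polynomial of `y`. Reversal makes the index a degree. -/
theorem evalSp_levi_spRev (y : Module.End ℂ D.L) (k : ℕ) :
    D.evalSp (D.levi y) (D.spRev k) =
      ∑ ij ∈ Finset.HasAntidiagonal.antidiagonal k,
        (-1) ^ ij.2 * (D.evalGl y (D.glRev ij.1) * D.evalGl y (D.glRev ij.2)) := by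
  change (LinearMap.charpoly (D.levi y : Module.End ℂ V)).coeff (revAt (2 * n) k) = _
  have hdeg := D.natDegree_charpoly_gl y
  have h2 : ∀ j, ((-1) ^ n * y.charpoly.comp (-X)).coeff j = (-1) ^ (n + j) * y.charpoly.coeff j := by
    intro j
    have h1 : ((-1 : ℂ[X])) ^ n = C ((-1) ^ n) := by simp
    rw [h1, coeff_C_mul, ← neg_one_mul (X : ℂ[X]), ← C_1, ← C_neg, comp_C_mul_X_coeff, pow_add]
    ring
  have hdeg2 : ((-1) ^ n * y.charpoly.comp (-X)).natDegree ≤ n := by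
    rw [natDegree_le_iff_coeff_eq_zero]
    intro j hj
    rw [h2, coeff_eq_zero_of_natDegree_lt (by rwa [hdeg]), mul_zero]
  rw [D.charpoly_eq_of_preserves _ (D.levi_preserves y), D.block_levi, ← coeff_reflect, two_mul,
    reflect_mul _ _ hdeg.le hdeg2, coeff_mul]
  refine Finset.sum_congr rfl fun ij _ => ?_
  rw [coeff_reflect, coeff_reflect, h2]
  change y.charpoly.coeff _ * _ = _ * (y.charpoly.coeff _ * y.charpoly.coeff _)
  rcases le_or_gt ij.2 n with h | h
  · rw [revAt_le h]
    have : ((-1 : ℂ)) ^ (n + (n - ij.2)) = (-1) ^ ij.2 := by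
      rw [show n + (n - ij.2) = 2 * (n - ij.2) + ij.2 by lia, pow_add, pow_mul]
      simp
    rw [this]
    ring
  · rw [revAt_eq_self_of_lt h, coeff_eq_zero_of_natDegree_lt (n := ij.2) (by rwa [hdeg])]
    ring

/-- In degree `2k` of the identity for `r(X) r(-X)`, the square of the `k`-th coefficient occurs
with sign `(-1)^k`; it is solved for, leaving an invariant of `sp(V)` and the other products of the
same degree. -/
theorem glRev_sq (k : ℕ) : ∃ (c : ℕ × ℕ → D.InvSp) (a : D.InvSp),
    D.glRev k * D.glRev k = algebraMap D.InvSp D.InvGl a +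
      ∑ ij ∈ (Finset.HasAntidiagonal.antidiagonal (2 * k)).erase (k, k),
        c ij • (D.glRev ij.1 * D.glRev ij.2) := by
  refine ⟨fun ij => algebraMap ℂ D.InvSp (-((-1) ^ k * (-1) ^ ij.2)),
    algebraMap ℂ D.InvSp ((-1) ^ k) * D.spRev (2 * k), ?_⟩
  refine D.invGl_ext fun y => ?_
  have hk : (k, k) ∈ Finset.HasAntidiagonal.antidiagonal (2 * k) := by
    rw [Finset.HasAntidiagonal.mem_antidiagonal]
    exact (two_mul k).symm
  simp only [algebraMap_smul, map_mul, map_add, map_sum, map_smul, smul_eq_mul, evalGl_algebraMap,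
    AlgHom.commutes, Algebra.algebraMap_self_apply]
  rw [D.evalSp_levi_spRev, ← Finset.add_sum_erase _ _ hk, mul_add, Finset.mul_sum, add_assoc,
    ← Finset.sum_add_distrib, Finset.sum_eq_zero, add_zero, ← mul_assoc, ← pow_add]
  · rw [Even.neg_one_pow ⟨k, rfl⟩, one_mul]
  · intro ij _
    ring

/-- `ℂ[gl(L)]^GL(L)` is spanned over `ℂ[sp(V)]^Sp(V)` by the squarefree monomials in the
coefficients of the characteristic polynomial. -/
theorem exists_sum_glInv (P : D.InvGl) : ∃ c : Finset (Fin n) → D.InvSp,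
    P = ∑ I, c I • ∏ i ∈ I, D.glInv i := by
  obtain ⟨Q, rfl⟩ := D.aeval_glInv_surjective P
  -- The statement is strengthened by an arbitrary product of generators, so that the induction on
  -- `Q` can move its variables into the multiset.
  have hspan : ∀ s : Multiset ℕ, MvPolynomial.aeval D.glInv Q * (s.map D.glRev).prod ∈
      Submodule.span D.InvSp (Set.range fun I : Finset (Fin n) => ∏ i ∈ I, D.glRev (i + 1)) := by
    induction Q using MvPolynomial.induction_on with
    | C a =>
      intro s
      rw [MvPolynomial.algHom_C, IsScalarTower.algebraMap_apply ℂ D.InvSp D.InvGl,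
        ← Algebra.smul_def]
      exact Submodule.smul_mem _ _ (prod_mem_span_squarefree n D.glRev D.glRev_zero
        (fun k hk => D.glRev_of_lt hk) (fun k _ => D.glRev_sq k) s)
    | add p q hp hq =>
      intro s
      rw [map_add, add_mul]
      exact Submodule.add_mem _ (hp s) (hq s)
    | mul_X p i hp =>
      intro s
      have := hp ((i + 1 : ℕ) ::ₘ s)
      rw [Multiset.map_cons, Multiset.prod_cons, D.glRev_succ, ← mul_assoc] at this
      rwa [map_mul, MvPolynomial.aeval_X]
  have h := hspan 0
  rw [Multiset.map_zero, Multiset.prod_zero, mul_one, Submodule.mem_span_range_iff_exists_fun] at h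
  obtain ⟨c, hc⟩ := h
  refine ⟨c, hc.symm.trans (Finset.sum_congr rfl fun I _ => ?_)⟩
  simp only [glRev_succ]

theorem exists_sum_tmul (r : D.CoordM) : ∃ F : Finset (Fin n) → D.CoordX,
    r = ∑ I, F I ⊗ₜ ∏ i ∈ I, D.glInv i := by
  induction r using TensorProduct.induction_on with
  | zero => exact ⟨0, by simp⟩
  | tmul F P =>
    obtain ⟨c, rfl⟩ := D.exists_sum_glInv P
    refine ⟨fun I => c I • F, ?_⟩
    rw [TensorProduct.tmul_sum]
    exact Finset.sum_congr rfl fun I _ => (TensorProduct.smul_tmul _ _ _).symm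
  | add a b ha hb =>
    obtain ⟨F, rfl⟩ := ha
    obtain ⟨G, rfl⟩ := hb
    exact ⟨fun I => F I + G I, by simp only [TensorProduct.add_tmul, Finset.sum_add_distrib]⟩

end Spanning

end Data

end PseudoSlice

namespace PseudoSlice

namespace Data

open Polynomial

variable {n : ℕ} {V : Type*} [AddCommGroup V] [Module ℂ V] (D : Data n V) [FiniteDimensional ℂ V]

/-! ### Functions on `𝔐` are determined by their values -/

section Injectivity

theorem exists_disc_ne_zero : ∃ s : D.Slice, disc (D.shift s.1 : Module.End ℂ V) ≠ 0 := by
  -- The spectrum `1, …, n` on `L` gives `x - v²` the `2n` distinct eigenvalues `±1, …, ±n`.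
  obtain ⟨s, -, h⟩ := D.exists_slice D.e (q := ∏ i : Fin n, (X - C ((i : ℕ) + 1 : ℂ)))
    (monic_prod_of_monic _ _ fun i _ => monic_X_sub_C ((i : ℕ) + 1 : ℂ))
    (natDegree_prod_X_sub_C fun i : Fin n => ((i : ℕ) + 1 : ℂ))
  refine ⟨s, disc_ne_zero ?_⟩
  rw [D.charpoly_shift_slice s h]
  refine separable_prod_X_sq_sub_C (fun i j hij => ?_) fun i => ?_
  · have h1 : (((i : ℕ) + 1) ^ 2 : ℕ) = ((j : ℕ) + 1) ^ 2 := by exact_mod_cast hij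
    have h2 := Nat.pow_left_injective two_ne_zero h1
    exact Fin.ext (by lia)
  · exact pow_ne_zero 2 (by exact_mod_cast Nat.succ_ne_zero i)

theorem eq_zero_of_cyclic_of_disc {F : D.sp × V → ℂ} (hF : F ∈ polyFun (D.sp × V))
    (h : ∀ p : D.sp × V, IsCyclic (p.1 : Module.End ℂ V) p.2 →
      disc (D.shift p : Module.End ℂ V) ≠ 0 → F p = 0) (p : D.sp × V) : F p = 0 := by
  have hdisc : (fun p => disc (D.shift p : Module.End ℂ V)) ∈ polyFun (D.sp × V) :=
    disc_mem_polyFun (D.isPolyMap_sp_coe.comp D.isPolyMap_shift)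
  obtain ⟨s, hs⟩ := D.exists_disc_ne_zero
  refine polyFun_eq_zero_of_dense hF hdisc ⟨s.1, hs⟩ (fun p hp => ?_) p
  have := D.eq_zero_of_cyclic (mul_mem_polyFun hF hdisc) (fun p hc => ?_) p
  · exact (mul_eq_zero.1 this).resolve_right hp
  · by_cases h0 : disc (D.shift p : Module.End ℂ V) = 0
    · rw [h0, mul_zero]
    · rw [h p hc h0, zero_mul]

theorem evalM_congr {p p' : D.sp × V} {y y' : Module.End ℂ D.L}
    (h : LinearMap.charpoly (D.shift p : Module.End ℂ V) =
      LinearMap.charpoly (D.levi y : Module.End ℂ V))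
    (h' : LinearMap.charpoly (D.shift p' : Module.End ℂ V) =
      LinearMap.charpoly (D.levi y' : Module.End ℂ V)) (hp : p = p')
    (hy : y.charpoly = y'.charpoly) (r : D.CoordM) : D.evalM p y h r = D.evalM p' y' h' r := by
  subst hp
  induction r using TensorProduct.induction_on with
  | zero => rw [map_zero, map_zero]
  | tmul F P => rw [D.evalM_tmul, D.evalM_tmul, D.invGl_congr P hy]
  | add a b ha hb => rw [map_add, map_add, ha, hb]

/-- An element of `ℂ[𝔐]` vanishing at all points of `𝔐` is zero. -/
theorem eq_zero_of_evalM {r : D.CoordM}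
    (hr : ∀ p y h, IsCyclic (p.1 : Module.End ℂ V) p.2 → D.evalM p y h r = 0) : r = 0 := by
  classical
  obtain ⟨F, rfl⟩ := D.exists_sum_tmul r
  suffices hF : ∀ I, F I = 0 by simp [hF]
  suffices hF : ∀ p : D.sp × V, IsCyclic (p.1 : Module.End ℂ V) p.2 →
      disc (D.shift p : Module.End ℂ V) ≠ 0 → ∀ I, (F I).1 p = 0 by
    intro I
    exact Subtype.ext (funext fun p =>
      D.eq_zero_of_cyclic_of_disc (F I).2 (fun p hc hd => hF p hc hd I) p)
  intro p hc hd
  obtain ⟨τ, hτ⟩ := D.exists_charpoly_eq_sq (D.shift p)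
  obtain ⟨hinj, h0⟩ := injective_of_not_sq_dvd (τ := τ) fun t ht =>
    not_sq_dvd_of_disc hd t (by rwa [hτ])
  -- The `2^n` choices of signs of the eigenvalues give `2^n` points of `𝔐` over `p`; they are
  -- distinct because the `τ i` are nonzero with distinct squares. The slice serves only to supply
  -- operators on `L` with these spectra.
  let τs : Finset (Fin n) → Fin n → ℂ := fun ε i => if i ∈ ε then τ i else -τ i
  have hτs : ∀ ε i, τs ε i ^ 2 = τ i ^ 2 := by
    intro ε i
    simp only [τs]
    split_ifs
    · rfl
    · ring
  choose s hs using fun ε => (D.exists_slice D.e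
    (monic_prod_of_monic _ _ fun i _ => monic_X_sub_C (τs ε i))
    (natDegree_prod_X_sub_C (τs ε))).imp fun _ h => h.2
  let y : Finset (Fin n) → Module.End ℂ D.L := fun ε => D.toGl (s ε).1
  have hy : ∀ ε, LinearMap.charpoly (D.shift p : Module.End ℂ V) =
      LinearMap.charpoly (D.levi (y ε) : Module.End ℂ V) := by
    intro ε
    rw [D.charpoly_levi_toGl, D.charpoly_shift_slice _ (hs ε), hτ]
    simp only [hτs]
  have hyinj : Function.Injective fun ε => D.glCoeff (y ε) := by
    intro ε ε' h
    have hchar : (y ε).charpoly = (y ε').charpoly :=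
      D.eq_charpoly_of_glCoeff (y ε').charpoly_monic (D.natDegree_charpoly_gl _) fun i =>
        congrFun h i
    rw [show (y ε).charpoly = _ from hs ε, show (y ε').charpoly = _ from hs ε'] at hchar
    ext i
    have hroot := congrArg (eval (τs ε i)) hchar
    rw [eval_prod, eval_prod, Finset.prod_eq_zero (Finset.mem_univ i) (by simp), eq_comm,
      Finset.prod_eq_zero_iff] at hroot
    obtain ⟨j, -, hj⟩ := hroot
    have hj' : τs ε i = τs ε' j := by simpa [sub_eq_zero] using hj
    have hij : i = j := hinj (by
      change τ i ^ 2 = τ j ^ 2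
      rw [← hτs ε i, ← hτs ε' j, hj'])
    subst hij
    have h2 := h0 i
    simp only [τs] at hj'
    split_ifs at hj' with h3 h4 h4
    · exact iff_of_true h3 h4
    · exact (h2 (self_eq_neg.1 hj')).elim
    · exact (h2 (neg_eq_self.1 hj')).elim
    · exact iff_of_false h3 h4
  -- Rows are indexed by the points of the fibre, columns by the squarefree monomials. Vanishing of
  -- the element on the fibre says that its coefficients at `p` are in the kernel of this square
  -- matrix.
  let A : Matrix (Finset (Fin n)) (Finset (Fin n)) ℂ :=
    fun ε I => D.evalGl (y ε) (∏ i ∈ I, D.glInv i)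
  have hAc : A.mulVec (fun I => (F I).1 p) = 0 := by
    funext ε
    have h1 := hr p (y ε) (hy ε) hc
    rw [map_sum] at h1
    simp only [evalM_tmul] at h1
    rw [Matrix.mulVec, dotProduct]
    refine Eq.trans (Finset.sum_congr rfl fun I _ => ?_) h1
    exact mul_comm _ _
  -- Any values on the fibre are interpolated by an invariant of `gl(L)`. Its expansion in
  -- squarefree monomials has coefficients from `sp(V)//Sp(V)`, which are constant on the fibre, so
  -- it solves the linear system. A surjective square matrix is injective.
  have hsurj : Function.Surjective A.mulVecLin := by
    intro φ
    obtain ⟨P, hP⟩ := exists_mvPolynomial_interpolation (fun ε => D.glCoeff (y ε)) hyinj φ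
    obtain ⟨c, hcP⟩ := D.exists_sum_glInv (MvPolynomial.aeval D.glInv P)
    refine ⟨fun I => (c I).1 (D.shift p), funext fun ε => ?_⟩
    have h1 := D.aeval_glInv_apply P (y ε)
    rw [hP, hcP] at h1
    change D.evalGl (y ε) _ = _ at h1
    rw [map_sum] at h1
    rw [← h1, Matrix.mulVecLin_apply, Matrix.mulVec, dotProduct]
    refine Finset.sum_congr rfl fun I _ => ?_
    rw [Algebra.smul_def, map_mul, D.evalGl_algebraMap, mul_comm]
    congr 1
    exact D.invSp_congr (c I) (hy ε)
  have hinjA : Function.Injective A.mulVecLin := LinearMap.injective_iff_surjective.2 hsurj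
  have := hinjA (a₁ := fun I => (F I).1 p) (a₂ := 0) (by
    rw [map_zero, Matrix.mulVecLin_apply, hAc])
  exact fun I => congrFun this I

theorem exists_eigenvalues (y : Module.End ℂ D.L) : ∃ τ : Fin n → ℂ,
    y.charpoly = ∏ i, (X - C (τ i)) :=
  exists_eq_prod_X_sub_C y.charpoly_monic (D.natDegree_charpoly_gl y)

theorem charpoly_levi {y : Module.End ℂ D.L} {τ : Fin n → ℂ}
    (h : y.charpoly = ∏ i, (X - C (τ i))) :
    LinearMap.charpoly (D.levi y : Module.End ℂ V) = ∏ i, (X ^ 2 - C (τ i ^ 2)) :=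
  D.charpoly_eq_prod_of_preserves _ (D.levi_preserves y) (by rw [D.block_levi, h])

/-- Every point of `𝔐` over a cyclic pair lies on an orbit of `Σ`, with the spectrum on `L`
prescribed by that point. -/
theorem orbitHom_injective : Function.Injective D.orbitHom := by
  rw [injective_iff_map_eq_zero]
  intro r hr
  refine D.eq_zero_of_evalM fun p y h hc => ?_
  obtain ⟨τ, hτ⟩ := D.exists_eigenvalues y
  obtain ⟨g, s, hgs, hs⟩ := D.exists_act_slice hc (h.trans (D.charpoly_levi hτ))
  rw [D.evalM_congr h (D.charpoly_shift_act g s) hgs.symm (hτ.trans hs.symm),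
    ← D.orbitHom_apply, hr]
  rfl

end Injectivity

/-! ### The invariants of `ℂ[𝔐]` and the Weierstrass section -/

section Quotient

theorem sliceHom_quotHom_tmul (F : D.InvSp) (P : D.InvGl) (s : D.Slice) :
    (D.sliceHom (D.quotHom (F ⊗ₜ P))).1 s = F.1 s.1.1 * P.1 (D.toGl s.1) := by
  rw [quotHom, Algebra.TensorProduct.productMap_apply_tmul]
  change (D.sliceHom ((D.fstHom F ⊗ₜ 1) * (1 ⊗ₜ P))).1 s = _
  rw [Algebra.TensorProduct.tmul_mul_tmul, one_mul, mul_one, D.sliceHom_apply, D.evalM_tmul]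
  rfl

theorem quotHom_tmul (F : D.InvSp) (P : D.InvGl) :
    D.quotHom (F ⊗ₜ P) = D.fstHom F ⊗ₜ[D.InvSp] P := by
  rw [quotHom, Algebra.TensorProduct.productMap_apply_tmul]
  change (D.fstHom F ⊗ₜ 1) * (1 ⊗ₜ P) = _
  rw [Algebra.TensorProduct.tmul_mul_tmul, one_mul, mul_one]

/-- The polynomials in the coefficients of the two characteristic polynomials. -/
noncomputable def invHom : SliceRing n →ₐ[ℂ] D.InvSp ⊗[ℂ] D.InvGl :=
  MvPolynomial.aeval (Sum.elim (fun i => D.spInv i ⊗ₜ 1) fun i => 1 ⊗ₜ D.glInv i)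

theorem invHom_surjective : Function.Surjective D.invHom := by
  rw [← AlgHom.range_eq_top, eq_top_iff]
  rintro r -
  induction r using TensorProduct.induction_on with
  | zero => exact Subalgebra.zero_mem _
  | add a b ha hb => exact Subalgebra.add_mem _ ha hb
  | tmul F P =>
    obtain ⟨Q, rfl⟩ := D.aeval_spInv_surjective F
    obtain ⟨R, rfl⟩ := D.aeval_glInv_surjective P
    have h1 : (D.invHom.comp (MvPolynomial.rename Sum.inl)) =
        (Algebra.TensorProduct.includeLeft : D.InvSp →ₐ[ℂ] D.InvSp ⊗[ℂ] D.InvGl).comp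
          (MvPolynomial.aeval D.spInv) := by
      ext i
      simp [invHom]
    have h2 : (D.invHom.comp (MvPolynomial.rename Sum.inr)) =
        (Algebra.TensorProduct.includeRight : D.InvGl →ₐ[ℂ] D.InvSp ⊗[ℂ] D.InvGl).comp
          (MvPolynomial.aeval D.glInv) := by
      ext i
      simp [invHom]
    refine ⟨MvPolynomial.rename Sum.inl Q * MvPolynomial.rename Sum.inr R, ?_⟩
    have h3 := DFunLike.congr_fun h1 Q
    have h4 := DFunLike.congr_fun h2 R
    simp only [AlgHom.comp_apply, Algebra.TensorProduct.includeLeft_apply,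
      Algebra.TensorProduct.includeRight_apply] at h3 h4
    change D.invHom _ = _
    rw [map_mul, h3, h4, Algebra.TensorProduct.tmul_mul_tmul, one_mul, mul_one]

/-- Evaluation at a point of the pseudo-slice. -/
def evalSlice (s : D.Slice) : D.CoordSlice →ₐ[ℂ] ℂ :=
  (Pi.evalAlgHom ℂ (fun _ : D.Slice => ℂ) s).comp
    (regFun (Subtype.val : D.Slice → D.sp × V)).val

theorem sliceHom_quotHom_invHom (Q : SliceRing n) (s : D.Slice) :
    (D.sliceHom (D.quotHom (D.invHom Q))).1 s = MvPolynomial.eval (D.sliceCoord s) Q := by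
  have : (D.evalSlice s).comp (D.sliceHom.comp (D.quotHom.comp D.invHom)) =
      MvPolynomial.aeval (D.sliceCoord s) := by
    ext i
    rw [MvPolynomial.aeval_X, AlgHom.comp_apply, AlgHom.comp_apply, AlgHom.comp_apply, invHom,
      MvPolynomial.aeval_X]
    rcases i with i | i
    · exact (D.sliceHom_quotHom_tmul _ _ s).trans (mul_one _)
    · exact (D.sliceHom_quotHom_tmul _ _ s).trans (one_mul _)
  exact DFunLike.congr_fun this Q

/-- Under `invHom` the composite sends the variables to the `2n` coefficients, which are coordinates
on `Σ`. -/
theorem sliceHom_comp_quotHom_bijective : Function.Bijective (D.sliceHom.comp D.quotHom) := by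
  constructor
  · rw [injective_iff_map_eq_zero]
    intro r hr
    obtain ⟨Q, rfl⟩ := D.invHom_surjective r
    suffices hQ : Q = 0 by rw [hQ, map_zero]
    refine MvPolynomial.funext fun c => ?_
    obtain ⟨z, l, h⟩ := exists_eval_sliceCoeff c
    have h1 := D.sliceHom_quotHom_invHom Q (D.slicePoint z l)
    rw [show D.sliceCoord (D.slicePoint z l) = c from funext fun i =>
      (D.sliceCoord_slicePoint z l i).trans (h i)] at h1
    rw [← h1, map_zero]
    exact congrFun (congrArg Subtype.val hr) _
  · rintro ⟨_, G, hG, rfl⟩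
    obtain ⟨Q, hQ⟩ := D.exists_eval_sliceCoord hG
    refine ⟨D.invHom Q, Subtype.ext (funext fun s => ?_)⟩
    exact (D.sliceHom_quotHom_invHom Q s).trans (hQ s).symm

theorem quotHom_injective : Function.Injective D.quotHom :=
  Function.Injective.of_comp (f := D.sliceHom) D.sliceHom_comp_quotHom_bijective.1

theorem sliceHom_surjective : Function.Surjective D.sliceHom :=
  Function.Surjective.of_comp (g := D.quotHom) D.sliceHom_comp_quotHom_bijective.2

theorem mem_invM_iff (r : D.CoordM) : r ∈ D.invM ↔ ∀ g, D.actM g r = r := by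
  simp [invM, Algebra.mem_iInf, AlgHom.mem_equalizer]

theorem actM_quotHom (g : D.Sp) (t : D.InvSp ⊗[ℂ] D.InvGl) :
    D.actM g (D.quotHom t) = D.quotHom t := by
  induction t using TensorProduct.induction_on with
  | zero => simp only [map_zero]
  | add a b ha hb => simp only [map_add, ha, hb]
  | tmul F P =>
    rw [D.quotHom_tmul]
    change (D.actX g (D.fstHom F)) ⊗ₜ[D.InvSp] P = _
    congr 1
    exact Subtype.ext (funext fun p => F.2.2 g p.1)

theorem orbitHom_of_mem_invM {r : D.CoordM} (hr : r ∈ D.invM) (g : D.Sp) (s : D.Slice) :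
    (D.orbitHom r).1 (g, s) = (D.sliceHom r).1 s := by
  rw [D.orbitHom_apply, ← D.evalM_actM, (D.mem_invM_iff r).1 hr, D.sliceHom_apply]

/-- An invariant and the element of the image with the same restriction to `Σ` have the same
pullback to `Sp(V) × Σ`, so they coincide by `orbitHom_injective`. -/
theorem quotHom_range : D.quotHom.range = D.invM := by
  apply le_antisymm
  · rintro _ ⟨t, rfl⟩
    exact (D.mem_invM_iff _).2 fun g => D.actM_quotHom g t
  · intro r hr
    obtain ⟨t, ht⟩ := D.sliceHom_comp_quotHom_bijective.2 (D.sliceHom r)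
    have hq : D.quotHom t ∈ D.invM := (D.mem_invM_iff _).2 fun g => D.actM_quotHom g t
    refine ⟨t, D.orbitHom_injective (Subtype.ext (funext fun q => ?_))⟩
    obtain ⟨g, s⟩ := q
    refine (D.orbitHom_of_mem_invM hq g s).trans (Eq.trans ?_ (D.orbitHom_of_mem_invM hr g s).symm)
    exact congrFun (congrArg Subtype.val ht) s

theorem sliceHom_comp_invM_bijective : Function.Bijective (D.sliceHom.comp D.invM.val) := by
  constructor
  · rintro ⟨r, hr⟩ ⟨r', hr'⟩ h
    rw [← D.quotHom_range] at hr hr'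
    obtain ⟨t, rfl⟩ := hr
    obtain ⟨t', rfl⟩ := hr'
    have : t = t' := D.sliceHom_comp_quotHom_bijective.1 h
    subst this
    rfl
  · intro b
    obtain ⟨t, ht⟩ := D.sliceHom_comp_quotHom_bijective.2 b
    exact ⟨⟨D.quotHom t, D.quotHom_range ▸ ⟨t, rfl⟩⟩, ht⟩

end Quotient

end Data

end PseudoSlice

namespace PseudoSlice

namespace Data

variable {n : ℕ} {V : Type*} [AddCommGroup V] [Module ℂ V] (D : Data n V)

/-! ### Generation of `Sp(V)` by transvections -/

section Transvections

theorem form_self (u : V) : D.ω u u = 0 := D.alt u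

theorem form_swap (u w : V) : D.ω u w = -D.ω w u := (D.alt.neg_eq w u).symm

/-- The symplectic transvection `w ↦ w + c ⟨d, w⟩ d`. -/
def transvection (d : V) (c : ℂ) : D.Sp :=
  ⟨LinearEquiv.ofLinearMap (LinearMap.id + c • (D.ω d).smulRight d)
    (LinearMap.id + (-c) • (D.ω d).smulRight d)
    (by ext w; simp [D.form_self]) (by ext w; simp [D.form_self]), fun u w => by
    change D.ω (u + c • D.ω d u • d) (w + c • D.ω d w • d) = D.ω u w
    have := D.form_swap u d
    simp only [map_add, map_smul, LinearMap.add_apply, LinearMap.smul_apply, smul_eq_mul,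
      D.form_self]
    rw [this]
    ring⟩

theorem transvection_apply (d : V) (c : ℂ) (w : V) :
    (D.transvection d c : V ≃ₗ[ℂ] V) w = w + c • D.ω d w • d := rfl

theorem transvection_neg_mul (d : V) (c : ℂ) (g : D.Sp) :
    D.transvection d (-c) * (D.transvection d c * g) = g := by
  refine Subtype.ext (LinearEquiv.ext fun w => ?_)
  change (D.transvection d (-c) : V ≃ₗ[ℂ] V) ((D.transvection d c : V ≃ₗ[ℂ] V) (g.1 w)) = g.1 w
  simp [transvection_apply, D.form_self]

theorem transvection_zero (d : V) : D.transvection d 0 = 1 := by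
  refine Subtype.ext (LinearEquiv.ext fun w => ?_)
  rw [transvection_apply, zero_smul, add_zero]
  rfl

/-- The vector `g u - u` is orthogonal to every vector fixed by `g`, so the transvection along it
keeps these vectors fixed. -/
theorem transvection_apply_of_fixed {g : D.Sp} (u : V) (c : ℂ) {w : V}
    (hw : (g : V ≃ₗ[ℂ] V) w = w) :
    (D.transvection ((g : V ≃ₗ[ℂ] V) u - u) c * g : V ≃ₗ[ℂ] V) w = w := by
  change (D.transvection ((g : V ≃ₗ[ℂ] V) u - u) c : V ≃ₗ[ℂ] V) ((g : V ≃ₗ[ℂ] V) w) = w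
  have h := g.2 u w
  rw [hw] at h
  rw [hw, transvection_apply, map_sub, LinearMap.sub_apply, h, sub_self, zero_smul, smul_zero,
    add_zero]

/-- The constant is chosen so that the transvection along `g u - u` takes `g u` back to `u`. -/
theorem exists_transvection_fix {g : D.Sp} {u : V} (hu : D.ω u ((g : V ≃ₗ[ℂ] V) u) ≠ 0) :
    ∃ d c, (∀ w, (g : V ≃ₗ[ℂ] V) w = w → (D.transvection d c * g : V ≃ₗ[ℂ] V) w = w) ∧
      (D.transvection d c * g : V ≃ₗ[ℂ] V) u = u := by
  refine ⟨(g : V ≃ₗ[ℂ] V) u - u, (D.ω u ((g : V ≃ₗ[ℂ] V) u))⁻¹,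
    fun w hw => D.transvection_apply_of_fixed u _ hw, ?_⟩
  change (D.transvection _ _ : V ≃ₗ[ℂ] V) ((g : V ≃ₗ[ℂ] V) u) = u
  rw [transvection_apply, map_sub, LinearMap.sub_apply, D.form_self, zero_sub, smul_smul, mul_neg,
    inv_mul_cancel₀ hu, neg_one_smul]
  abel

/-- Symplectic transvections generate the symplectic group. -/
theorem sp_induction [FiniteDimensional ℂ V] {P : D.Sp → Prop} (h1 : P 1)
    (hmul : ∀ d c g, P g → P (D.transvection d c * g)) (g : D.Sp) : P g := by
  -- Induction on the codimension of the space of fixed vectors.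
  induction hk : Module.finrank ℂ V - Module.finrank ℂ
      (LinearMap.ker (((g : V ≃ₗ[ℂ] V) : Module.End ℂ V) - 1)) using Nat.strong_induction_on
    generalizing g with
  | _ k ih =>
  have hmem : ∀ (g : D.Sp) w, w ∈ LinearMap.ker (((g : V ≃ₗ[ℂ] V) : Module.End ℂ V) - 1) ↔
      (g : V ≃ₗ[ℂ] V) w = w := fun g w => by
    rw [LinearMap.mem_ker, LinearMap.sub_apply, sub_eq_zero]
    rfl
  have hback : ∀ d c (g : D.Sp), P (D.transvection d c * g) → P g := fun d c g h => by
    have := hmul d (-c) _ h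
    rwa [D.transvection_neg_mul] at this
  have hstep : ∀ (g' : D.Sp) (u : V), (∀ w, (g : V ≃ₗ[ℂ] V) w = w → (g' : V ≃ₗ[ℂ] V) w = w) →
      (g' : V ≃ₗ[ℂ] V) u = u → (g : V ≃ₗ[ℂ] V) u ≠ u → P g' := by
    intro g' u hfix hu hgu
    refine ih _ ?_ g' rfl
    have hlt : LinearMap.ker (((g : V ≃ₗ[ℂ] V) : Module.End ℂ V) - 1) <
        LinearMap.ker (((g' : V ≃ₗ[ℂ] V) : Module.End ℂ V) - 1) := by
      refine lt_of_le_of_ne (fun w hw => (hmem g' w).2 (hfix w ((hmem g w).1 hw))) fun h => ?_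
      exact hgu ((hmem g u).1 (h ▸ (hmem g' u).2 hu))
    have h1 := Submodule.finrank_lt_finrank_of_lt hlt
    have h2 := Submodule.finrank_le (LinearMap.ker (((g' : V ≃ₗ[ℂ] V) : Module.End ℂ V) - 1))
    lia
  by_cases hall : ∀ u, D.ω u ((g : V ≃ₗ[ℂ] V) u) = 0
  · by_cases hg : ∀ u, (g : V ≃ₗ[ℂ] V) u = u
    · rwa [show g = 1 from Subtype.ext (LinearEquiv.ext hg)]
    push Not at hg
    obtain ⟨u, hu⟩ := hg
    have hpol : ∀ u w, D.ω w ((g : V ≃ₗ[ℂ] V) u) = -D.ω u ((g : V ≃ₗ[ℂ] V) w) := by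
      intro u w
      have h := hall (u + w)
      simp only [map_add, LinearMap.add_apply, hall, zero_add, add_zero] at h
      linear_combination h
    obtain ⟨w, hw⟩ : ∃ w, D.ω u ((g : V ≃ₗ[ℂ] V) w - w) ≠ 0 := by
      by_contra! h
      apply hu
      rw [← sub_eq_zero]
      apply D.nondeg.1
      intro w
      have h1 := h w
      rw [map_sub, sub_eq_zero] at h1
      rw [map_sub, LinearMap.sub_apply, D.form_swap, hpol, neg_neg, h1, sub_self]
    -- When `⟨u, g u⟩` vanishes identically, no vector satisfies the hypothesis of
    -- `exists_transvection_fix`. A preliminary transvection along `d = g w - w` preserves the fixed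
    -- vectors and makes this number `⟨u, d⟩²`, which is nonzero; a second one then enlarges the
    -- fixed space.
    let g' := D.transvection ((g : V ≃ₗ[ℂ] V) w - w) 1 * g
    have hg' : D.ω u ((g' : V ≃ₗ[ℂ] V) u) ≠ 0 := by
      change D.ω u ((D.transvection ((g : V ≃ₗ[ℂ] V) w - w) 1 : V ≃ₗ[ℂ] V)
        ((g : V ≃ₗ[ℂ] V) u)) ≠ 0
      have h2 : D.ω ((g : V ≃ₗ[ℂ] V) w - w) ((g : V ≃ₗ[ℂ] V) u) =
          D.ω u ((g : V ≃ₗ[ℂ] V) w - w) := by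
        rw [map_sub, LinearMap.sub_apply, g.2 w u, hpol u w, map_sub, D.form_swap w u]
        ring
      rw [transvection_apply, map_add, hall, zero_add, one_smul, map_smul, h2, smul_eq_mul]
      exact mul_ne_zero hw hw
    obtain ⟨d, c, hfix, hdu⟩ := D.exists_transvection_fix hg'
    refine hback _ _ _ (hback d c _ (hstep _ u (fun x hx => hfix x ?_) hdu hu))
    exact D.transvection_apply_of_fixed w 1 hx
  · push Not at hall
    obtain ⟨u, hu⟩ := hall
    obtain ⟨d, c, hfix, hdu⟩ := D.exists_transvection_fix hu
    exact hback d c g (hstep _ u hfix hdu fun h => hu (by rw [h, D.form_self]))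

variable [FiniteDimensional ℂ V]

/-- The symplectic group is connected by polynomial families. -/
theorem exists_polynomial_family (g : D.Sp) : ∃ (m : ℕ) (φ : (Fin m → ℂ) → D.Sp),
    IsPolyMap (fun w => (((φ w : D.Sp) : V ≃ₗ[ℂ] V) : Module.End ℂ V)) ∧ φ 0 = 1 ∧ φ 1 = g := by
  induction g using D.sp_induction with
  | h1 => exact ⟨0, fun _ => 1, isPolyMap_const _, rfl, rfl⟩
  | hmul d c g ih =>
    obtain ⟨m, φ, hφ, h0, h1⟩ := ih
    refine ⟨m + 1, fun w => D.transvection d (c * w 0) * φ fun i => w i.succ, ?_, ?_, ?_⟩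
    · have hT : IsPolyMap fun w : Fin (m + 1) → ℂ =>
          (LinearMap.id + (c * w 0) • (D.ω d).smulRight d : Module.End ℂ V) :=
        (isPolyMap_const _).add (IsPolyMap.smul (mul_mem_polyFun (const_mem_polyFun c)
          (proj_mem_polyFun 0)) (isPolyMap_const _))
      exact hT.mul (hφ.comp (IsPolyMap.pi fun i => proj_mem_polyFun i.succ))
    · change D.transvection d (c * 0) * φ 0 = 1
      rw [mul_zero, D.transvection_zero, one_mul, h0]
    · change D.transvection d (c * 1) * φ 1 = _
      rw [mul_one, h1]

end Transvections

/-! ### The coordinate rings are domains -/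

section Domains

variable [FiniteDimensional ℂ V]

instance : IsDomain D.CoordX := inferInstanceAs (IsDomain (polyFun (D.sp × V)))

instance : UniqueFactorizationMonoid D.CoordX :=
  inferInstanceAs (UniqueFactorizationMonoid (polyFun (D.sp × V)))

/-- Any two points of `Sp(V) × Σ` lie in the image of one polynomial map from a vector space, by
`exists_polynomial_family` and because `Σ` is an affine space. Two functions with zero product pull
back to a domain, so one of them vanishes on the whole image; the two points are taken where the
respective functions do not vanish. -/
instance : IsDomain D.CoordSpSlice := by
  have hne : Nontrivial D.CoordSpSlice := by
    refine ⟨0, 1, fun h => ?_⟩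
    have := congrFun (congrArg Subtype.val h) (1, D.slicePoint 0 0)
    exact zero_ne_one this
  have hz : NoZeroDivisors D.CoordSpSlice := by
    refine ⟨fun {a b} hab => ?_⟩
    obtain ⟨_, F, hF, rfl⟩ := a
    obtain ⟨_, G, hG, rfl⟩ := b
    by_contra! h
    obtain ⟨⟨q, hq⟩, q', hq'⟩ : (∃ q : D.Sp × D.Slice,
        F (((q.1 : V ≃ₗ[ℂ] V) : Module.End ℂ V), (q.2 : D.sp × V)) ≠ 0) ∧
        ∃ q : D.Sp × D.Slice,
          G (((q.1 : V ≃ₗ[ℂ] V) : Module.End ℂ V), (q.2 : D.sp × V)) ≠ 0 := by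
      refine ⟨?_, ?_⟩ <;> by_contra! h'
      · exact h.1 (Subtype.ext (funext h'))
      · exact h.2 (Subtype.ext (funext h'))
    have hFG : ∀ q : D.Sp × D.Slice,
        F (((q.1 : V ≃ₗ[ℂ] V) : Module.End ℂ V), (q.2 : D.sp × V)) *
          G (((q.1 : V ≃ₗ[ℂ] V) : Module.End ℂ V), (q.2 : D.sp × V)) = 0 := fun q =>
      congrFun (congrArg Subtype.val hab) q
    obtain ⟨g, s⟩ := q
    obtain ⟨g', s'⟩ := q'
    obtain ⟨z, l, rfl⟩ := D.exists_slicePoint s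
    obtain ⟨z', l', rfl⟩ := D.exists_slicePoint s'
    obtain ⟨m, φ, hφ, h0, h1⟩ := D.exists_polynomial_family (g⁻¹ * g')
    let W := (Fin m → ℂ) × (Fin n → ℂ) × (Fin n → ℂ)
    let Ψ : W → D.Sp × D.Slice := fun w => (g * φ w.1, D.slicePoint w.2.1 w.2.2)
    have hΨ : IsPolyMap fun w : W => ((((Ψ w).1 : V ≃ₗ[ℂ] V) : Module.End ℂ V),
        ((Ψ w).2 : D.sp × V)) := by
      have hw1 : IsPolyMap fun w : W => w.1 :=
        isPolyMap_linear (LinearMap.fst ℂ (Fin m → ℂ) ((Fin n → ℂ) × (Fin n → ℂ)))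
      have hw2 : IsPolyMap fun w : W => w.2 :=
        isPolyMap_linear (LinearMap.snd ℂ (Fin m → ℂ) ((Fin n → ℂ) × (Fin n → ℂ)))
      have hw21 : IsPolyMap fun w : W => w.2.1 := hw2.linear (LinearMap.fst ℂ _ _)
      have hw22 : IsPolyMap fun w : W => w.2.2 := hw2.linear (LinearMap.snd ℂ _ _)
      refine IsPolyMap.prodMk ?_ (IsPolyMap.prodMk ?_ ?_)
      · exact (isPolyMap_const ((g : V ≃ₗ[ℂ] V) : Module.End ℂ V)).mul (hφ.comp hw1)
      · exact D.isPolyMap_kostantPoint.comp hw21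
      · exact D.isPolyMap_sliceVec.comp hw22
    rcases polyFun_eq_zero_or (hΨ.comp_mem hF) (hΨ.comp_mem hG) fun w => hFG (Ψ w) with h2 | h2
    · apply hq
      have h3 : Ψ (0, z, l) = (g, D.slicePoint z l) := by
        simp only [Ψ, h0, mul_one]
      have h4 := congrFun h2 (0, z, l)
      simp only [h3] at h4
      exact h4
    · apply hq'
      have h3 : Ψ (1, z', l') = (g', D.slicePoint z' l') := by
        simp only [Ψ, h1, mul_inv_cancel_left]
      have h4 := congrFun h2 (1, z', l')
      simp only [h3] at h4
      exact h4
  exact NoZeroDivisors.to_isDomain _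

instance : IsDomain D.CoordM := D.orbitHom_injective.isDomain D.orbitHom.toRingHom

end Domains

end Data

end PseudoSlice

namespace PseudoSlice

/-! ### Overrings inside a fraction field -/

section FractionRings

variable {A B : Type*} [CommRing A] [IsDomain A] [Algebra ℂ A] [CommRing B] [IsDomain B]
  [Algebra ℂ B]

/-- An overring all of whose elements are fractions embeds uniquely into the fraction field. -/
theorem exists_embedding_fractionRing (μ : A →ₐ[ℂ] B) (hμ : Function.Injective μ)
    (h : ∀ b, ∃ c a : A, c ≠ 0 ∧ μ a = μ c * b) :
    ∃ j : B →ₐ[ℂ] FractionRing A, (∀ r, j (μ r) = algebraMap A (FractionRing A) r) ∧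
      (∀ j' : B →ₐ[ℂ] FractionRing A, (∀ r, j' (μ r) = algebraMap A (FractionRing A) r) → j' = j) ∧
      Function.Injective j := by
  have hinj : Function.Injective ((algebraMap B (FractionRing B)).comp μ.toRingHom) :=
    (IsFractionRing.injective B (FractionRing B)).comp hμ
  -- Both rings are compared inside the fraction field of `B`: each element of `B` is a fraction
  -- over `A`, so it lies in the image of the injective map `l`, and `j` is the inverse of `l`
  -- there.
  let l : FractionRing A →+* FractionRing B := IsFractionRing.lift hinj
  have hl : ∀ a, l (algebraMap A (FractionRing A) a) = algebraMap B (FractionRing B) (μ a) :=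
    fun a => IsFractionRing.lift_algebraMap hinj a
  have hne : ∀ c : A, c ≠ 0 → algebraMap A (FractionRing A) c ≠ 0 := fun c hc h0 =>
    hc (IsFractionRing.injective A (FractionRing A) (by rw [h0, map_zero]))
  have hex : ∀ b, ∃ k, l k = algebraMap B (FractionRing B) b := by
    intro b
    obtain ⟨c, a, hc, hac⟩ := h b
    refine ⟨algebraMap A (FractionRing A) a / algebraMap A (FractionRing A) c, ?_⟩
    have hc' := (map_ne_zero l).2 (hne c hc)
    rw [map_div₀, div_eq_iff hc', hl, hl, hac, map_mul, mul_comm]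
  choose k hk using hex
  let j : B →ₐ[ℂ] FractionRing A :=
    { toFun := k
      map_one' := l.injective (by rw [hk, map_one, map_one])
      map_zero' := l.injective (by rw [hk, map_zero, map_zero])
      map_mul' := fun a b => l.injective (by rw [hk, map_mul, map_mul, hk, hk])
      map_add' := fun a b => l.injective (by rw [hk, map_add, map_add, hk, hk])
      commutes' := fun c => l.injective (by
        rw [hk, IsScalarTower.algebraMap_apply ℂ A (FractionRing A), hl, AlgHom.commutes]) }
  have hj : ∀ b, l (j b) = algebraMap B (FractionRing B) b := hk
  refine ⟨j, fun r => l.injective (by rw [hj, hl]), fun j' hj' => AlgHom.ext fun b => ?_, ?_⟩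
  · obtain ⟨c, a, hc, hac⟩ := h b
    have h1 := congrArg j' hac
    have h2 : j (μ a) = j (μ c * b) := congrArg j hac
    have hjr : ∀ r, j (μ r) = algebraMap A (FractionRing A) r := fun r =>
      l.injective (by rw [hj, hl])
    rw [map_mul, hj', hj'] at h1
    rw [map_mul, hjr, hjr] at h2
    exact mul_left_cancel₀ (hne c hc) (h1.symm.trans h2)
  · intro a b hab
    apply IsFractionRing.injective B (FractionRing B)
    rw [← hj, ← hj, hab]

end FractionRings

namespace Data

variable {n : ℕ} {V : Type*} [AddCommGroup V] [Module ℂ V] (D : Data n V) [FiniteDimensional ℂ V]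

/-! ### `ℂ[Sp(V) × Σ]` consists of fractions over `ℂ[𝔐]` -/

section Denominators

/-- The functions on `Sp(V) × Σ` which are quotients of pullbacks of functions on `𝔐`. -/
def IsFraction (G : D.Sp × D.Slice → ℂ) : Prop :=
  ∃ c a : D.CoordM, c ≠ 0 ∧ ∀ q, (D.orbitHom a).1 q = (D.orbitHom c).1 q * G q

theorem orbitHom_add_apply (a b : D.CoordM) (q : D.Sp × D.Slice) :
    (D.orbitHom (a + b)).1 q = (D.orbitHom a).1 q + (D.orbitHom b).1 q := by
  rw [map_add]; rfl

theorem orbitHom_mul_apply (a b : D.CoordM) (q : D.Sp × D.Slice) :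
    (D.orbitHom (a * b)).1 q = (D.orbitHom a).1 q * (D.orbitHom b).1 q := by
  rw [map_mul]; rfl

theorem IsFraction.add {D : Data n V} {G H : D.Sp × D.Slice → ℂ} (hG : D.IsFraction G)
    (hH : D.IsFraction H) : D.IsFraction fun q => G q + H q := by
  obtain ⟨c, a, hc, ha⟩ := hG
  obtain ⟨d, b, hd, hb⟩ := hH
  refine ⟨c * d, a * d + b * c, mul_ne_zero hc hd, fun q => ?_⟩
  rw [D.orbitHom_add_apply, D.orbitHom_mul_apply, D.orbitHom_mul_apply, D.orbitHom_mul_apply, ha,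
    hb]
  ring

theorem IsFraction.mul {D : Data n V} {G H : D.Sp × D.Slice → ℂ} (hG : D.IsFraction G)
    (hH : D.IsFraction H) : D.IsFraction fun q => G q * H q := by
  obtain ⟨c, a, hc, ha⟩ := hG
  obtain ⟨d, b, hd, hb⟩ := hH
  refine ⟨c * d, a * b, mul_ne_zero hc hd, fun q => ?_⟩
  rw [D.orbitHom_mul_apply, D.orbitHom_mul_apply, ha, hb]
  ring

theorem IsFraction.of_apply {D : Data n V} {G : D.Sp × D.Slice → ℂ} (a : D.CoordM)
    (h : ∀ q, (D.orbitHom a).1 q = G q) : D.IsFraction G :=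
  ⟨1, a, one_ne_zero, fun q => by
    rw [h, map_one]
    exact (one_mul _).symm⟩

theorem isFraction_const (c : ℂ) : D.IsFraction fun _ => c :=
  IsFraction.of_apply (algebraMap ℂ D.CoordM c) fun q => by
    rw [AlgHom.commutes]; rfl

theorem IsFraction.sum {D : Data n V} {ι : Type*} (t : Finset ι) {G : ι → D.Sp × D.Slice → ℂ}
    (h : ∀ i ∈ t, D.IsFraction (G i)) : D.IsFraction fun q => ∑ i ∈ t, G i q := by
  classical
  induction t using Finset.induction_on with
  | empty => simpa using D.isFraction_const 0
  | insert i t hi ih =>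
    simp only [Finset.sum_insert hi]
    exact (h i (Finset.mem_insert_self i t)).add
      (ih fun k hk => h k (Finset.mem_insert_of_mem hk))

/-- Functions on the pseudo-slice extend to invariant functions. -/
theorem exists_extension {G : D.sp × V → ℂ} (hG : G ∈ polyFun (D.sp × V)) :
    ∃ a : D.CoordM, ∀ (g : D.Sp) (s : D.Slice), (D.orbitHom a).1 (g, s) = G s.1 := by
  obtain ⟨t, ht⟩ := D.sliceHom_comp_quotHom_bijective.2 ⟨fun s => G s.1, G, hG, rfl⟩
  refine ⟨D.quotHom t, fun g s => ?_⟩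
  rw [D.orbitHom_of_mem_invM (D.quotHom_range ▸ ⟨t, rfl⟩)]
  exact congrFun (congrArg Subtype.val ht) s

/-- The matrix of the iterates of the vector in a pair. -/
noncomputable def iterates (p : D.sp × V) : Matrix (Fin (2 * n)) (Fin (2 * n)) ℂ :=
  D.basis.toMatrix fun i : Fin (2 * n) => ((p.1 : Module.End ℂ V) ^ (i : ℕ)) p.2

theorem det_iterates (p : D.sp × V) :
    (D.iterates p).det = cyclicDet D.basis (p.1 : Module.End ℂ V) p.2 :=
  (D.basis.det_apply _).symm

theorem iterates_mem_polyFun (i k : Fin (2 * n)) :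
    (fun p => D.iterates p i k) ∈ polyFun (D.sp × V) :=
  (D.isPolyMap_fst_coe.pow k).apply D.isPolyMap_snd (D.basis.coord i)

/-- The coordinates of the iterates, as elements of `ℂ[sp(V) ⊕ V]`. -/
noncomputable def iterateCoord (i k : Fin (2 * n)) : D.CoordX :=
  ⟨fun p => D.iterates p i k, D.iterates_mem_polyFun i k⟩

theorem iterates_act (g : D.Sp) (p : D.sp × V) : D.iterates (D.act g p) =
    LinearMap.toMatrix D.basis D.basis ((g : V ≃ₗ[ℂ] V) : Module.End ℂ V) * D.iterates p := by
  have hpow : ∀ k : ℕ, ((D.Ad g p.1 : Module.End ℂ V) ^ k) ((g : V ≃ₗ[ℂ] V) p.2) =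
      (g : V ≃ₗ[ℂ] V) (((p.1 : Module.End ℂ V) ^ k) p.2) := by
    intro k
    induction k with
    | zero => rfl
    | succ k ih =>
      rw [pow_succ', Module.End.mul_apply, ih, pow_succ', Module.End.mul_apply, Ad_coe,
        LinearEquiv.conj_apply_apply, LinearEquiv.symm_apply_apply]
  ext i k
  have h := congrFun (LinearMap.toMatrix_mulVec_repr D.basis D.basis
    ((g : V ≃ₗ[ℂ] V) : Module.End ℂ V) (((p.1 : Module.End ℂ V) ^ (k : ℕ)) p.2)) i
  change D.basis.repr (((D.Ad g p.1 : Module.End ℂ V) ^ (k : ℕ)) ((g : V ≃ₗ[ℂ] V) p.2)) i = _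
  rw [hpow]
  exact h.symm

/-- The iterates of the vector in `g · s` are the images under `g` of those in `s`. By Cramer's rule
the matrix of `g`, times the cyclic determinant at `s`, is the matrix of iterates at `g · s` times
the adjugate of that at `s`. The first factor comes from `ℂ[sp(V) ⊕ V]`; functions of `s` come from
invariants. -/
theorem isFraction_entry (i k : Fin (2 * n)) : D.IsFraction fun q =>
    LinearMap.toMatrix D.basis D.basis ((q.1 : V ≃ₗ[ℂ] V) : Module.End ℂ V) i k := by
  obtain ⟨c, hc⟩ := D.exists_extension D.cyclicDet_mem
  have hadj : ∀ j, ∃ a : D.CoordM, ∀ (g : D.Sp) (s : D.Slice), (D.orbitHom a).1 (g, s) =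
      (D.iterates s.1).adjugate j k := fun j => D.exists_extension
    (adjugate_mem_polyFun (A := D.iterates) D.iterates_mem_polyFun j k)
  choose a ha using hadj
  refine ⟨c, ∑ j, (D.iterateCoord i j ⊗ₜ[D.InvSp] (1 : D.InvGl)) *
    a j, ?_, ?_⟩
  · rintro rfl
    obtain ⟨p, hp⟩ := D.exists_cyclicDet_ne_zero
    obtain ⟨g, s, rfl⟩ := D.exists_act_slice_of_cyclic ((isCyclic_iff_cyclicDet D.basis).2 hp)
    rw [← D.det_iterates, D.iterates_act, Matrix.det_mul, D.det_iterates] at hp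
    refine right_ne_zero_of_mul hp ((hc g s).symm.trans ?_)
    rw [map_zero]
    rfl
  · rintro ⟨g, s⟩
    have h1 : ∀ t : Finset (Fin (2 * n)), (D.orbitHom (∑ j ∈ t,
        (D.iterateCoord i j ⊗ₜ[D.InvSp] (1 : D.InvGl)) * a j)).1
          (g, s) = ∑ j ∈ t, D.iterates (D.act g s.1) i j * (D.iterates s.1).adjugate j k := by
      intro t
      induction t using Finset.induction_on with
      | empty => rw [Finset.sum_empty, Finset.sum_empty, map_zero]; rfl
      | insert j t hj ih =>
        rw [Finset.sum_insert hj, Finset.sum_insert hj, D.orbitHom_add_apply,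
          D.orbitHom_mul_apply, ih, ha, D.orbitHom_tmul]
        congr 2
        exact mul_one _
    rw [h1, hc, ← D.det_iterates]
    have h2 : D.iterates (D.act g s.1) * (D.iterates s.1).adjugate =
        (D.iterates s.1).det •
          LinearMap.toMatrix D.basis D.basis ((g : V ≃ₗ[ℂ] V) : Module.End ℂ V) := by
      rw [D.iterates_act, mul_assoc, Matrix.mul_adjugate, mul_smul_comm, mul_one]
    exact congrFun (congrFun h2 i) k

theorem isFraction_linear (ξ : Module.Dual ℂ (Module.End ℂ V)) :
    D.IsFraction fun q => ξ ((q.1 : V ≃ₗ[ℂ] V) : Module.End ℂ V) := by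
  have h : (fun q : D.Sp × D.Slice => ξ ((q.1 : V ≃ₗ[ℂ] V) : Module.End ℂ V)) = fun q =>
      ∑ i, ∑ k, LinearMap.toMatrix D.basis D.basis ((q.1 : V ≃ₗ[ℂ] V) : Module.End ℂ V) i k *
        ξ ((LinearMap.toMatrix D.basis D.basis).symm (Matrix.single i k 1)) := by
    funext q
    set T : Module.End ℂ V := ((q.1 : V ≃ₗ[ℂ] V) : Module.End ℂ V)
    have h1 : T = ∑ i, ∑ k, LinearMap.toMatrix D.basis D.basis T i k •
        (LinearMap.toMatrix D.basis D.basis).symm (Matrix.single i k 1) := by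
      apply (LinearMap.toMatrix D.basis D.basis).injective
      conv_lhs => rw [Matrix.matrix_eq_sum_single (LinearMap.toMatrix D.basis D.basis T)]
      simp only [map_sum, map_smul, LinearEquiv.apply_symm_apply, Matrix.smul_single, smul_eq_mul,
        mul_one]
    conv_lhs => rw [h1]
    simp only [map_sum, map_smul, smul_eq_mul]
  rw [h]
  exact IsFraction.sum _ fun i _ => IsFraction.sum _ fun k _ =>
    (D.isFraction_entry i k).mul (D.isFraction_const _)

theorem exists_denominator (b : D.CoordSpSlice) :
    ∃ c a : D.CoordM, c ≠ 0 ∧ D.orbitHom a = D.orbitHom c * b := by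
  obtain ⟨_, G, hG, rfl⟩ := b
  suffices h : D.IsFraction fun q =>
      G (((q.1 : V ≃ₗ[ℂ] V) : Module.End ℂ V), (q.2 : D.sp × V)) by
    obtain ⟨c, a, hc, ha⟩ := h
    exact ⟨c, a, hc, Subtype.ext (funext ha)⟩
  induction hG using Algebra.adjoin_induction with
  | mem G hG =>
    obtain ⟨ξ, rfl⟩ := hG
    obtain ⟨a, ha⟩ := D.exists_extension
      (dual_mem_polyFun (ξ ∘ₗ LinearMap.inr ℂ (Module.End ℂ V) (D.sp × V)))
    have h1 : D.IsFraction fun q =>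
        (ξ ∘ₗ LinearMap.inr ℂ (Module.End ℂ V) (D.sp × V)) q.2.1 :=
      IsFraction.of_apply a fun q => ha q.1 q.2
    have h2 := (D.isFraction_linear (ξ ∘ₗ LinearMap.inl ℂ (Module.End ℂ V) (D.sp × V))).add h1
    convert h2 using 2 with q
    simp only [LinearMap.comp_apply, LinearMap.inl_apply, LinearMap.inr_apply, ← map_add,
      Prod.mk_add_mk, add_zero, zero_add]
  | algebraMap c => exact D.isFraction_const c
  | add G H _ _ hG hH => exact hG.add hH
  | mul G H _ _ hG hH => exact hG.mul hH

end Denominators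

/-! ### Reduction of the fibre product to primes of `ℂ[sp(V) ⊕ V]` -/

section FibreProduct

theorem tmul_one_injective : Function.Injective fun F : D.CoordX => F ⊗ₜ[D.InvSp] (1 : D.InvGl) := by
  intro F G h
  rw [← sub_eq_zero]
  refine Subtype.ext (funext fun p => ?_)
  refine D.eq_zero_of_cyclic (F - G).2 (fun p hp => ?_) p
  obtain ⟨g, s, rfl⟩ := D.exists_act_slice_of_cyclic hp
  have h1 := congrArg (fun r => (D.orbitHom r).1 (g, s)) h
  simp only [orbitHom_tmul] at h1
  have h2 : (1 : D.InvGl).1 (D.toGl s.1) = 1 := rfl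
  rw [h2, mul_one, mul_one] at h1
  exact sub_eq_zero.2 h1

theorem orbitHom_tmul_one (F : D.CoordX) (g : D.Sp) (s : D.Slice) :
    (D.orbitHom (F ⊗ₜ[D.InvSp] (1 : D.InvGl))).1 (g, s) = F.1 (D.act g s.1) := by
  rw [D.orbitHom_tmul]
  exact mul_one _

/-- A rational function whose denominator has a prime factor with zeros on the orbits of the
pseudo-slice outside of the zeros of the numerator is not regular on the orbits. -/
theorem exists_unique_of_prime (hprime : ∀ {π a : D.CoordX}, Prime π → ¬ π ∣ a →
      ∃ (g : D.Sp) (s : D.Slice), π.1 (D.act g s.1) = 0 ∧ a.1 (D.act g s.1) ≠ 0)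
    {j : D.CoordSpSlice →ₐ[ℂ] FractionRing D.CoordM}
    {i : FractionRing D.CoordX →ₐ[ℂ] FractionRing D.CoordM}
    (hj : ∀ r, j (D.orbitHom r) = algebraMap D.CoordM (FractionRing D.CoordM) r)
    (hinj : Function.Injective j)
    (hi : ∀ F, i (algebraMap D.CoordX (FractionRing D.CoordX) F) =
      algebraMap D.CoordM (FractionRing D.CoordM) (F ⊗ₜ[D.InvSp] (1 : D.InvGl)))
    {b : D.CoordSpSlice} {k : FractionRing D.CoordX} (hbk : j b = i k) :
    ∃! F : D.CoordX, D.orbitHom (F ⊗ₜ[D.InvSp] (1 : D.InvGl)) = b ∧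
      algebraMap D.CoordX (FractionRing D.CoordX) F = k := by
  refine existsUnique_of_exists_of_unique ?_ fun F G hF hG =>
    IsFractionRing.injective D.CoordX (FractionRing D.CoordX) (hF.2.trans hG.2.symm)
  suffices h : ∃ F, algebraMap D.CoordX (FractionRing D.CoordX) F = k by
    obtain ⟨F, hF⟩ := h
    refine ⟨F, hinj ?_, hF⟩
    rw [hj, hbk, ← hF, hi]
  -- On `Sp(V) × Σ` the relation `b c = a` holds. At a point given by `hprime` for a prime factor of
  -- `c`, the left side vanishes and the right side does not, so the reduced denominator `c` is a
  -- unit.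
  obtain ⟨a, c, hred, hk⟩ := IsFractionRing.exists_reduced_fraction D.CoordX k
  have hc0 : (c : D.CoordX) ≠ 0 := nonZeroDivisors.ne_zero c.2
  have hkc : k * algebraMap D.CoordX (FractionRing D.CoordX) c =
      algebraMap D.CoordX (FractionRing D.CoordX) a := by
    rw [← hk, IsLocalization.mk'_spec]
  have hbc : b * D.orbitHom ((c : D.CoordX) ⊗ₜ[D.InvSp] (1 : D.InvGl)) = D.orbitHom (a ⊗ₜ[D.InvSp] (1 : D.InvGl)) := by
    apply hinj
    rw [map_mul, hj, hj, hbk, ← hi, ← hi, ← map_mul, hkc]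
  have hunit : IsUnit (c : D.CoordX) := by
    by_contra hcu
    obtain ⟨π, hπ, hπc⟩ := WfDvdMonoid.exists_irreducible_factor hcu hc0
    have hπa : ¬ π ∣ a := fun h => hπ.not_isUnit (hred h hπc)
    obtain ⟨g, s, h1, h2⟩ := hprime hπ.prime hπa
    apply h2
    have h3 : b.1 (g, s) * (D.orbitHom ((c : D.CoordX) ⊗ₜ[D.InvSp] (1 : D.InvGl))).1 (g, s) =
        (D.orbitHom (a ⊗ₜ[D.InvSp] (1 : D.InvGl))).1 (g, s) := congrFun (congrArg Subtype.val hbc) (g, s)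
    rw [D.orbitHom_tmul_one, D.orbitHom_tmul_one] at h3
    obtain ⟨d, hd⟩ := hπc
    have h4 : (c : D.CoordX).1 (D.act g s.1) = π.1 (D.act g s.1) * d.1 (D.act g s.1) :=
      congrFun (congrArg Subtype.val hd) _
    rw [← h3, h4, h1, zero_mul, mul_zero]
  obtain ⟨u, hu⟩ := hunit
  refine ⟨a * ↑u⁻¹, ?_⟩
  have hne : algebraMap D.CoordX (FractionRing D.CoordX) c ≠ 0 := fun h0 =>
    hc0 (IsFractionRing.injective D.CoordX (FractionRing D.CoordX) (by rw [h0, map_zero]))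
  apply mul_right_cancel₀ hne
  rw [hkc, ← map_mul, mul_assoc, ← hu, Units.inv_mul, mul_one]

/-- The pullback of rational functions. -/
theorem exists_fractionRing_hom : ∃ i : FractionRing D.CoordX →ₐ[ℂ] FractionRing D.CoordM,
    ∀ F, i (algebraMap D.CoordX (FractionRing D.CoordX) F) =
      algebraMap D.CoordM (FractionRing D.CoordM) (F ⊗ₜ[D.InvSp] (1 : D.InvGl)) := by
  let ψ : D.CoordX →ₐ[ℂ] FractionRing D.CoordM :=
    (IsScalarTower.toAlgHom ℂ D.CoordM (FractionRing D.CoordM)).comp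
      (Algebra.TensorProduct.includeLeft : D.CoordX →ₐ[ℂ] D.CoordM)
  have hψ : Function.Injective ψ :=
    (IsFractionRing.injective D.CoordM (FractionRing D.CoordM)).comp D.tmul_one_injective
  refine ⟨IsFractionRing.liftAlgHom hψ, fun F => ?_⟩
  rw [IsFractionRing.liftAlgHom_apply]
  exact IsFractionRing.lift_algebraMap hψ F

end FibreProduct

end Data

end PseudoSlice

namespace PseudoSlice

/-! ### Eigenbases and coordinate hyperplanes -/

section Eigenbases

open Polynomial

variable {U : Type*} [AddCommGroup U] [Module ℂ U] {ι : Type*} [Fintype ι]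

theorem exists_eigenbasis [FiniteDimensional ℂ U] (T : Module.End ℂ U) {t : ι → ℂ}
    (ht : Function.Injective t) (hroot : ∀ k, T.charpoly.eval (t k) = 0)
    (hcard : Fintype.card ι = Module.finrank ℂ U) :
    ∃ b : Module.Basis ι ℂ U, ∀ k, T (b k) = t k • b k := by
  classical
  have hev : ∀ k, ∃ u, T.HasEigenvector (t k) u := fun k =>
    ((Module.End.hasEigenvalue_iff_isRoot_charpoly T (t k)).2 (hroot k)).exists_hasEigenvector
  choose u hu using hev
  have hli := Module.End.eigenvectors_linearIndependent' T t ht u hu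
  rcases isEmpty_or_nonempty ι with hι | hι
  · have : Subsingleton U := Module.finrank_zero_iff.1 (by rw [← hcard, Fintype.card_eq_zero])
    exact ⟨Module.Basis.empty U, fun k => (hι.false k).elim⟩
  · refine ⟨basisOfLinearIndependentOfCardEqFinrank hli hcard, fun k => ?_⟩
    rw [coe_basisOfLinearIndependentOfCardEqFinrank]
    exact (hu k).apply_eq_smul

variable {T : Module.End ℂ U} {t : ι → ℂ} {b : Module.Basis ι ℂ U}

theorem aeval_eigenvector {u : U} {c : ℂ} (hu : T u = c • u) (f : ℂ[X]) :
    aeval T f u = f.eval c • u := by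
  induction f using Polynomial.induction_on' with
  | add f g hf hg => simp [hf, hg, add_smul]
  | monomial k a =>
    have hk : (T ^ k) u = c ^ k • u := by
      induction k with
      | zero => simp
      | succ k ih => rw [pow_succ', Module.End.mul_apply, ih, map_smul, hu, smul_smul, pow_succ]
    rw [aeval_monomial, Module.End.mul_apply, hk, Module.algebraMap_end_apply, eval_monomial,
      smul_smul]

theorem aeval_eigenbasis (hb : ∀ k, T (b k) = t k • b k) (f : ℂ[X]) (w : U) :
    aeval T f w = ∑ k, (f.eval (t k) * b.repr w k) • b k := by
  conv_lhs => rw [← b.sum_repr w]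
  rw [map_sum]
  refine Finset.sum_congr rfl fun k _ => ?_
  rw [map_smul, aeval_eigenvector (hb k), smul_smul, mul_comm]

theorem exists_eval_eq (ht : Function.Injective t) (c : ι → ℂ) :
    ∃ f : ℂ[X], ∀ k, f.eval (t k) = c k := by
  classical
  exact ⟨Lagrange.interpolate Finset.univ t c, fun k =>
    Lagrange.eval_interpolate_at_node c ht.injOn (Finset.mem_univ k)⟩

theorem isCyclic_of_eigenbasis (ht : Function.Injective t) (hb : ∀ k, T (b k) = t k • b k) {w : U}
    (hw : ∀ k, b.repr w k ≠ 0) : IsCyclic T w := by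
  intro u
  obtain ⟨f, hf⟩ := exists_eval_eq ht fun k => b.repr u k / b.repr w k
  refine ⟨f, ?_⟩
  rw [aeval_eigenbasis hb]
  conv_rhs => rw [← b.sum_repr u]
  refine Finset.sum_congr rfl fun k _ => ?_
  rw [hf, div_mul_cancel₀ _ (hw k)]

/-- A coordinate function, as a polynomial function. -/
noncomputable def coordFun (b : Module.Basis ι ℂ U) (k : ι) : polyFun U :=
  ⟨b.coord k, dual_mem_polyFun _⟩

theorem coordFun_prime (b : Module.Basis ι ℂ U) (k : ι) : Prime (coordFun b k) := by
  have h : mvPolynomialEquiv b (MvPolynomial.X k) = coordFun b k := by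
    change ofMvPolynomial b (MvPolynomial.X k) = _
    rw [ofMvPolynomial, MvPolynomial.aeval_X]
    rfl
  rw [← h]
  exact (MulEquiv.prime_iff (mvPolynomialEquiv b)).2 MvPolynomial.X_prime

/-- If a polynomial function vanishes only on a union of coordinate hyperplanes, then it vanishes
on one of these hyperplanes through any given zero. -/
theorem exists_coord_vanish [FiniteDimensional ℂ U] (b : Module.Basis ι ℂ U) {F : polyFun U}
    (hF : ∀ w, (∀ k, b.repr w k ≠ 0) → F.1 w ≠ 0) {w : U} (hw : F.1 w = 0) :
    ∃ k, b.repr w k = 0 ∧ ∀ u, b.repr u k = 0 → F.1 u = 0 := by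
  -- Some prime factor of `F` vanishes at `w`, by induction over a factorization into primes.
  have hmain : ∀ G : polyFun U, G ∣ F → G ≠ 0 → G.1 w = 0 →
      ∃ π : polyFun U, Prime π ∧ π ∣ F ∧ π.1 w = 0 := by
    intro G
    induction G using UniqueFactorizationMonoid.induction_on_prime with
    | h₁ => exact fun _ h => (h rfl).elim
    | h₂ x hx =>
      intro _ _ h
      obtain ⟨y, hy⟩ := hx.exists_right_inv
      have : x.1 w * y.1 w = 1 := congrFun (congrArg Subtype.val hy) w
      rw [h, zero_mul] at this
      exact (zero_ne_one this).elim
    | h₃ a π ha hπ ih =>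
      intro hdvd _ h
      have h1 : π.1 w * a.1 w = 0 := h
      rcases mul_eq_zero.1 h1 with h2 | h2
      · exact ⟨π, hπ, (dvd_mul_right π a).trans hdvd, h2⟩
      · exact ih ((dvd_mul_left a π).trans hdvd) ha h2
  have hF0 : F ≠ 0 := by
    rintro rfl
    refine hF (∑ k, b k) (fun k => ?_) rfl
    rw [map_sum, Finsupp.finsetSum_apply, Finset.sum_eq_single k]
    · simp
    · intro i _ hik
      simp [hik]
    · exact fun h => (h (Finset.mem_univ k)).elim
  obtain ⟨π, hπ, ⟨G, hG⟩, hπw⟩ := hmain F dvd_rfl hF0 hw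
  -- The zeros of `π` lie in the union of the coordinate hyperplanes, so `π` divides the product of
  -- the coordinates and is associated to one of them.
  have hdvd : π ∣ ∏ k, coordFun b k := by
    refine prime_dvd_of_vanish hπ fun u hu => ?_
    have hFu : F.1 u = 0 := by
      have : F.1 u = π.1 u * G.1 u := congrFun (congrArg Subtype.val hG) u
      rw [this, hu, zero_mul]
    obtain ⟨k, hk⟩ : ∃ k, b.repr u k = 0 := by
      by_contra! h
      exact hF u h hFu
    change evalAt u (∏ k, coordFun b k) = 0
    rw [map_prod]
    exact Finset.prod_eq_zero (Finset.mem_univ k) hk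
  obtain ⟨k, -, hk⟩ := hπ.exists_mem_finset_dvd hdvd
  obtain ⟨A, hA⟩ := hk
  obtain ⟨B, hB⟩ := hπ.irreducible.dvd_symm (coordFun_prime b k).irreducible ⟨A, hA⟩
  refine ⟨k, ?_, fun u hu => ?_⟩
  · have : b.repr w k = π.1 w * A.1 w := congrFun (congrArg Subtype.val hA) w
    rw [this, hπw, zero_mul]
  · have h1 : F.1 u = π.1 u * G.1 u := congrFun (congrArg Subtype.val hG) u
    have h2 : π.1 u = b.repr u k * B.1 u := congrFun (congrArg Subtype.val hB) u
    rw [h1, h2, hu, zero_mul, zero_mul]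

end Eigenbases

namespace Data

open Polynomial

variable {n : ℕ} {V : Type*} [AddCommGroup V] [Module ℂ V] (D : Data n V)

/-! ### Pairs with `x` regular semisimple -/

section SymplecticEigenbases

variable {ι : Type*} [Fintype ι] [DecidableEq ι] {t : ι → ℂ} {σ : ι → ι}
  {x : D.sp} {b : Module.Basis ι ℂ V}

theorem form_eigenvectors {u w : V} {c d : ℂ} (hu : (x : Module.End ℂ V) u = c • u)
    (hw : (x : Module.End ℂ V) w = d • w) (hcd : c + d ≠ 0) : D.ω u w = 0 := by
  have h := D.form_apply x u w
  rw [hu, hw, map_smul, map_smul, LinearMap.smul_apply, smul_eq_mul, smul_eq_mul] at h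
  have h2 : (c + d) * D.ω u w = 0 := by linear_combination h
  exact (mul_eq_zero.1 h2).resolve_left hcd

/-- As `x` is skew, eigenvectors pair to zero unless their eigenvalues are opposite; `σ` is the
involution of the indices that negates the eigenvalue. -/
theorem form_eigenbasis (ht : Function.Injective t) (hσ : ∀ k, t (σ k) = -t k)
    (hb : ∀ k, (x : Module.End ℂ V) (b k) = t k • b k) (k : ι) (w : V) :
    D.ω (b k) w = D.ω (b k) (b (σ k)) * b.repr w (σ k) := by
  conv_lhs => rw [← b.sum_repr w]
  rw [map_sum, Finset.sum_eq_single (σ k)]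
  · rw [map_smul, smul_eq_mul, mul_comm]
  · intro l _ hl
    rw [map_smul, D.form_eigenvectors (hb k) (hb l), smul_zero]
    intro h
    refine hl (ht ?_)
    rw [hσ]
    linear_combination h
  · exact fun h => (h (Finset.mem_univ _)).elim

theorem form_eigenbasis_ne_zero (ht : Function.Injective t) (hσ : ∀ k, t (σ k) = -t k)
    (hb : ∀ k, (x : Module.End ℂ V) (b k) = t k • b k) (k : ι) : D.ω (b k) (b (σ k)) ≠ 0 := by
  intro h
  apply b.ne_zero k
  apply D.nondeg.1
  intro w
  rw [D.form_eigenbasis ht hσ hb, h, zero_mul]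

theorem form_aeval_eigenbasis (ht : Function.Injective t) (hσ : ∀ k, t (σ k) = -t k)
    (hb : ∀ k, (x : Module.End ℂ V) (b k) = t k • b k) (f : ℂ[X]) (v : V) :
    D.ω v (aeval (x : Module.End ℂ V) f v) =
      ∑ k, f.eval (t k) * (b.repr v k * b.repr v (σ k) * D.ω (b (σ k)) (b k)) := by
  rw [aeval_eigenbasis hb, map_sum]
  refine Finset.sum_congr rfl fun k _ => ?_
  rw [map_smul, smul_eq_mul, D.form_swap v, D.form_eigenbasis ht hσ hb, D.form_swap (b k)]
  ring

variable {p p' : D.sp × V} {b' : Module.Basis ι ℂ V}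

/-- A rescaling between eigenbases automatically intertwines the operators; the two conditions on
`c` say that it matches the vectors and preserves the form. -/
theorem exists_act_eq_of_eigenbasis (ht : Function.Injective t) (hσ : ∀ k, t (σ k) = -t k)
    (hb : ∀ k, (p.1 : Module.End ℂ V) (b k) = t k • b k)
    (hb' : ∀ k, (p'.1 : Module.End ℂ V) (b' k) = t k • b' k) (c : ι → ℂ)
    (hc : ∀ k, c k * b.repr p.2 k = b'.repr p'.2 k)
    (hcσ : ∀ k, c k * c (σ k) * D.ω (b' k) (b' (σ k)) = D.ω (b k) (b (σ k))) :
    ∃ g : D.Sp, D.act g p = p' := by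
  have hc0 : ∀ k, c k ≠ 0 := by
    intro k h
    apply D.form_eigenbasis_ne_zero ht hσ hb k
    rw [← hcσ, h, zero_mul, zero_mul]
  let G : V ≃ₗ[ℂ] V := b.equiv (b'.unitsSMul fun k => Units.mk0 (c k) (hc0 k)) (Equiv.refl ι)
  have hG : ∀ k, G (b k) = c k • b' k := by
    intro k
    simp only [G, Module.Basis.equiv_apply, Equiv.refl_apply, Module.Basis.unitsSMul_apply]
    rfl
  have hform : ∀ u w, D.ω (G u) (G w) = D.ω u w := by
    have h : D.ω.compl₁₂ G.toLinearMap G.toLinearMap = D.ω := by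
      refine b.ext fun k => b.ext fun l => ?_
      change D.ω (G (b k)) (G (b l)) = D.ω (b k) (b l)
      rw [hG, hG, map_smul, map_smul, LinearMap.smul_apply, smul_eq_mul, smul_eq_mul]
      by_cases hl : l = σ k
      · rw [hl, ← hcσ]
        ring
      · have hne : t k + t l ≠ 0 := by
          intro h
          refine hl (ht ?_)
          rw [hσ]
          linear_combination h
        rw [D.form_eigenvectors (hb k) (hb l) hne, D.form_eigenvectors (hb' k) (hb' l) hne,
          mul_zero, mul_zero]
    intro u w
    exact LinearMap.congr_fun (LinearMap.congr_fun h u) w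
  refine ⟨⟨G, hform⟩, Prod.ext (Subtype.ext ?_) ?_⟩
  · change G.conj (p.1 : Module.End ℂ V) = p'.1
    have h : (G : V →ₗ[ℂ] V) ∘ₗ (p.1 : Module.End ℂ V) =
        (p'.1 : Module.End ℂ V) ∘ₗ (G : V →ₗ[ℂ] V) := by
      refine b.ext fun k => ?_
      change G ((p.1 : Module.End ℂ V) (b k)) = (p'.1 : Module.End ℂ V) (G (b k))
      rw [hb, map_smul, hG, map_smul, hb', smul_comm]
    ext u
    obtain ⟨w, rfl⟩ := G.surjective u
    rw [LinearEquiv.conj_apply_apply, LinearEquiv.symm_apply_apply]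
    exact LinearMap.congr_fun h w
  · change G p.2 = p'.2
    conv_lhs => rw [← b.sum_repr p.2]
    conv_rhs => rw [← b'.sum_repr p'.2]
    rw [map_sum]
    refine Finset.sum_congr rfl fun k _ => ?_
    rw [map_smul, hG, smul_smul, mul_comm, hc]

variable [FiniteDimensional ℂ V]

/-- A polynomial equal to `1` at one eigenvalue and `0` at the others isolates a single term of the
moments, and the moments are determined by the characteristic polynomials. -/
theorem moment_eq (ht : Function.Injective t) (hσ : ∀ k, t (σ k) = -t k)
    (hb : ∀ k, (p.1 : Module.End ℂ V) (b k) = t k • b k)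
    (hb' : ∀ k, (p'.1 : Module.End ℂ V) (b' k) = t k • b' k)
    (hp : LinearMap.charpoly (p.1 : Module.End ℂ V) = LinearMap.charpoly (p'.1 : Module.End ℂ V))
    (hr : LinearMap.charpoly (D.shift p : Module.End ℂ V) =
      LinearMap.charpoly (D.shift p' : Module.End ℂ V)) (k : ι) :
    b.repr p.2 k * b.repr p.2 (σ k) * D.ω (b (σ k)) (b k) =
      b'.repr p'.2 k * b'.repr p'.2 (σ k) * D.ω (b' (σ k)) (b' k) := by
  obtain ⟨f, hf⟩ := exists_eval_eq ht (Pi.single k 1)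
  have h : D.ω p.2 (aeval (p.1 : Module.End ℂ V) f p.2) =
      D.ω p'.2 (aeval (p'.1 : Module.End ℂ V) f p'.2) := moments_eq hp hr f
  rw [D.form_aeval_eigenbasis ht hσ hb, D.form_aeval_eigenbasis ht hσ hb'] at h
  simpa [hf, Pi.single_apply] using h

/-- A pair `(x, v)` for which exactly one eigencoordinate of `v` vanishes, as seen on the
pseudo-slice. -/
theorem exists_act_eq_of_single (ht : Function.Injective t) (hσ : ∀ k, t (σ k) = -t k)
    (hσσ : ∀ k, σ (σ k) = k) {k₀ : ι} (hσ₀ : σ k₀ ≠ k₀)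
    (hb : ∀ k, (p.1 : Module.End ℂ V) (b k) = t k • b k)
    (hb' : ∀ k, (p'.1 : Module.End ℂ V) (b' k) = t k • b' k)
    (hp : LinearMap.charpoly (p.1 : Module.End ℂ V) = LinearMap.charpoly (p'.1 : Module.End ℂ V))
    (hr : LinearMap.charpoly (D.shift p : Module.End ℂ V) =
      LinearMap.charpoly (D.shift p' : Module.End ℂ V))
    (h0 : b'.repr p'.2 k₀ = 0) (h1 : ∀ k, k ≠ k₀ → b'.repr p'.2 k ≠ 0)
    (h2 : b.repr p.2 (σ k₀) ≠ 0) : ∃ g : D.Sp, D.act g p = p' := by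
  have hm := D.moment_eq ht hσ hb hb' hp hr
  have hω := D.form_eigenbasis_ne_zero ht hσ hb
  have hω' := D.form_eigenbasis_ne_zero ht hσ hb'
  have hk₀ : b.repr p.2 k₀ = 0 := by
    have h := hm k₀
    rw [h0, zero_mul, zero_mul] at h
    have h3 := hω (σ k₀)
    rw [hσσ] at h3
    exact ((mul_eq_zero.1 h).resolve_right h3 |> mul_eq_zero.1).resolve_right h2
  have hne : ∀ k, k ≠ k₀ → b.repr p.2 k ≠ 0 := by
    intro k hk h
    by_cases hk' : k = σ k₀
    · exact h2 (hk' ▸ h)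
    have h3 := hm k
    rw [h, zero_mul, zero_mul, eq_comm] at h3
    have h4 := hω' (σ k)
    rw [hσσ] at h4
    rcases mul_eq_zero.1 ((mul_eq_zero.1 h3).resolve_right h4) with h5 | h5
    · exact h1 k hk h5
    · exact h1 (σ k) (fun h6 => hk' (by rw [← h6, hσσ])) h5
  -- Away from `k₀` the scaling is the ratio of coordinates. At `k₀` both coordinates vanish, and
  -- the scaling is forced by preservation of the form on the pair `k₀, σ k₀`.
  let c : ι → ℂ := fun k => if k = k₀ then
      D.ω (b k₀) (b (σ k₀)) * b.repr p.2 (σ k₀) / (b'.repr p'.2 (σ k₀) * D.ω (b' k₀) (b' (σ k₀)))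
    else b'.repr p'.2 k / b.repr p.2 k
  have hc₀ : c k₀ = D.ω (b k₀) (b (σ k₀)) * b.repr p.2 (σ k₀) /
      (b'.repr p'.2 (σ k₀) * D.ω (b' k₀) (b' (σ k₀))) := if_pos rfl
  have hc : ∀ k, k ≠ k₀ → c k = b'.repr p'.2 k / b.repr p.2 k := fun k hk => if_neg hk
  have hpair : c k₀ * c (σ k₀) * D.ω (b' k₀) (b' (σ k₀)) = D.ω (b k₀) (b (σ k₀)) := by
    rw [hc₀, hc _ hσ₀]
    have h3 := h1 _ hσ₀
    have h4 := hω' k₀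
    field_simp
  refine D.exists_act_eq_of_eigenbasis ht hσ hb hb' c (fun k => ?_) fun k => ?_
  · by_cases hk : k = k₀
    · rw [hk, hk₀, h0, mul_zero]
    · rw [hc k hk, div_mul_cancel₀ _ (hne k hk)]
  · by_cases hk : k = k₀
    · rw [hk, hpair]
    by_cases hk' : k = σ k₀
    · rw [hk', hσσ, mul_comm (c (σ k₀)), D.form_swap (b' (σ k₀)), D.form_swap (b (σ k₀)), mul_neg,
        hpair]
    · have hk'' : σ k ≠ k₀ := fun h6 => hk' (by rw [← h6, hσσ])
      have h3 := hne k hk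
      have h4 := hne _ hk''
      have h5 := hm k
      rw [D.form_swap (b (σ k)), D.form_swap (b' (σ k))] at h5
      rw [hc k hk, hc _ hk'']
      field_simp
      linear_combination h5

end SymplecticEigenbases

end Data

end PseudoSlice

namespace PseudoSlice

theorem IsCyclic.smul {U : Type*} [AddCommGroup U] [Module ℂ U] [FiniteDimensional ℂ U]
    {T : Module.End ℂ U} {w : U} (h : IsCyclic T w) {c : ℂ} (hc : c ≠ 0) : IsCyclic (c • T) w := by
  rw [isCyclic_iff] at h ⊢
  exact fun S hw hS => h S hw fun u hu => (S.smul_mem_iff hc).1 (hS u hu)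

namespace Data

open Polynomial

variable {n : ℕ} {V : Type*} [AddCommGroup V] [Module ℂ V] (D : Data n V)

/-! ### Eigenvectors at points of the pseudo-slice -/

section SliceEigenvectors

theorem mem_L_of_form {u : V} (h : ∀ l ∈ D.L, D.ω u l = 0) : u ∈ D.L := by
  obtain ⟨l, hl, m, hm, rfl⟩ := Submodule.mem_sup.1
    ((D.isCompl.sup_eq_top ▸ Submodule.mem_top : u ∈ D.L ⊔ D.Ls))
  have hm0 : m = 0 := by
    apply D.nondeg.1
    intro w
    obtain ⟨a, ha, b, hb, rfl⟩ := Submodule.mem_sup.1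
      ((D.isCompl.sup_eq_top ▸ Submodule.mem_top : w ∈ D.L ⊔ D.Ls))
    have h1 := h a ha
    rw [map_add, LinearMap.add_apply, D.isotropic_L l hl a ha, zero_add] at h1
    rw [map_add, h1, D.isotropic_Ls m hm b hb, add_zero]
  rw [hm0, add_zero]
  exact hl

variable [FiniteDimensional ℂ V]

/-- If `-c` is not an eigenvalue on `L`, then `-c - y` maps `L` onto itself. By skewness `u` is
orthogonal to the image, hence to `L`, which is its own orthogonal. -/
theorem eigenvector_mem_L {y : D.sp} (hy : ∀ u ∈ D.L, (y : Module.End ℂ V) u ∈ D.L) {c : ℂ}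
    (hc : (D.block (y : Module.End ℂ V)).charpoly.eval (-c) ≠ 0) {u : V}
    (hu : (y : Module.End ℂ V) u = c • u) : u ∈ D.L := by
  refine D.mem_L_of_form fun l hl => ?_
  rw [LinearMap.eval_charpoly] at hc
  obtain ⟨k, hk⟩ := (LinearMap.equivOfDetNeZero _ hc).surjective ⟨l, hl⟩
  have hblock : (D.block (y : Module.End ℂ V) k : V) = (y : Module.End ℂ V) k :=
    congrArg Subtype.val (D.prL_coe ⟨_, hy k k.2⟩)
  have h1 : (-c) • (k : V) - (y : Module.End ℂ V) k = l := by
    rw [← hblock]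
    exact congrArg Subtype.val hk
  have h2 := D.form_apply y u k
  rw [hu, map_smul, LinearMap.smul_apply, smul_eq_mul] at h2
  rw [← h1, map_sub, map_smul, smul_eq_mul]
  linear_combination -h2

/-- On `L` the pairing with `v` is `n²` times the coordinate of index `n`. If that vanishes, the
Hessenberg shape of `x` expresses each further coordinate of the eigenvector through the preceding
ones, so all vanish. -/
theorem form_slice_eigenvector_ne_zero (s : D.Slice) {u : V} (hu : u ∈ D.L) (hu0 : u ≠ 0) {c : ℂ}
    (h : (s.1.1 : Module.End ℂ V) u = c • u) : D.ω s.1.2 u ≠ 0 := by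
  have hn := D.one_le
  rw [D.form_slice s hu]
  intro h0
  have hcoord : D.coord n u = 0 := (mul_eq_zero.1 h0).resolve_left
    (pow_ne_zero 2 (Nat.cast_ne_zero.2 (by lia)))
  obtain ⟨z, hz⟩ := (D.mem_kostantSlice_iff _).1 s.2.1
  apply hu0
  refine D.ext_coord fun k hk => ?_
  rw [map_zero]
  induction k using Nat.strong_induction_on with
  | _ k ih =>
  rcases lt_trichotomy k n with hlt | rfl | hgt
  · exact (D.mem_L_iff u).1 hu k hlt
  · exact hcoord
  · obtain ⟨m, rfl⟩ : ∃ m, k = m + 1 := ⟨k - 1, by lia⟩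
    have h1 := D.coord_kostantPoint z m u
    rw [hz, h, map_smul, ih m (by lia) (by lia), smul_zero, Finset.sum_eq_zero, add_zero,
      eq_comm] at h1
    · refine (mul_eq_zero.1 h1).resolve_left (mul_ne_zero ?_ ?_)
      · exact_mod_cast Nat.succ_ne_zero m
      · intro h2
        have h3 : (2 * n : ℂ) = ((1 + m : ℕ) : ℂ) := by
          push_cast
          linear_combination h2
        have h4 : 2 * n = 1 + m := by exact_mod_cast h3
        lia
    · intro j _
      split_ifs
      · rw [ih _ (by lia) (by lia), mul_zero]
      · exact mul_zero _

/-- A zero coordinate of index `σ k` makes `v` orthogonal to `b k`, so `b k` is also an eigenvector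
of `x - v²`. The condition on the spectrum on `L` puts `b k` in `L`, where orthogonality to `v` is
impossible for an eigenvector of `x`. -/
theorem repr_slice_ne_zero (s : D.Slice) {ι : Type*} [Fintype ι] [DecidableEq ι] {t : ι → ℂ}
    {σ : ι → ι} {b : Module.Basis ι ℂ V} (ht : Function.Injective t) (hσ : ∀ k, t (σ k) = -t k)
    (hb : ∀ k, (s.1.1 : Module.End ℂ V) (b k) = t k • b k) {k : ι}
    (hq : (D.toGl s.1).charpoly.eval (-t k) ≠ 0) : b.repr s.1.2 (σ k) ≠ 0 := by
  intro h0
  have h1 : D.ω s.1.2 (b k) = 0 := by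
    rw [D.form_swap, D.form_eigenbasis ht hσ hb, h0, mul_zero, neg_zero]
  have h2 : (D.shift s.1 : Module.End ℂ V) (b k) = t k • b k := by
    rw [D.shift_apply, h1, zero_smul, sub_zero, hb]
  have h3 : b k ∈ D.L := D.eigenvector_mem_L (fun u hu => D.shift_mem_L s hu) hq h2
  exact D.form_slice_eigenvector_ne_zero s h3 (b.ne_zero k) (hb k) h1

end SliceEigenvectors

/-! ### Zeros of primes on the orbits of the pseudo-slice -/

section PrimeDivisors

variable [FiniteDimensional ℂ V]

/-- The function detecting cyclic vectors, as an element of `ℂ[sp(V) ⊕ V]`. -/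
noncomputable def cyclicFun : D.CoordX := ⟨_, D.cyclicDet_mem⟩

/-- The function detecting separable characteristic polynomials, as an element of
`ℂ[sp(V) ⊕ V]`. -/
noncomputable def discFun : D.CoordX :=
  ⟨fun p => disc (p.1 : Module.End ℂ V), disc_mem_polyFun D.isPolyMap_fst_coe⟩

theorem coordX_prime_dvd {π F : D.CoordX} (hπ : Prime π) (h : ∀ p, π.1 p = 0 → F.1 p = 0) :
    π ∣ F := prime_dvd_of_vanish (W := D.sp × V) hπ h

theorem coordX_apply_ne_zero {π F : D.CoordX} (h : π ∣ F) {p : D.sp × V} (hp : F.1 p ≠ 0) :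
    π.1 p ≠ 0 := by
  obtain ⟨G, rfl⟩ := h
  intro h0
  apply hp
  change π.1 p * G.1 p = 0
  rw [h0, zero_mul]

/-- A nonzero element of the plane spanned by `e` and `f` is a multiple of `f` or of a point of the
Kostant slice; both have cyclic vectors. The plane serves to show that a function without zeros at
such elements is also nonzero at the origin. -/
theorem isCyclic_e_f {a c : ℂ} (hac : a ≠ 0 ∨ c ≠ 0) :
    ∃ w, IsCyclic ((a • D.e + c • D.f : D.sp) : Module.End ℂ V) w := by
  have hn := D.one_le
  by_cases ha : a = 0
  · refine ⟨D.vec 0, ?_⟩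
    have hc : c ≠ 0 := hac.resolve_left fun h => h ha
    rw [ha, zero_smul, zero_add]
    refine IsCyclic.smul (T := D.F) ?_ hc
    rw [isCyclic_iff]
    intro S hS hF
    have hvec : ∀ k, D.vec k ∈ S := by
      intro k
      induction k with
      | zero => exact hS
      | succ k ih =>
        rw [← D.F_vec]
        exact hF _ ih
    rw [eq_top_iff]
    intro u _
    rw [D.sum_coord u]
    exact S.sum_mem fun i _ => S.smul_mem _ (hvec i)
  · refine ⟨D.vec (2 * n - 1), ?_⟩
    have h : a • D.e + c • D.f = a • D.kostantPoint (Pi.single ⟨0, by lia⟩ (c / a)) := by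
      have hf : D.fOdd 0 = D.f := Subtype.ext (pow_one _)
      rw [kostantPoint, Finset.sum_eq_single ⟨0, by lia⟩]
      · rw [Pi.single_eq_same, hf, smul_add, smul_smul, mul_div_cancel₀ _ ha]
      · intro j _ hj
        rw [Pi.single_eq_of_ne hj, zero_smul]
      · exact fun h => (h (Finset.mem_univ _)).elim
    rw [h]
    exact (D.isCyclic_kostantPoint _).smul ha

/-- The discriminant depends only on `x`, so a common prime divisor would too. Dividing the cyclic
determinant, it has no zeros at any `x` with a cyclic vector. A polynomial without zeros on a line
is constant there; applied in the plane of `e` and `f`, and then on the lines through the origin,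
this shows that the divisor is a nonzero constant. -/
theorem not_dvd_discFun {π : D.CoordX} (hπ : Prime π) (hcyc : π ∣ D.cyclicFun) :
    ¬ π ∣ D.discFun := by
  intro hdisc
  have hfst : IsPolyMap fun p : D.sp × V => (p.1, (0 : V)) :=
    isPolyMap_linear (LinearMap.inl ℂ D.sp V ∘ₗ LinearMap.fst ℂ D.sp V)
  have h1 : ∀ p : D.sp × V, π.1 p = π.1 (p.1, 0) := by
    intro p
    rw [← sub_eq_zero]
    obtain ⟨s, hs⟩ := D.exists_disc_ne_zero
    refine polyFun_eq_zero_of_dense (F := fun p => π.1 p - π.1 (p.1, 0)) (G := D.discFun.1)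
      (Subalgebra.sub_mem _ π.2 (hfst.comp_mem π.2)) D.discFun.2 ⟨(D.shift s.1, 0), hs⟩
      (fun p hp => ?_) p
    have h := line_const_of_ne_zero π.2 (p.1, 0) (0, p.2) (fun t => ?_) 1
    · simp only [one_smul, Prod.mk_add_mk, add_zero, zero_add] at h
      change π.1 p - π.1 (p.1, 0) = 0
      rw [← h, sub_self]
    · refine D.coordX_apply_ne_zero hdisc ?_
      change disc (((p.1, (0 : V)) + t • ((0 : D.sp), p.2)).1 : Module.End ℂ V) ≠ 0
      have hp' : disc (p.1 : Module.End ℂ V) ≠ 0 := hp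
      simpa using hp'
  have h2 : ∀ (x : D.sp) (v : V), IsCyclic (x : Module.End ℂ V) v → π.1 (x, 0) ≠ 0 := by
    intro x v hc
    rw [← h1 (x, v)]
    exact D.coordX_apply_ne_zero hcyc ((isCyclic_iff_cyclicDet D.basis).1 hc)
  have h3 : ∀ a c : ℂ, a ≠ 0 ∨ c ≠ 0 → π.1 (a • D.e + c • D.f, 0) ≠ 0 := by
    intro a c hac
    obtain ⟨w, hw⟩ := D.isCyclic_e_f hac
    exact h2 _ w hw
  have h4 : ∀ c : ℂ, c ≠ 0 → π.1 (D.e + c • D.f, 0) = π.1 (c • D.f, 0) := by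
    intro c hc
    have h := line_const_of_ne_zero π.2 (c • D.f, 0) (D.e, 0) (fun a => ?_) 1
    · simpa [add_comm] using h
    · have := h3 a c (Or.inr hc)
      simpa [add_comm] using this
  have h5 : π.1 (0, 0) ≠ 0 := by
    have hpoly : ∀ x : D.sp, IsPolyMap fun c : ℂ => (x + c • D.f, (0 : V)) := fun x =>
      IsPolyMap.prodMk ((isPolyMap_const _).add
        (IsPolyMap.smul (isPolyMap_scalar.1 isPolyMap_id) (isPolyMap_const _))) (isPolyMap_const _)
    have h := polyFun_eq_zero_of_dense (W := ℂ)
      (F := fun c => π.1 (D.e + c • D.f, 0) - π.1 (0 + c • D.f, 0)) (G := fun c => c)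
      (Subalgebra.sub_mem _ ((hpoly _).comp_mem π.2) ((hpoly _).comp_mem π.2))
      (isPolyMap_scalar.1 isPolyMap_id) ⟨1, one_ne_zero⟩
      (fun c hc => by simp only [zero_add, h4 c hc, sub_self]) 0
    -- Letting `c = 0` in the polynomial identity obtained from `h4` identifies the value at the
    -- origin with the nonzero value at `e`.
    have h6 := h3 1 0 (Or.inl one_ne_zero)
    simp only [zero_smul, add_zero, one_smul, sub_eq_zero] at h h6
    rwa [← h]
  have h6 : ∀ p, π.1 p - π.1 (0, 0) = 0 := by
    refine D.eq_zero_of_cyclic (Subalgebra.sub_mem _ π.2 (const_mem_polyFun _)) fun p hp => ?_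
    have h := line_const_of_ne_zero π.2 (0, 0) (p.1, 0) (fun t => ?_) 1
    · simp only [one_smul, Prod.mk_add_mk, add_zero, zero_add] at h
      change π.1 p - π.1 (0, 0) = 0
      rw [h1 p, h, sub_self]
    · have h7 : ((0 : D.sp), (0 : V)) + t • (p.1, (0 : V)) = (t • p.1, 0) := by simp
      rw [h7]
      by_cases ht : t = 0
      · rw [ht, zero_smul]
        exact h5
      · exact h2 _ p.2 (IsCyclic.smul hp ht)
  apply hπ.not_isUnit
  have h7 : π = algebraMap ℂ D.CoordX (π.1 (0, 0)) :=
    Subtype.ext (funext fun p => sub_eq_zero.1 (h6 p))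
  rw [h7]
  exact (IsUnit.mk0 _ h5).map _

/-- If `π` is prime and does not divide `a`, then the orbits of the pseudo-slice contain a zero of
`π` which is not a zero of `a`. -/
theorem exists_zero_of_prime {π a : D.CoordX} (hπ : Prime π) (ha : ¬ π ∣ a) :
    ∃ (g : D.Sp) (s : D.Slice), π.1 (D.act g s.1) = 0 ∧ a.1 (D.act g s.1) ≠ 0 := by
  classical
  by_cases hcyc : π ∣ D.cyclicFun
  swap
  · obtain ⟨p, hp, hap⟩ : ∃ p, π.1 p = 0 ∧ (a * D.cyclicFun).1 p ≠ 0 := by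
      by_contra! h
      exact (hπ.dvd_or_dvd (D.coordX_prime_dvd hπ h)).elim ha hcyc
    have hap' : a.1 p * D.cyclicFun.1 p ≠ 0 := hap
    obtain ⟨g, s, rfl⟩ := D.exists_act_slice_of_cyclic
      ((isCyclic_iff_cyclicDet D.basis).2 (right_ne_zero_of_mul hap'))
    exact ⟨g, s, hp, left_ne_zero_of_mul hap'⟩
  obtain ⟨⟨x, v⟩, hp, hap⟩ : ∃ p, π.1 p = 0 ∧ (a * D.discFun).1 p ≠ 0 := by
    by_contra! h
    exact (hπ.dvd_or_dvd (D.coordX_prime_dvd hπ h)).elim ha (D.not_dvd_discFun hπ hcyc)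
  have hap' : a.1 (x, v) * disc (x : Module.End ℂ V) ≠ 0 := hap
  have hav := left_ne_zero_of_mul hap'
  have hdx := right_ne_zero_of_mul hap'
  obtain ⟨τ, hτ⟩ := D.exists_charpoly_eq_sq x
  obtain ⟨hinj, h0⟩ := injective_of_not_sq_dvd (τ := τ) fun t ht =>
    not_sq_dvd_of_disc hdx t (by rwa [hτ])
  let t : Fin n ⊕ Fin n → ℂ := Sum.elim τ fun i => -τ i
  have hσ : ∀ k, t (Sum.swap k) = -t k := by
    rintro (i | i) <;> simp [t]
  have hsq : ∀ i j, τ i ^ 2 = τ j ^ 2 → i = j := fun i j h => hinj h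
  have ht : Function.Injective t := by
    rintro (i | i) (j | j) h <;> simp only [t, Sum.elim_inl, Sum.elim_inr] at h
    · rw [hsq i j (by rw [h])]
    · have hij := hsq i j (by rw [h, neg_sq])
      subst hij
      exact (h0 i (self_eq_neg.1 h)).elim
    · have hij := hsq i j (by rw [← h, neg_sq])
      subst hij
      exact (h0 i (neg_eq_self.1 h)).elim
    · rw [hsq i j (by rw [neg_inj.1 h])]
  have hroot : ∀ k, (LinearMap.charpoly (x : Module.End ℂ V)).eval (t k) = 0 := by
    intro k
    rw [hτ, eval_prod]
    rcases k with i | i <;>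
    exact Finset.prod_eq_zero (Finset.mem_univ i) (by simp [t])
  have hcard : Fintype.card (Fin n ⊕ Fin n) = Module.finrank ℂ V := by
    rw [D.finrank_V, Fintype.card_sum, Fintype.card_fin, two_mul]
  obtain ⟨b, hb⟩ := exists_eigenbasis (x : Module.End ℂ V) ht hroot hcard
  have hx : IsPolyMap fun v : V => (x, v) := (isPolyMap_const x).prodMk isPolyMap_id
  -- With `x` fixed, `π` has no zeros at vectors with all eigencoordinates nonzero; hence it
  -- vanishes on a whole coordinate hyperplane through `v`.
  let F : polyFun V := ⟨fun v => π.1 (x, v), hx.comp_mem π.2⟩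
  obtain ⟨k₀, hvk, hvan⟩ := exists_coord_vanish b (F := F) (fun w hw =>
    D.coordX_apply_ne_zero hcyc ((isCyclic_iff_cyclicDet D.basis).1
      (isCyclic_of_eigenbasis ht hb hw))) (w := v) hp
  -- On that hyperplane `a` is not identically zero, since it is nonzero at `v`, so `v` may be
  -- replaced by a vector whose other eigencoordinates are all nonzero.
  obtain ⟨v', hv'₀, hv', hav'⟩ : ∃ v', b.repr v' k₀ = 0 ∧ (∀ k, k ≠ k₀ → b.repr v' k ≠ 0) ∧
      a.1 (x, v') ≠ 0 := by
    let pr : V →ₗ[ℂ] V := LinearMap.id - (b.coord k₀).smulRight (b k₀)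
    have hpr : ∀ u, pr u = u - b.repr u k₀ • b k₀ := fun u => rfl
    have hpr₀ : ∀ u, b.repr (pr u) k₀ = 0 := by
      intro u
      simp [hpr]
    have hpr₁ : ∀ u k, k ≠ k₀ → b.repr (pr u) k = b.repr u k := by
      intro u k hk
      simp [hpr, hk.symm]
    by_contra! hcon
    rcases polyFun_eq_zero_or (F := fun u => a.1 (x, pr u))
      (G := fun u => ∏ k ∈ Finset.univ.erase k₀, b.coord k (pr u))
      (comp_linear_mem_polyFun pr (hx.comp_mem a.2))
      (prod_mem_polyFun fun k _ => dual_mem_polyFun (b.coord k ∘ₗ pr)) (fun u => by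
        by_cases hk : ∀ k, k ≠ k₀ → b.repr (pr u) k ≠ 0
        · rw [hcon _ (hpr₀ u) hk, zero_mul]
        · push Not at hk
          obtain ⟨k, hk, hk'⟩ := hk
          exact mul_eq_zero_of_right _
            (Finset.prod_eq_zero (Finset.mem_erase.2 ⟨hk, Finset.mem_univ k⟩) hk'))
      with h | h
    · apply hav
      have h1 := congrFun h v
      simp only [hpr, hvk, zero_smul, sub_zero] at h1
      exact h1
    · have h1 := congrFun h (∑ k, b k)
      simp only [Pi.zero_apply] at h1
      rw [Finset.prod_eq_zero_iff] at h1
      obtain ⟨k, hk, hk'⟩ := h1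
      rw [Module.Basis.coord_apply, hpr₁ _ _ (Finset.ne_of_mem_erase hk), map_sum,
        Finsupp.finsetSum_apply, Finset.sum_eq_single k] at hk'
      · simp at hk'
      · intro i _ hik
        simp [hik]
      · exact fun h => (h (Finset.mem_univ k)).elim
  obtain ⟨ρ, hρ⟩ := D.exists_charpoly_eq_sq (D.shift (x, v'))
  -- The signs are chosen so that `-t k₀` is not in the spectrum on `L`. This makes the coordinate
  -- of index `σ k₀` nonzero on the slice, so the zero of the product for the pair falls on `k₀`, as
  -- for `v'`.
  let ρ' : Fin n → ℂ := fun i => if ρ i = -t k₀ then t k₀ else ρ i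
  have hρ' : ∀ i, ρ' i ^ 2 = ρ i ^ 2 := by
    intro i
    simp only [ρ']
    split_ifs with h
    · rw [h, neg_sq]
    · rfl
  have htk₀ : t k₀ ≠ 0 := by
    rcases k₀ with i | i <;> simp [t, h0 i]
  obtain ⟨s, hs, hq⟩ := D.exists_slice x
    (monic_prod_of_monic _ _ fun i _ => monic_X_sub_C (ρ' i)) (natDegree_prod_X_sub_C ρ')
  obtain ⟨b', hb'⟩ := exists_eigenbasis (s.1.1 : Module.End ℂ V) ht
    (fun k => by rw [hs]; exact hroot k) hcard
  have hq₀ : (D.toGl s.1).charpoly.eval (-t k₀) ≠ 0 := by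
    rw [hq, eval_prod, Finset.prod_ne_zero_iff]
    intro i _
    rw [eval_sub, eval_X, eval_C, sub_ne_zero]
    intro h
    simp only [ρ'] at h
    split_ifs at h with h1
    · exact htk₀ (neg_eq_self.1 h)
    · exact h1 h.symm
  have hr : LinearMap.charpoly (D.shift s.1 : Module.End ℂ V) =
      LinearMap.charpoly (D.shift (x, v') : Module.End ℂ V) := by
    rw [D.charpoly_shift_slice s hq, hρ]
    simp only [hρ']
  obtain ⟨g, hg⟩ := D.exists_act_eq_of_single (p := s.1) (p' := (x, v')) ht hσ Sum.swap_swap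
    (k₀ := k₀) (by rcases k₀ with i | i <;> simp) hb' hb hs hr hv'₀ hv'
    (D.repr_slice_ne_zero s ht hσ hb' hq₀)
  refine ⟨g, s, ?_, ?_⟩
  · rw [hg]
    exact hvan v' hv'₀
  · rw [hg]
    exact hav'

end PrimeDivisors

end Data

end PseudoSlice

theorem corollary3 (n : ℕ) (hn : 1 ≤ n) (V : Type*) [AddCommGroup V] [Module ℂ V]
    [FiniteDimensional ℂ V] (D : PseudoSlice.Data n V) :
    -- `x - v²` preserves `L` for `(x, v) ∈ Σ`
    (∀ s : D.Slice, ∀ w ∈ D.L, (D.shift s.1 : Module.End ℂ V) w ∈ D.L) ∧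
    -- `sp(V)//Sp(V) = Σ_sp`
    Function.Bijective D.kostantHom ∧
    -- `𝔐//Sp(V) = Σ_sp × Σ_gl`
    Function.Injective D.quotHom ∧ D.quotHom.range = D.invM ∧
    -- `Σ → 𝔐` is a well defined closed embedding, and it is a Weierstrass section
    (∃ ι : D.CoordM →ₐ[ℂ] D.CoordSlice, D.IsSliceHom ι ∧ Function.Surjective ι ∧
      Function.Bijective (ι.comp D.invM.val)) ∧
    -- `ℂ[sp(V) ⊕ V]` is the fibre product of `ℂ[Sp(V) × Σ]` and `ℂ(sp(V) ⊕ V)` over `ℂ(𝔐)`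
    IsDomain D.CoordX ∧ IsDomain D.CoordM ∧
    (∃ (μ : D.CoordM →ₐ[ℂ] D.CoordSpSlice)
      (j : D.CoordSpSlice →ₐ[ℂ] FractionRing D.CoordM)
      (i : FractionRing D.CoordX →ₐ[ℂ] FractionRing D.CoordM),
      D.IsOrbitHom μ ∧
      (∀ r : D.CoordM, j (μ r) = algebraMap D.CoordM (FractionRing D.CoordM) r) ∧
      (∀ j' : D.CoordSpSlice →ₐ[ℂ] FractionRing D.CoordM,
        (∀ r : D.CoordM, j' (μ r) = algebraMap D.CoordM (FractionRing D.CoordM) r) → j' = j) ∧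
      Function.Injective j ∧
      (∀ F : D.CoordX, i (algebraMap D.CoordX (FractionRing D.CoordX) F) =
        algebraMap D.CoordM (FractionRing D.CoordM) (F ⊗ₜ[D.InvSp] (1 : D.InvGl))) ∧
      ∀ (b : D.CoordSpSlice) (k : FractionRing D.CoordX), j b = i k →
        ∃! F : D.CoordX, μ (F ⊗ₜ[D.InvSp] (1 : D.InvGl)) = b ∧
          algebraMap D.CoordX (FractionRing D.CoordX) F = k) := by
  obtain ⟨j, hj, huniq, hinj⟩ := PseudoSlice.exists_embedding_fractionRing D.orbitHom
    D.orbitHom_injective D.exists_denominator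
  obtain ⟨i, hi⟩ := D.exists_fractionRing_hom
  exact ⟨fun s _ hw => D.shift_mem_L s hw, D.kostantHom_bijective, D.quotHom_injective,
    D.quotHom_range, ⟨D.sliceHom, D.isSliceHom_sliceHom, D.sliceHom_surjective,
      D.sliceHom_comp_invM_bijective⟩, inferInstance, inferInstance,
    ⟨D.orbitHom, j, i, D.isOrbitHom_orbitHom, hj, huniq, hinj, hi, fun _ _ hbk =>
      D.exists_unique_of_prime D.exists_zero_of_prime hj hinj hi hbk⟩⟩
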